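/- Setting. Let $d,\ell\ge 0$ be integers, let $\mathcal R\subset\mathbb Z^d$ be finite and nonempty, and let $\mathcal G$ be the additive subgroup of $\mathbb Z^d$ generated by $\mathcal R$. Let $(\Omega,\mathfrak S,\mathbb P)$ be a probability space with a group $\{T_x:x\in\mathcal G\}$ of measurable $\mathbb P$-preserving transformations satisfying $T_{x+y}=T_xT_y$, $T_0=\mathrm{id}$. The measure $\mathbb P$ is ergodic if $\mathbb P(A)\in\{0,1\}$ for every event $A$ with $T_z^{-1}A=A$ for all $z\in\mathcal R$. Let $P$ (expectation $E$) be the law of the random walk $X_0=0$, $X_n=Z_1+\dots+Z_n$, whose steps $Z_k$ are i.i.d. uniform on $\mathcal R$; write $Z_{k+1,k+\ell}=(Z_{k+1},\dots,Z_{k+\ell})$. Let $\mathcal U\subset\mathbb R^d$ be the convex hull of $\mathcal R$ and $\mathrm{ri}\,\mathcal U$ its relative interior. A measurable function $g:\Omega\times\mathcal R^\ell\to\mathbb R$ is in the class $\mathcal L$ if for each $\tilde z\in\mathcal R^\ell$ one has $g(\cdot,\tilde z)\in L^1(\mathbb P)$ and, for each nonzero $z\in\mathcal R$ and $\mathbb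 P$-a.e. $\omega$, $$\varlimsup_{\varepsilon\searrow0}\varlimsup_{n\to\infty}\max_{x\in\mathcal G:|x|\le n}\frac1n\sum_{0\le k\le\varepsilon n}|g(T_{x+kz}\omega,\tilde z)|=0 .$$ For each $\zeta\in\mathcal U$ fix weights $\beta_z(\zeta)\ge0$ with $\sum_{z\in\mathcal R}\beta_z(\zeta)=1$ and $\sum_{z\in\mathcal R}\beta_z(\zeta)z=\zeta$, rational if $\zeta\in\mathbb Q^d$, and numbers $b^{(n)}_z(\zeta)\in\{0,1\}$ with $b^{(n)}_z(\zeta)=0$ if $\beta_z(\zeta)=0$ and $\sum_z b^{(n)}_z(\zeta)=n-\sum_z\lfloor n\beta_z(\zeta)\rfloor$, and put $\hat x_n(\zeta)=\sum_{z\in\mathcal R}(\lfloor n\beta_z(\zeta)\rfloor+b^{(n)}_z(\zeta))z$. Define $$\Lambda_\ell(g;\omega)=\lim_{n\to\infty}\frac1n\log E\Big[e^{\sum_{k=0}^{n-1}g(T_{X_k}\omega,Z_{k+1,k+\ell})}\Big],$$ $$\Lambda_\ell(g,\zeta;\omega)=\lim_{n\to\infty}\frac1n\log E\Big[e^{\sum_{k=0}^{n-1}g(T_{X_k}\omega,Z_{k+1,k+\ell})}\mathbf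 1\{X_n=\hat x_n(\zeta)\}\Big]\quad(\zeta\in\mathcal U),$$ and $\Lambda_\ell(g,\zeta;\omega)=-\infty$ for $\zeta\notin\mathcal U$. Theorem. Let $g\in\mathcal L$ and let $\mathbb P$ be ergodic. Then for $\mathbb P$-a.e. $\omega$ the limits $\Lambda_\ell(g;\omega)$ and, simultaneously for all $\zeta\in\mathcal U$, $\Lambda_\ell(g,\zeta;\omega)$ exist in $(-\infty,\infty]$, and $\Lambda_\ell(g)$ is deterministic: there is a constant $\Lambda_\ell(g)\in(-\infty,\infty]$ with $\Lambda_\ell(g;\omega)=\Lambda_\ell(g)$ for $\mathbb P$-a.e. $\omega$. Moreover: (a) If $\Lambda_\ell(g)=\infty$, then for $\mathbb P$-a.e. $\omega$, $\Lambda_\ell(g,\zeta;\omega)=+\infty$ for all $\zeta\in\mathrm{ri}\,\mathcal U$. (b) If $\Lambda_\ell(g)<\infty$, then for $\mathbb P$-a.e. $\omega$ the function $\Lambda_\ell(g,\cdot\,;\omega)$ is lower semicontinuous and bounded on $\mathcal U$ and concave and continuous on $\mathrm{ri}\,\mathcal U$. Furthermore there is a deterministic function $h:\mathcal U\to\mathbb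 R$ such that for $\mathbb P$-a.e. $\omega$, $h$ is the unique continuous extension of $\Lambda_\ell(g,\cdot\,;\omega)$ from $\mathrm{ri}\,\mathcal U$ to $\mathcal U$, and $h$ equals on $\mathcal U$ the upper semicontinuous regularization $\zeta\mapsto\inf_{B\ni\zeta\text{ open}}\sup_{\zeta'\in B}\Lambda_\ell(g,\zeta';\omega)$. -/

import Mathlib

open Filter Topology MeasureTheory
open scoped ENNReal

noncomputable section

namespace RWRP

variable {d : ℕ}

/-- The additive subgroup of `ℤ^d` generated by the finite step set `R`. -/
abbrev stepGroup (R : Finset (Fin d → ℤ)) : AddSubgroup (Fin d → ℤ) :=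
  AddSubgroup.closure (R : Set (Fin d → ℤ))

/-- A step, as an element of the group generated by all steps. -/
def step {R : Finset (Fin d → ℤ)} (z : R) : stepGroup R :=
  ⟨z.1, AddSubgroup.subset_closure z.2⟩

/-- The inclusion of `ℤ^d` in Euclidean space `ℝ^d`. -/
def toReal (x : Fin d → ℤ) : EuclideanSpace ℝ (Fin d) :=
  WithLp.toLp 2 (fun i => (x i : ℝ))

/-- The convex hull `U` of the step set in `ℝ^d`. -/
def hull (R : Finset (Fin d → ℤ)) : Set (EuclideanSpace ℝ (Fin d)) :=
  convexHull ℝ (toReal '' (R : Set (Fin d → ℤ)))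

/-- The relative interior of `U`. -/
def riHull (R : Finset (Fin d → ℤ)) : Set (EuclideanSpace ℝ (Fin d)) :=
  intrinsicInterior ℝ (hull R)

/-- The law of the random walk, through its sequence of steps: the steps are independent and
uniformly distributed on `R`. The coordinate `s k` is the step `Z_{k+1}`. -/
def walkLaw (R : Finset (Fin d → ℤ)) [Nonempty R] : Measure (ℕ → R) :=
  Measure.infinitePi (fun _ : ℕ => (PMF.uniformOfFintype R).toMeasure)

/-- The position `X_n = Z_1 + ⋯ + Z_n` of the walk. -/
def pos {R : Finset (Fin d → ℤ)} (s : ℕ → R) (n : ℕ) : stepGroup R :=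
  ∑ k ∈ Finset.range n, step (s k)

/-- The vector of steps `(Z_{k+1}, …, Z_{k+ℓ})`. -/
def stepBlock {R : Finset (Fin d → ℤ)} (ℓ : ℕ) (s : ℕ → R) (k : ℕ) : Fin ℓ → R :=
  fun i => s (k + i)

section Environment

variable {ℓ : ℕ} (R : Finset (Fin d → ℤ)) {Ω : Type*} [AddAction (stepGroup R) Ω]

/-- Ergodicity: every event that is invariant under all `T_z`, `z ∈ R`, is trivial.
Here `T_x ω = x +ᵥ ω`. -/
def IsErgodic [MeasurableSpace Ω] (ℙ : Measure Ω) : Prop :=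
  ∀ A : Set Ω, MeasurableSet A → (∀ z : R, (fun ω => step z +ᵥ ω) ⁻¹' A = A) →
    ℙ A = 0 ∨ ℙ A = 1

/-- The class `𝓛` of potentials `g : Ω × R^ℓ → ℝ`. -/
def MemClassL [MeasurableSpace Ω] (ℙ : Measure Ω) (g : Ω → (Fin ℓ → R) → ℝ) : Prop :=
  ∀ w : Fin ℓ → R,
    Measurable (fun ω => g ω w) ∧
    Integrable (fun ω => g ω w) ℙ ∧
    ∀ z : R, (z : Fin d → ℤ) ≠ 0 → ∀ᵐ ω ∂ℙ,
      limsup (fun ε : ℝ =>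
        limsup (fun n : ℕ =>
          ⨆ x : stepGroup R, ⨆ _ : ‖toReal (x : Fin d → ℤ)‖ ≤ n,
            ENNReal.ofReal ((n : ℝ)⁻¹ *
              ∑ k ∈ Finset.range (⌊ε * n⌋₊ + 1), |g ((x + k • step z) +ᵥ ω) w|)) atTop)
        (𝓝[>] (0 : ℝ)) = 0

/-- `∑_{k=0}^{n-1} g(T_{X_k} ω, Z_{k+1,k+ℓ})`. -/
def energy (g : Ω → (Fin ℓ → R) → ℝ) (ω : Ω) (n : ℕ) (s : ℕ → R) : ℝ :=
  ∑ k ∈ Finset.range n, g (pos s k +ᵥ ω) (stepBlock ℓ s k)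

/-- `n⁻¹ log E[exp(∑_{k<n} g(T_{X_k} ω, Z_{k+1,k+ℓ}))]`. -/
def logPartition [Nonempty R] (g : Ω → (Fin ℓ → R) → ℝ) (ω : Ω) (n : ℕ) : EReal :=
  ((n : ℝ)⁻¹ : ℝ) * ENNReal.log (∫⁻ s, ENNReal.ofReal (Real.exp (energy R g ω n s)) ∂walkLaw R)

/-- `n⁻¹ log E[exp(∑_{k<n} g(T_{X_k} ω, Z_{k+1,k+ℓ})) 1{X_n = y}]`. -/
def logPartitionAt [Nonempty R] (g : Ω → (Fin ℓ → R) → ℝ) (ω : Ω) (n : ℕ) (y : Fin d → ℤ) :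
    EReal :=
  ((n : ℝ)⁻¹ : ℝ) * ENNReal.log
    (∫⁻ s in {s : ℕ → R | (pos s n : Fin d → ℤ) = y},
      ENNReal.ofReal (Real.exp (energy R g ω n s)) ∂walkLaw R)

/-- The free energy `Λ_ℓ(g; ω)`. -/
def freeEnergy [Nonempty R] (g : Ω → (Fin ℓ → R) → ℝ) (ω : Ω) : EReal :=
  limUnder atTop (logPartition R g ω)

open Classical in
/-- The point-to-point free energy `Λ_ℓ(g, ζ; ω)`, relative to lattice points `xhat ζ n`
approximating `n ζ`, with the value `-∞` outside `U`. -/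
def pointFreeEnergy [Nonempty R] (xhat : EuclideanSpace ℝ (Fin d) → ℕ → Fin d → ℤ)
    (g : Ω → (Fin ℓ → R) → ℝ) (ω : Ω) (ζ : EuclideanSpace ℝ (Fin d)) : EReal :=
  if ζ ∈ hull R then limUnder atTop (fun n => logPartitionAt R g ω n (xhat ζ n)) else ⊥

end Environment

/-- The admissible sequences of lattice points `x n` approximating `n ζ`:
`x n = ∑_z (⌊n β_z⌋ + b_z^{(n)}) z` for a convex representation `ζ = ∑_z β_z z` (with rational
weights if `ζ` is rational) and numbers `b_z^{(n)} ∈ {0,1}` which vanish where `β_z = 0` and make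
the number of steps equal to `n`. -/
def IsLatticeApprox (R : Finset (Fin d → ℤ)) (ζ : EuclideanSpace ℝ (Fin d))
    (x : ℕ → Fin d → ℤ) : Prop :=
  ∃ (β : R → ℝ) (b : ℕ → R → ℕ),
    (∀ z, 0 ≤ β z) ∧ ∑ z, β z = 1 ∧ ∑ z, β z • toReal (z : Fin d → ℤ) = ζ ∧
    ((∀ i, ∃ q : ℚ, ζ i = q) → ∀ z, ∃ q : ℚ, β z = q) ∧
    (∀ n z, b n z = 0 ∨ b n z = 1) ∧
    (∀ n z, β z = 0 → b n z = 0) ∧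
    (∀ n : ℕ, ∑ z, (⌊(n : ℝ) * β z⌋₊ + b n z) = n) ∧
    (∀ n : ℕ, x n = ∑ z : R, (⌊(n : ℝ) * β z⌋₊ + b n z) • (z : Fin d → ℤ))

/-- The upper semicontinuous regularization
`f^usc(x) = inf_{B open, x ∈ B} sup_{y ∈ B} f(y)`. -/
def uscReg {X : Type*} [TopologicalSpace X] (f : X → EReal) (x : X) : EReal :=
  ⨅ B : Set X, ⨅ _ : IsOpen B ∧ x ∈ B, ⨆ y ∈ B, f y

/-- `h` is a (finite) continuous extension to `U` of the restriction of `f` to `ri U`; its values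
outside `U` are irrelevant. -/
def IsContExtension (R : Finset (Fin d → ℤ)) (f : EuclideanSpace ℝ (Fin d) → EReal)
    (h : EuclideanSpace ℝ (Fin d) → ℝ) : Prop :=
  ContinuousOn h (hull R) ∧ ∀ ζ ∈ riHull R, f ζ = h ζ

end RWRP

end

/-!
The proof describes a path of the walk by its count vector `c : R → ℕ`, where `c z` is the number
of steps `z`. The logarithm `logPart g ω c` of the point-to-point partition function with `∑ c z`
steps and endpoint `∑ c z • z` is superadditive along concatenation of paths, with the environment
shifted by the endpoint of the first path and up to an error `tailError` at the junction, which
arises because the potential sees the next `ℓ` steps (`logPart_add_ge`).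

*Typical environments.* A direct covering argument gives the superadditive ergodic theorem
(`ae_tendsto_of_almost_superadditive`), hence almost surely a growth rate of `logPart g ω` along
`m • κ` for each of the countably many `κ : R → ℕ`. The class `𝓛` says that prolonging a path of
length of order `n` by `ε n` steps, and the junction errors in a ball of radius of order `n`, cost
at most `δ n` with `δ` small when `ε` is (`logPart_extension`, `eventually_tailError_le`). For
fixed `ω` the growth rates and the prolongation bound are collected in `IsRegular`, and the rest
of the existence proof is deterministic. A regular function has a rate in every direction `β` of
the standard simplex, since the directions `κ` are dense enough for comparison from both sides
(`IsRegular.tendsto_rate`). The rate depends only on the point `∑ β z • z`: two weights with the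
same mean differ, up to bounded errors, by integer vectors that change neither the number of steps
nor the endpoint (`rate_eq_of_rep_eq`). As only polynomially many count vectors have a given
number of steps, the free energy is the supremum of the rates (`tendsto_of_max_count`).

*Shape.* If `θ β ≤ β'` for the weights, the rate at `β'` is at least `θ` times the rate at `β` up
to an additive constant, which is small when `θ` is near one (`IsRegular.rate_lower`,
`IsRegular.rate_lower_global`). The version with an arbitrary constant gives (a), because weights
in the relative interior are bounded below. The version with a small constant says that the rate
does not drop much along short initial pieces of segments (`SegmentLower`). In a polytope every
point near `ζ` lies on such a piece of a segment from `ζ`, so this yields lower semicontinuity on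
the hull, and also continuity on the relative interior, where the roles of the two points can be
exchanged.

*Nonrandomness.* The supremum of the rates, and the rate in a direction that charges all steps,
can only decrease when the environment is shifted by a step, as the step may be made first; by
ergodicity they are almost surely constant (`IsErgodic.ae_const_of_le`). When the free energy is
finite, continuity extends this to all points of the relative interior at once. Concavity follows
from superadditivity for two successive pieces of a path: the second starts at a moving point, but
the environment seen from there has the same law, so the second piece has its typical weight for
infinitely many `n` (`MemClassL.ae_rate_concave`).

*Extension.* A bounded concave function on the relative interior of a polytope extends
continuously to the polytope (`exists_continuous_extension`). By lower semicontinuity the rate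
lies below the extension `h`, and hence `h` is its upper semicontinuous regularization
(`uscReg_eq_of_isContExtension`).
-/

noncomputable section

namespace RWRP

/-! ### Pointwise ergodic theorems -/

section Ergodic

variable {Ω : Type*} {T : Ω → Ω} {F : ℕ → Ω → ℝ}

/-- The event that the upper growth rate `limsup F n / n` exceeds `b`. -/
def exceedSet (F : ℕ → Ω → ℝ) (b : ℝ) : Set Ω :=
  {ω | ∃ q : ℚ, b < q ∧ ∃ᶠ n : ℕ in atTop, (q : ℝ) * n < F n ω}

/-- The part of `exceedSet F b` on which the rate `b` is not yet reached at any time up to `N`. -/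
def lateSet (F : ℕ → Ω → ℝ) (b : ℝ) (N : ℕ) : Set Ω :=
  exceedSet F b ∩ {ω | ∀ n : ℕ, 1 ≤ n → n ≤ N → F n ω < b * n}

/-- The greedy block decomposition of an orbit: the orbit is cut into blocks of length at most `N`
on each of which `F` grows at rate `b`, and single points of the set `B` where there is no such
block. -/
lemma greedy_blocks (hF0 : ∀ n ω, 1 ≤ n → 0 ≤ F n ω)
    (hsup : ∀ m n ω, 1 ≤ m → 1 ≤ n → F m ω + F n (T^[m] ω) ≤ F (m + n) ω)
    {b : ℝ} (hb : 0 ≤ b) (N : ℕ) (D B : Set Ω)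
    (hB : ∀ ω ∈ D, ω ∉ B → ∃ n : ℕ, 1 ≤ n ∧ n ≤ N ∧ b * n ≤ F n ω) :
    ∀ L : ℕ, 1 ≤ L → ∀ ω, (∀ k, T^[k] ω ∈ D) →
      b * ((L : ℝ) - N) ≤ F L ω + b * birkhoffSum T (B.indicator fun _ => (1 : ℝ)) L ω := by
  have hS0 : ∀ (L : ℕ) (ω : Ω), 0 ≤ birkhoffSum T (B.indicator fun _ => (1 : ℝ)) L ω := by
    intro L ω
    exact Finset.sum_nonneg fun k _ => Set.indicator_nonneg (fun _ _ => zero_le_one) _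
  intro L
  induction L using Nat.strong_induction_on with
  | _ L ih =>
    intro hL ω hω
    have hshift : ∀ m, ∀ k, T^[k] (T^[m] ω) ∈ D := by
      intro m k
      rw [← Function.iterate_add_apply]
      exact hω _
    rcases le_or_gt L N with hLN | hLN
    · have h1 : (L : ℝ) ≤ N := by exact_mod_cast hLN
      have h2 := hF0 L ω hL
      have h3 := mul_nonneg hb (hS0 L ω)
      nlinarith
    · have key : ∀ n : ℕ, 1 ≤ n → n < L →
          b * n ≤ F n ω + b * birkhoffSum T (B.indicator fun _ => (1 : ℝ)) n ω →
          b * ((L : ℝ) - N) ≤ F L ω + b * birkhoffSum T (B.indicator fun _ => (1 : ℝ)) L ω := by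
        intro n hn hnL hbn
        obtain ⟨m, rfl⟩ := Nat.exists_eq_add_of_lt hnL
        have h1 := ih (m + 1) (by omega) (by omega) (T^[n] ω) (hshift n)
        have h2 := hsup n (m + 1) ω hn (by omega)
        have h3 := birkhoffSum_add T (B.indicator fun _ => (1 : ℝ)) n (m + 1) ω
        rw [← add_assoc] at h2 h3
        rw [h3]
        push_cast at h1 ⊢
        linarith
      by_cases hωB : ω ∈ B
      · rcases Nat.eq_zero_or_pos N with rfl | hN
        · rcases Nat.lt_or_ge 1 L with h1L | h1L
          · refine key 1 le_rfl h1L ?_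
            have := hF0 1 ω le_rfl
            rw [birkhoffSum_one, Set.indicator_of_mem hωB]
            push_cast; linarith
          · obtain rfl : L = 1 := le_antisymm h1L hL
            have := hF0 1 ω le_rfl
            rw [birkhoffSum_one, Set.indicator_of_mem hωB]
            push_cast; linarith
        · refine key 1 le_rfl (by omega) ?_
          have := hF0 1 ω le_rfl
          rw [birkhoffSum_one, Set.indicator_of_mem hωB]
          push_cast; linarith
      · obtain ⟨n, hn1, hnN, hbn⟩ := hB ω (by simpa using hω 0) hωB
        refine key n hn1 (by omega) ?_
        have := mul_nonneg hb (hS0 n ω)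
        linarith

lemma exceedSet_preimage_subset (hF0 : ∀ n ω, 1 ≤ n → 0 ≤ F n ω)
    (hsup : ∀ m n ω, 1 ≤ m → 1 ≤ n → F m ω + F n (T^[m] ω) ≤ F (m + n) ω) (b : ℝ) :
    T ⁻¹' exceedSet F b ⊆ exceedSet F b := by
  rintro ω ⟨q, hq, hfr⟩
  obtain ⟨r, hbr, hrq⟩ := exists_rat_btwn hq
  refine ⟨r, hbr, ?_⟩
  -- the rate drops from `q` to `r` to absorb the factor `n / (n + 1)`
  have hlarge : ∀ᶠ n : ℕ in atTop, 1 ≤ n ∧ (r : ℝ) * (n + 1 : ℕ) ≤ q * n := by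
    have h1 : ∀ᶠ n : ℕ in atTop, (r : ℝ) / (q - r) ≤ n :=
      tendsto_natCast_atTop_atTop.eventually_ge_atTop _
    filter_upwards [h1, eventually_ge_atTop 1] with n hn hn1
    refine ⟨hn1, ?_⟩
    rw [div_le_iff₀ (by linarith)] at hn
    push_cast
    linarith
  have h2 : ∃ᶠ n : ℕ in atTop, (r : ℝ) * (n + 1 : ℕ) < F (n + 1) ω := by
    refine (hfr.and_eventually hlarge).mono ?_
    rintro n ⟨h, hn1, hn⟩
    have h3 := hsup 1 n ω le_rfl hn1
    have h4 := hF0 1 ω le_rfl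
    rw [add_comm 1 n] at h3
    simp only [Function.iterate_one] at h3
    linarith
  exact (tendsto_add_atTop_nat 1).frequently h2

variable [MeasurableSpace Ω] {μ : Measure Ω}

lemma measurableSet_frequently_atTop {p : ℕ → Ω → Prop}
    (hp : ∀ n, MeasurableSet {ω | p n ω}) : MeasurableSet {ω | ∃ᶠ n in atTop, p n ω} := by
  have : {ω | ∃ᶠ n in atTop, p n ω} = ⋂ N : ℕ, ⋃ n : ℕ, ⋃ _ : N ≤ n, {ω | p n ω} := by
    ext ω
    simp [frequently_atTop]
  rw [this]
  exact MeasurableSet.iInter fun N => MeasurableSet.iUnion fun n => MeasurableSet.iUnion fun _ => hp n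

lemma measurableSet_exceedSet (hF : ∀ n, Measurable (F n)) (b : ℝ) :
    MeasurableSet (exceedSet F b) := by
  have : exceedSet F b = ⋃ q : ℚ, ⋃ _ : b < q,
      {ω | ∃ᶠ n : ℕ in atTop, (q : ℝ) * n < F n ω} := by
    ext ω
    simp [exceedSet]
  rw [this]
  exact MeasurableSet.iUnion fun q => MeasurableSet.iUnion fun _ =>
    measurableSet_frequently_atTop fun n => measurableSet_lt measurable_const (hF n)

lemma measurableSet_lateSet (hF : ∀ n, Measurable (F n)) (b : ℝ) (N : ℕ) :
    MeasurableSet (lateSet F b N) := by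
  refine (measurableSet_exceedSet hF b).inter ?_
  have : {ω | ∀ n : ℕ, 1 ≤ n → n ≤ N → F n ω < b * n} =
      ⋂ n : ℕ, ⋂ _ : 1 ≤ n, ⋂ _ : n ≤ N, {ω | F n ω < b * n} := by
    ext ω; simp
  rw [this]
  exact MeasurableSet.iInter fun n => MeasurableSet.iInter fun _ => MeasurableSet.iInter fun _ =>
    measurableSet_lt (hF n) measurable_const

lemma tendsto_measureReal_lateSet [IsFiniteMeasure μ] (hF : ∀ n, Measurable (F n)) (b : ℝ) :
    Tendsto (fun N => μ.real (lateSet F b N)) atTop (𝓝 0) := by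
  have hanti : Antitone (lateSet F b) := fun M N hMN ω hω =>
    ⟨hω.1, fun n h1 h2 => hω.2 n h1 (h2.trans hMN)⟩
  have hempty : ⋂ N, lateSet F b N = ∅ := by
    ext ω
    simp only [Set.mem_iInter, Set.mem_empty_iff_false, iff_false]
    intro h
    obtain ⟨q, hq, hfr⟩ := (h 0).1
    obtain ⟨n, hn, hn1⟩ := (hfr.and_eventually (eventually_ge_atTop 1)).exists
    have h1 := (h n).2 n hn1 le_rfl
    have : b * n ≤ q * n := mul_le_mul_of_nonneg_right hq.le (Nat.cast_nonneg n)
    linarith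
  have h := tendsto_measure_iInter_atTop (μ := μ)
    (fun N => (measurableSet_lateSet hF b N).nullMeasurableSet) hanti ⟨0, measure_ne_top _ _⟩
  rw [hempty, measure_empty] at h
  simpa [Measure.real, Function.comp_def] using (ENNReal.tendsto_toReal ENNReal.zero_ne_top).comp h

lemma ae_iterate_mem_of_preimage_subset [IsFiniteMeasure μ] (hT : MeasurePreserving T μ μ)
    {D : Set Ω} (hD : MeasurableSet D) (h : T ⁻¹' D ⊆ D) :
    ∀ᵐ ω ∂μ, ω ∈ D → ∀ k, T^[k] ω ∈ D := by
  have hk : ∀ k, ∀ᵐ ω ∂μ, ω ∈ D → T^[k] ω ∈ D := by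
    intro k
    have hsub : T^[k] ⁻¹' D ⊆ D := by
      induction k with
      | zero => simp
      | succ k ih =>
        intro ω hω
        rw [Set.mem_preimage, Function.iterate_succ_apply] at hω
        exact h (ih hω)
    have heq := ae_eq_of_subset_of_measure_ge hsub ((hT.iterate k).measure_preimage hD.nullMeasurableSet).ge
      ((hT.iterate k).measurable hD).nullMeasurableSet (measure_ne_top _ _)
    filter_upwards [heq] with ω hω hωD
    have : (T^[k] ⁻¹' D) ω := by rw [hω]; exact hωD
    exact this
  filter_upwards [ae_all_iff.2 hk] with ω hω hωD k using hω k hωD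

lemma measurable_birkhoffSum (hT : Measurable T) {f : Ω → ℝ} (hf : Measurable f) (n : ℕ) :
    Measurable (birkhoffSum T f n) :=
  Finset.measurable_sum _ fun k _ => hf.comp (hT.iterate k)

lemma integrable_birkhoffSum (hT : MeasurePreserving T μ μ) {f : Ω → ℝ} (hf : Integrable f μ)
    (n : ℕ) : Integrable (birkhoffSum T f n) μ :=
  integrable_finsetSum _ fun k _ => (hT.iterate k).integrable_comp_of_integrable hf

lemma integral_birkhoffSum (hT : MeasurePreserving T μ μ) {f : Ω → ℝ} (hf : Integrable f μ)
    (n : ℕ) : ∫ ω, birkhoffSum T f n ω ∂μ = n * ∫ ω, f ω ∂μ := by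
  unfold birkhoffSum
  have hint : ∀ k ∈ Finset.range n, Integrable (fun ω => f (T^[k] ω)) μ :=
    fun k _ => (hT.iterate k).integrable_comp_of_integrable hf
  rw [integral_finsetSum _ hint]
  have : ∀ k ∈ Finset.range n, ∫ ω, f (T^[k] ω) ∂μ = ∫ ω, f ω ∂μ := by
    intro k _
    have h1 := (hT.iterate k).map_eq
    conv_rhs => rw [← h1]
    rw [integral_map (hT.iterate k).aemeasurable (by rw [h1]; exact hf.1)]
  rw [Finset.sum_congr rfl this]
  simp

lemma ae_greedy [IsFiniteMeasure μ] (hT : MeasurePreserving T μ μ) (hF : ∀ n, Measurable (F n))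
    (hF0 : ∀ n ω, 1 ≤ n → 0 ≤ F n ω)
    (hsup : ∀ m n ω, 1 ≤ m → 1 ≤ n → F m ω + F n (T^[m] ω) ≤ F (m + n) ω)
    {b : ℝ} (hb : 0 ≤ b) :
    ∀ᵐ ω ∂μ, ω ∈ exceedSet F b → ∀ N L : ℕ, 1 ≤ L → b * ((L : ℝ) - N) ≤
      F L ω + b * birkhoffSum T ((lateSet F b N).indicator fun _ => (1 : ℝ)) L ω := by
  filter_upwards [ae_iterate_mem_of_preimage_subset hT (measurableSet_exceedSet hF b)
    (exceedSet_preimage_subset hF0 hsup b)] with ω hω hωD N L hL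
  refine greedy_blocks hF0 hsup hb N (exceedSet F b) (lateSet F b N) ?_ L hL ω (hω hωD)
  intro ω' h1 h2
  by_contra hcon
  push Not at hcon
  exact h2 ⟨h1, hcon⟩

/-- The maximal inequality for the visits of an orbit to a set. -/
lemma maximal_inequality [IsFiniteMeasure μ] (hT : MeasurePreserving T μ μ) {B : Set Ω}
    (hB : MeasurableSet B) {b : ℝ} (hb : 0 ≤ b) :
    b * μ.real (exceedSet (birkhoffSum T (B.indicator fun _ => (1 : ℝ))) b) ≤ μ.real B := by
  set f : Ω → ℝ := B.indicator fun _ => (1 : ℝ) with hf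
  have hfm : Measurable f := measurable_const.indicator hB
  have hfint : ∀ {A : Set Ω}, MeasurableSet A → Integrable (A.indicator fun _ => (1 : ℝ)) μ :=
    fun hA => (integrable_const 1).indicator hA
  set F : ℕ → Ω → ℝ := birkhoffSum T f with hFdef
  have hF : ∀ n, Measurable (F n) := measurable_birkhoffSum hT.measurable hfm
  have hF0 : ∀ n ω, 0 ≤ F n ω := fun n ω =>
    Finset.sum_nonneg fun k _ => Set.indicator_nonneg (fun _ _ => zero_le_one) _
  have hDm := measurableSet_exceedSet hF b
  have hgreedy := ae_greedy hT hF (fun n ω _ => hF0 n ω)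
    (fun m n ω _ _ => (birkhoffSum_add T f m n ω).ge) hb
  have hint : ∀ N L : ℕ, 1 ≤ L → b * ((L : ℝ) - N) * μ.real (exceedSet F b) ≤
      L * (μ.real B + b * μ.real (lateSet F b N)) := by
    intro N L hL
    have hlm := measurableSet_lateSet hF b N
    rcases le_or_gt (L : ℝ) N with hLN | hLN
    · have h1 : b * ((L : ℝ) - N) * μ.real (exceedSet F b) ≤ 0 :=
        mul_nonpos_of_nonpos_of_nonneg (mul_nonpos_of_nonneg_of_nonpos hb (by linarith))
          measureReal_nonneg
      have h2 : 0 ≤ (L : ℝ) * (μ.real B + b * μ.real (lateSet F b N)) := by positivity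
      linarith
    · have h1 : ∫ ω, (exceedSet F b).indicator (fun _ => b * ((L : ℝ) - N)) ω ∂μ ≤
          ∫ ω, (F L ω + b * birkhoffSum T ((lateSet F b N).indicator fun _ => (1 : ℝ)) L ω) ∂μ := by
        refine integral_mono_ae ((integrable_const _).indicator hDm)
          ((integrable_birkhoffSum hT (hfint hB) L).add
            ((integrable_birkhoffSum hT (hfint hlm) L).const_mul b)) ?_
        filter_upwards [hgreedy] with ω hω
        by_cases hωD : ω ∈ exceedSet F b
        · rw [Set.indicator_of_mem hωD]
          exact hω hωD N L hL
        · rw [Set.indicator_of_notMem hωD]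
          have : 0 ≤ birkhoffSum T ((lateSet F b N).indicator fun _ => (1 : ℝ)) L ω :=
            Finset.sum_nonneg fun k _ => Set.indicator_nonneg (fun _ _ => zero_le_one) _
          have h3 := hF0 L ω
          positivity
      rw [integral_indicator_const _ hDm, integral_add (integrable_birkhoffSum hT (hfint hB) L)
        ((integrable_birkhoffSum hT (hfint hlm) L).const_mul b), integral_const_mul,
        integral_birkhoffSum hT (hfint hB), integral_birkhoffSum hT (hfint hlm),
        integral_indicator_const _ hB, integral_indicator_const _ hlm] at h1
      simp only [smul_eq_mul, mul_one] at h1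
      linarith
  have hN : ∀ N : ℕ, b * μ.real (exceedSet F b) ≤ μ.real B + b * μ.real (lateSet F b N) := by
    intro N
    have hlim : Tendsto (fun L : ℕ => b * (1 - (N : ℝ) / L) * μ.real (exceedSet F b)) atTop
        (𝓝 (b * (1 - 0) * μ.real (exceedSet F b))) :=
      ((tendsto_const_nhds.sub (tendsto_const_div_atTop_nhds_zero_nat _)).const_mul b).mul_const _
    rw [sub_zero, mul_one] at hlim
    refine le_of_tendsto hlim ?_
    filter_upwards [eventually_ge_atTop 1] with L hL
    have hL0 : (0 : ℝ) < L := by exact_mod_cast hL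
    have h1 := hint N L hL
    have h2 : b * ((L : ℝ) - N) * μ.real (exceedSet F b) =
        L * (b * (1 - (N : ℝ) / L) * μ.real (exceedSet F b)) := by
      field_simp
    rw [h2] at h1
    exact le_of_mul_le_mul_left h1 hL0
  have hlim := (tendsto_measureReal_lateSet (μ := μ) hF b).const_mul b |>.const_add (μ.real B)
  rw [mul_zero, add_zero] at hlim
  exact ge_of_tendsto' hlim hN

/-- The superadditive ergodic theorem for nonnegative processes, without integrability: the limit
may be infinite. -/
theorem ae_tendsto_of_superadditive_nonneg [IsFiniteMeasure μ] (hT : MeasurePreserving T μ μ)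
    (hF : ∀ n, Measurable (F n)) (hF0 : ∀ n ω, 1 ≤ n → 0 ≤ F n ω)
    (hsup : ∀ m n ω, 1 ≤ m → 1 ≤ n → F m ω + F n (T^[m] ω) ≤ F (m + n) ω) :
    ∀ᵐ ω ∂μ, ∃ l : EReal, Tendsto (fun n : ℕ => ((F n ω / n : ℝ) : EReal)) atTop (𝓝 l) := by
  have hpair : ∀ a b : ℚ, a < b → ∀ᵐ ω ∂μ,
      ¬ ((∃ᶠ n : ℕ in atTop, F n ω < a * n) ∧ ∃ᶠ n : ℕ in atTop, (b : ℝ) * n < F n ω) := by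
    intro a b hab
    rcases le_or_gt a 0 with ha | ha
    · refine Eventually.of_forall fun ω h => ?_
      obtain ⟨n, hn, hn1⟩ := (h.1.and_eventually (eventually_ge_atTop 1)).exists
      have h1 := hF0 n ω hn1
      have h2 : (a : ℝ) * n ≤ 0 :=
        mul_nonpos_of_nonpos_of_nonneg (by exact_mod_cast ha) (Nat.cast_nonneg n)
      linarith
    have ha' : (0 : ℝ) < a := by exact_mod_cast ha
    obtain ⟨c, hac, hcb⟩ := exists_between hab
    have hac' : (a : ℝ) < c := by exact_mod_cast hac
    have hc : (0 : ℝ) < c := ha'.trans hac'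
    have hcb' : (c : ℝ) < b := by exact_mod_cast hcb
    set E : Set Ω := exceedSet F c ∩ {ω | ∃ᶠ n : ℕ in atTop, F n ω < a * n} with hE
    have hEm : MeasurableSet E := (measurableSet_exceedSet hF c).inter
      (measurableSet_frequently_atTop fun n => measurableSet_lt (hF n) measurable_const)
    -- slow times force the orbit to visit the late set with positive frequency
    obtain ⟨p, hp0, hp⟩ : ∃ p : ℚ, (0 : ℝ) < p ∧ (p : ℝ) < (c - a) / (2 * c) := by
      obtain ⟨p, h1, h2⟩ := exists_rat_btwn (show (0 : ℝ) < (c - a) / (2 * c) by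
        apply div_pos <;> linarith)
      exact ⟨p, h1, h2⟩
    have hsub : ∀ N : ℕ, E ≤ᵐ[μ] exceedSet
        (birkhoffSum T ((lateSet F c N).indicator fun _ => (1 : ℝ))) (p / 2) := by
      intro N
      filter_upwards [ae_greedy hT hF hF0 hsup hc.le] with ω hω hωE
      refine ⟨p, by linarith, ?_⟩
      have hlarge : ∀ᶠ n : ℕ in atTop, 2 * c * N / (c - a) ≤ (n : ℝ) :=
        tendsto_natCast_atTop_atTop.eventually_ge_atTop _
      refine (hωE.2.and_eventually (hlarge.and (eventually_ge_atTop 1))).mono ?_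
      rintro n ⟨h1, h2, h3⟩
      have h4 := hω hωE.1 N n h3
      have hn0 : (0 : ℝ) < n := by exact_mod_cast h3
      rw [div_le_iff₀ (by linarith)] at h2
      rw [lt_div_iff₀ (by linarith)] at hp
      have h5 := mul_lt_mul_of_pos_right hp hn0
      have h6 : (c : ℝ) * (p * n) < c *
          birkhoffSum T ((lateSet F c N).indicator fun _ => (1 : ℝ)) n ω := by nlinarith
      exact lt_of_mul_lt_mul_left h6 hc.le
    have hbound : ∀ N : ℕ, (p / 2 : ℝ) * μ.real E ≤ μ.real (lateSet F c N) := by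
      intro N
      have h1 := maximal_inequality hT (measurableSet_lateSet hF c N) (b := (p / 2 : ℝ))
        (by positivity)
      have h2 : μ.real E ≤ μ.real (exceedSet
          (birkhoffSum T ((lateSet F c N).indicator fun _ => (1 : ℝ))) (p / 2)) :=
        ENNReal.toReal_mono (measure_ne_top _ _) (measure_mono_ae (hsub N))
      exact (mul_le_mul_of_nonneg_left h2 (by positivity)).trans h1
    have hE0 : (p / 2 : ℝ) * μ.real E ≤ 0 :=
      ge_of_tendsto' (tendsto_measureReal_lateSet (μ := μ) hF c) hbound
    have hE0' : μ E = 0 := by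
      have : μ.real E = 0 := le_antisymm
        (by by_contra h; push Not at h; have := mul_pos (half_pos hp0) h; linarith)
        measureReal_nonneg
      exact (measureReal_eq_zero_iff).1 this
    filter_upwards [measure_eq_zero_iff_ae_notMem.1 hE0'] with ω hω h
    exact hω ⟨⟨b, hcb', h.2⟩, h.1⟩
  have hall : ∀ᵐ ω ∂μ, ∀ a b : ℚ, a < b →
      ¬ ((∃ᶠ n : ℕ in atTop, F n ω < a * n) ∧ ∃ᶠ n : ℕ in atTop, (b : ℝ) * n < F n ω) := by
    simp only [ae_all_iff]
    exact hpair
  filter_upwards [hall] with ω hω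
  refine tendsto_of_no_upcrossings EReal.denseRange_ratCast ?_
  rintro _ ⟨a, rfl⟩ _ ⟨b, rfl⟩ hab ⟨h1, h2⟩
  refine hω a b (by exact_mod_cast EReal.coe_lt_coe_iff.1 hab) ⟨?_, ?_⟩
  · refine (h1.and_eventually (eventually_gt_atTop 0)).mono ?_
    rintro n ⟨h, hn⟩
    have hn0 : (0 : ℝ) < n := by exact_mod_cast hn
    rwa [EReal.coe_lt_coe_iff, div_lt_iff₀ hn0] at h
  · refine (h2.and_eventually (eventually_gt_atTop 0)).mono ?_
    rintro n ⟨h, hn⟩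
    have hn0 : (0 : ℝ) < n := by exact_mod_cast hn
    rwa [EReal.coe_lt_coe_iff, lt_div_iff₀ hn0] at h

/-- The pointwise ergodic theorem for nonnegative integrable functions. -/
theorem ae_tendsto_birkhoffSum_div [IsFiniteMeasure μ] (hT : MeasurePreserving T μ μ)
    {f : Ω → ℝ} (hfm : Measurable f) (hf0 : ∀ ω, 0 ≤ f ω) (hf : Integrable f μ) :
    ∀ᵐ ω ∂μ, ∃ l : ℝ, Tendsto (fun n : ℕ => birkhoffSum T f n ω / n) atTop (𝓝 l) := by
  have h1 := ae_tendsto_of_superadditive_nonneg hT (measurable_birkhoffSum hT.measurable hfm)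
    (fun n ω _ => Finset.sum_nonneg fun k _ => hf0 _)
    (fun m n ω _ _ => (birkhoffSum_add T f m n ω).ge)
  -- finiteness of the limit comes from Fatou's lemma
  have h2 : ∀ᵐ ω ∂μ, liminf (fun n : ℕ => ENNReal.ofReal (birkhoffSum T f n ω / n)) atTop < ⊤ := by
    have hm : ∀ n : ℕ, Measurable fun ω => ENNReal.ofReal (birkhoffSum T f n ω / n) := fun n =>
      ((measurable_birkhoffSum hT.measurable hfm n).div_const _).ennreal_ofReal
    refine ae_lt_top (Measurable.liminf hm) ?_
    refine ne_of_lt (lt_of_le_of_lt (lintegral_liminf_le hm) ?_)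
    refine lt_of_le_of_lt (liminf_le_of_frequently_le' (x := ENNReal.ofReal (∫ ω, f ω ∂μ)) ?_)
      ENNReal.ofReal_lt_top
    refine Eventually.frequently ?_
    filter_upwards [eventually_gt_atTop 0] with n hn
    have hn0 : (n : ℝ) ≠ 0 := by exact_mod_cast hn.ne'
    rw [← ofReal_integral_eq_lintegral_ofReal ((integrable_birkhoffSum hT hf n).div_const _)
      (Eventually.of_forall fun ω => div_nonneg (Finset.sum_nonneg fun k _ => hf0 _)
        (Nat.cast_nonneg n)), integral_div, integral_birkhoffSum hT hf,
      mul_div_cancel_left₀ _ hn0]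
  filter_upwards [h1, h2] with ω ⟨l, hl⟩ hω
  have hl0 : 0 ≤ l := ge_of_tendsto' hl fun n => by
    exact_mod_cast div_nonneg (Finset.sum_nonneg fun k _ => hf0 _) (Nat.cast_nonneg n)
  have hltop : l ≠ ⊤ := by
    rintro rfl
    have h3 : Tendsto (fun n : ℕ => ENNReal.ofReal (birkhoffSum T f n ω / n)) atTop (𝓝 ⊤) := by
      rw [ENNReal.tendsto_nhds_top_iff_nnreal]
      intro x
      rw [EReal.tendsto_nhds_top_iff_real] at hl
      filter_upwards [hl x] with n hn
      rw [EReal.coe_lt_coe_iff] at hn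
      rw [← ENNReal.ofReal_coe_nnreal]
      exact (ENNReal.ofReal_lt_ofReal_iff (lt_of_le_of_lt x.2 hn)).2 hn
    rw [h3.liminf_eq] at hω
    exact lt_irrefl _ hω
  have hlbot : l ≠ ⊥ := fun h => by simp [h] at hl0
  refine ⟨l.toReal, ?_⟩
  rw [← EReal.coe_toReal hltop hlbot] at hl
  exact EReal.tendsto_coe.1 hl

/-- The subadditive ergodic theorem, for processes which are superadditive up to a stationary
integrable error. The limit may be `+∞`. -/
theorem ae_tendsto_of_almost_superadditive [IsFiniteMeasure μ] (hT : MeasurePreserving T μ μ)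
    {G : ℕ → Ω → ℝ} (hG : ∀ n, Measurable (G n)) {err a : Ω → ℝ}
    (hem : Measurable err) (he0 : ∀ ω, 0 ≤ err ω) (he : Integrable err μ)
    (ham : Measurable a) (ha0 : ∀ ω, 0 ≤ a ω) (ha : Integrable a μ)
    (hsup : ∀ m n ω, 1 ≤ m → 1 ≤ n → G m ω + G n (T^[m] ω) - err (T^[m] ω) ≤ G (m + n) ω)
    (h1 : ∀ ω, -a ω ≤ G 1 ω) :
    ∀ᵐ ω ∂μ, ∃ l : EReal, Tendsto (fun n : ℕ => ((G n ω / n : ℝ) : EReal)) atTop (𝓝 l) := by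
  set f : Ω → ℝ := fun ω => a ω + err (T ω) with hf
  have hfm : Measurable f := ham.add (hem.comp hT.measurable)
  have hf0 : ∀ ω, 0 ≤ f ω := fun ω => add_nonneg (ha0 _) (he0 _)
  have hfi : Integrable f μ := ha.add (hT.integrable_comp_of_integrable he)
  set F : ℕ → Ω → ℝ := fun n ω => G n ω - err (T^[n] ω) + birkhoffSum T f n ω with hFdef
  have hFm : ∀ n, Measurable (F n) := fun n =>
    ((hG n).sub (hem.comp (hT.measurable.iterate n))).add (measurable_birkhoffSum hT.measurable hfm n)
  have hFs : ∀ m n ω, 1 ≤ m → 1 ≤ n → F m ω + F n (T^[m] ω) ≤ F (m + n) ω := by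
    intro m n ω hm hn
    have h2 := hsup m n ω hm hn
    have h3 := birkhoffSum_add T f m n ω
    simp only [hFdef]
    rw [h3, ← Function.iterate_add_apply, add_comm n m]
    linarith
  have hF0 : ∀ n ω, 1 ≤ n → 0 ≤ F n ω := by
    intro n ω hn
    have hone : ∀ ω, 0 ≤ F 1 ω := by
      intro ω
      simp only [hFdef, birkhoffSum_one, hf, Function.iterate_one]
      linarith [h1 ω]
    induction n, hn using Nat.le_induction generalizing ω with
    | base => exact hone ω
    | succ n hn ih =>
      have := hFs n 1 ω hn le_rfl
      linarith [ih ω, hone (T^[n] ω)]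
  filter_upwards [ae_tendsto_of_superadditive_nonneg hT hFm hF0 hFs,
    ae_tendsto_birkhoffSum_div hT hfm hf0 hfi, ae_tendsto_birkhoffSum_div hT hem he0 he]
    with ω ⟨l, hl⟩ ⟨r, hr⟩ ⟨e, hω⟩
  have herr : Tendsto (fun n : ℕ => err (T^[n] ω) / n) atTop (𝓝 0) := by
    have h2 : Tendsto (fun n : ℕ => birkhoffSum T err (n + 1) ω / (n + 1 : ℕ) * ((n + 1 : ℕ) / n : ℝ)
        - birkhoffSum T err n ω / n) atTop (𝓝 (e * 1 - e)) := by
      refine Tendsto.sub (Tendsto.mul (hω.comp (tendsto_add_atTop_nat 1)) ?_) hω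
      have h3 : Tendsto (fun n : ℕ => 1 + 1 / (n : ℝ)) atTop (𝓝 (1 + 0)) :=
        tendsto_const_nhds.add (tendsto_const_div_atTop_nhds_zero_nat _)
      rw [add_zero] at h3
      refine h3.congr' ?_
      filter_upwards [eventually_gt_atTop 0] with n hn
      have hn0 : (n : ℝ) ≠ 0 := by exact_mod_cast hn.ne'
      push_cast; field_simp
    rw [mul_one, sub_self] at h2
    refine h2.congr' ?_
    filter_upwards [eventually_gt_atTop 0] with n hn
    have hn0 : (n : ℝ) ≠ 0 := by exact_mod_cast hn.ne'
    have hn1 : ((n + 1 : ℕ) : ℝ) ≠ 0 := by positivity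
    rw [birkhoffSum_succ]
    field_simp
    ring
  have hdiff : Tendsto (fun n : ℕ => ((err (T^[n] ω) / n - birkhoffSum T f n ω / n : ℝ) : EReal)) atTop
      (𝓝 ((0 - r : ℝ) : EReal)) := EReal.tendsto_coe.2 (herr.sub hr)
  refine ⟨l + ((0 - r : ℝ) : EReal), ?_⟩
  have hadd := (EReal.continuousAt_add (p := (l, ((0 - r : ℝ) : EReal))) (Or.inr (EReal.coe_ne_bot _))
    (Or.inr (EReal.coe_ne_top _))).tendsto.comp (hl.prodMk_nhds hdiff)
  refine hadd.congr fun n => ?_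
  simp only [Function.comp_apply, ← EReal.coe_add, hFdef]
  congr 1
  ring

end Ergodic

end RWRP

end

noncomputable section

namespace RWRP

/-! ### Growth rates of regular functions of count vectors -/

section Rate

variable {d : ℕ} {ι : Type*} [Fintype ι]

/-- A function `q` of count vectors `c` is regular if it depends only on the number of steps and
the endpoint `∑ c i • z i`, if a small extension of `c` lowers it only by little, and if it has a
growth rate in every lattice direction. The logarithms of point-to-point partition functions in a
typical environment are the example. -/
structure IsRegular (z : ι → Fin d → ℤ) (q : (ι → ℕ) → ℝ) : Prop where
  congr : ∀ c c' : ι → ℕ, ∑ i, c i = ∑ i, c' i → ∑ i, c i • z i = ∑ i, c' i • z i → q c = q c'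
  ext : ∀ δ : ℝ, 0 < δ → ∃ ε : ℝ, 0 < ε ∧ ∃ n₀ : ℕ, ∀ n : ℕ, n₀ ≤ n → ∀ c e : ι → ℕ,
    ∑ i, c i ≤ 2 * n → ((∑ i, e i : ℕ) : ℝ) ≤ ε * n → q c - δ * n ≤ q (c + e)
  lim : ∀ κ : ι → ℕ, κ ≠ 0 →
    ∃ l : EReal, Tendsto (fun m : ℕ => ((q (m • κ) / m : ℝ) : EReal)) atTop (𝓝 l)

/-- The count vectors `c n` follow the weights `w`: they differ from `n w` by at most one in every
coordinate and vanish where `w` does. The weights need not sum to one. -/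
def IsApprox (w : ι → ℝ) (c : ℕ → ι → ℕ) : Prop :=
  ∀ n i, |(c n i : ℝ) - n * w i| ≤ 1 ∧ (w i = 0 → c n i = 0)

/-- The count vectors `⌊n w⌋`. -/
def floorCount (w : ι → ℝ) (n : ℕ) (i : ι) : ℕ := ⌊n * w i⌋₊

/-- The growth rate of `q` in direction `w`. -/
def rate (q : (ι → ℕ) → ℝ) (w : ι → ℝ) : EReal :=
  limsup (fun n : ℕ => ((q (floorCount w n) / n : ℝ) : EReal)) atTop

omit [Fintype ι] in
lemma isApprox_floorCount {w : ι → ℝ} (hw : ∀ i, 0 ≤ w i) : IsApprox w (floorCount w) := by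
  intro n i
  have h0 : 0 ≤ (n : ℝ) * w i := mul_nonneg (Nat.cast_nonneg n) (hw i)
  refine ⟨?_, fun h => by simp [floorCount, h]⟩
  have h1 := Nat.floor_le h0
  have h2 := Nat.lt_floor_add_one ((n : ℝ) * w i)
  rw [abs_le]
  constructor <;> simp only [floorCount] <;> linarith

omit [Fintype ι] in
lemma isApprox_smul (κ : ι → ℕ) : IsApprox (fun i => (κ i : ℝ)) fun m => m • κ := by
  intro n i
  refine ⟨by simp, fun h => ?_⟩
  have : κ i = 0 := by simpa using h
  simp [this]

lemma tendsto_floor_mul_div {a : ℝ} (ha : 0 ≤ a) :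
    Tendsto (fun n : ℕ => ((⌊a * n⌋₊ : ℕ) : ℝ) / n) atTop (𝓝 a) :=
  (tendsto_nat_floor_mul_div_atTop ha).comp tendsto_natCast_atTop_atTop

lemma tendsto_id_div : Tendsto (fun n : ℕ => ((n : ℕ) : ℝ) / n) atTop (𝓝 1) := by
  refine tendsto_const_nhds.congr' ?_
  filter_upwards [eventually_gt_atTop 0] with n hn
  have hn0 : (n : ℝ) ≠ 0 := by exact_mod_cast hn.ne'
  rw [div_self hn0]

lemma tendsto_atTop_of_div {τ : ℕ → ℕ} {t : ℝ} (ht : 0 < t)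
    (hτ : Tendsto (fun n : ℕ => (τ n : ℝ) / n) atTop (𝓝 t)) : Tendsto τ atTop atTop := by
  have h1 : Tendsto (fun n : ℕ => (τ n : ℝ) / n * n) atTop atTop :=
    hτ.pos_mul_atTop ht tendsto_natCast_atTop_atTop
  have h2 : Tendsto (fun n : ℕ => (τ n : ℝ)) atTop atTop := by
    refine h1.congr' ?_
    filter_upwards [eventually_gt_atTop 0] with n hn
    have hn0 : (n : ℝ) ≠ 0 := by exact_mod_cast hn.ne'
    field_simp
  exact tendsto_natCast_atTop_iff.1 h2

lemma le_limit_of_frequently_le {Q v : ℕ → ℝ} {τ : ℕ → ℕ} {t b : ℝ} {l : EReal} (ht : 0 < t)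
    (hQ : Tendsto (fun m : ℕ => ((Q m / m : ℝ) : EReal)) atTop (𝓝 l))
    (hτ : Tendsto (fun n : ℕ => (τ n : ℝ) / n) atTop (𝓝 t))
    (hv : Tendsto (fun n : ℕ => v n / n) atTop (𝓝 b))
    (hle : ∃ᶠ n in atTop, v n ≤ Q (τ n)) : ((b / t : ℝ) : EReal) ≤ l := by
  have hτ' := tendsto_atTop_of_div ht hτ
  have h1 : Tendsto (fun n : ℕ => ((v n / n / (τ n / n) : ℝ) : EReal)) atTop
      (𝓝 ((b / t : ℝ) : EReal)) := EReal.tendsto_coe.2 (hv.div hτ ht.ne')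
  refine le_of_tendsto_of_tendsto_of_frequently h1 (hQ.comp hτ') ?_
  refine (hle.and_eventually ((eventually_gt_atTop 0).and (hτ'.eventually_gt_atTop 0))).mono ?_
  rintro n ⟨h, hn, hm⟩
  have hn0 : (0 : ℝ) < n := by exact_mod_cast hn
  have hm0 : (0 : ℝ) < τ n := by exact_mod_cast hm
  rw [Function.comp_apply, EReal.coe_le_coe_iff, div_div_div_cancel_right₀ hn0.ne']
  exact div_le_div_of_nonneg_right h hm0.le

lemma limit_le_of_frequently_le {Q v : ℕ → ℝ} {τ : ℕ → ℕ} {t b : ℝ} {l : EReal} (ht : 0 < t)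
    (hQ : Tendsto (fun m : ℕ => ((Q m / m : ℝ) : EReal)) atTop (𝓝 l))
    (hτ : Tendsto (fun n : ℕ => (τ n : ℝ) / n) atTop (𝓝 t))
    (hv : Tendsto (fun n : ℕ => v n / n) atTop (𝓝 b))
    (hle : ∃ᶠ n in atTop, Q (τ n) ≤ v n) : l ≤ ((b / t : ℝ) : EReal) := by
  have hτ' := tendsto_atTop_of_div ht hτ
  have h1 : Tendsto (fun n : ℕ => ((v n / n / (τ n / n) : ℝ) : EReal)) atTop
      (𝓝 ((b / t : ℝ) : EReal)) := EReal.tendsto_coe.2 (hv.div hτ ht.ne')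
  refine le_of_tendsto_of_tendsto_of_frequently (hQ.comp hτ') h1 ?_
  refine (hle.and_eventually ((eventually_gt_atTop 0).and (hτ'.eventually_gt_atTop 0))).mono ?_
  rintro n ⟨h, hn, hm⟩
  have hn0 : (0 : ℝ) < n := by exact_mod_cast hn
  have hm0 : (0 : ℝ) < τ n := by exact_mod_cast hm
  rw [Function.comp_apply, EReal.coe_le_coe_iff, div_div_div_cancel_right₀ hn0.ne']
  exact div_le_div_of_nonneg_right h hm0.le

lemma tendsto_const_mul_div (b : ℝ) : Tendsto (fun n : ℕ => b * n / n) atTop (𝓝 b) := by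
  have := tendsto_id_div.const_mul b
  simpa [mul_div_assoc] using this

/-- The asymptotic form of a comparison between two sequences with growth rates. -/
lemma rate_le_of_eventually {P Q : ℕ → ℝ} {σ τ : ℕ → ℕ} {s t δ a : ℝ} {l l' : EReal}
    (hs : 0 < s) (ht : 0 < t)
    (hP : Tendsto (fun m : ℕ => ((P m / m : ℝ) : EReal)) atTop (𝓝 l))
    (hQ : Tendsto (fun m : ℕ => ((Q m / m : ℝ) : EReal)) atTop (𝓝 l'))
    (hσ : Tendsto (fun n : ℕ => (σ n : ℝ) / n) atTop (𝓝 s))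
    (hτ : Tendsto (fun n : ℕ => (τ n : ℝ) / n) atTop (𝓝 t))
    (hle : ∀ᶠ n : ℕ in atTop, P (σ n) - δ * n ≤ Q (τ n)) (ha : (a : EReal) < l) :
    (((s * a - δ) / t : ℝ) : EReal) ≤ l' := by
  have hσ' := tendsto_atTop_of_div hs hσ
  have h1 := hσ'.eventually ((tendsto_order.1 hP).1 _ ha)
  refine le_limit_of_frequently_le (v := fun n => a * σ n - δ * n) ht hQ hτ ?_ ?_
  · have h2 := (hσ.const_mul a).sub (tendsto_const_mul_div δ)
    rw [mul_comm s a]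
    refine h2.congr fun n => ?_
    ring
  · refine Eventually.frequently ?_
    filter_upwards [h1, hle, hσ'.eventually_gt_atTop 0] with n h2 h3 h4
    have hm0 : (0 : ℝ) < σ n := by exact_mod_cast h4
    rw [EReal.coe_lt_coe_iff, lt_div_iff₀ hm0] at h2
    linarith

/-- Sequences which follow proportionally larger weights eventually dominate. -/
lemma eventually_count_le {w w' : ι → ℝ} {c c' : ℕ → ι → ℕ} (hc : IsApprox w c)
    (hc' : IsApprox w' c') {σ τ : ℕ → ℕ} {s t : ℝ} (hw : ∀ i, 0 ≤ w i)
    (hσ : Tendsto (fun n : ℕ => (σ n : ℝ) / n) atTop (𝓝 s))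
    (hτ : Tendsto (fun n : ℕ => (τ n : ℝ) / n) atTop (𝓝 t))
    (hlt : ∀ i, 0 < w i → s * w i < t * w' i) :
    ∀ᶠ n : ℕ in atTop, c (σ n) ≤ c' (τ n) := by
  have hi : ∀ i, ∀ᶠ n : ℕ in atTop, c (σ n) i ≤ c' (τ n) i := by
    intro i
    rcases (hw i).eq_or_lt with h0 | h0
    · exact Eventually.of_forall fun n => by rw [(hc (σ n) i).2 h0.symm]; exact Nat.zero_le _
    · have h1 : Tendsto (fun n : ℕ => (σ n : ℝ) / n * w i + 2 / n) atTop (𝓝 (s * w i + 0)) :=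
        (hσ.mul_const _).add (tendsto_const_div_atTop_nhds_zero_nat 2)
      rw [add_zero] at h1
      filter_upwards [h1.eventually_lt (hτ.mul_const (w' i)) (hlt i h0), eventually_gt_atTop 0]
        with n hn hn0
      have hn0' : (0 : ℝ) < n := by exact_mod_cast hn0
      have h2 : (σ n : ℝ) * w i + 2 < τ n * w' i := by
        have := mul_lt_mul_of_pos_right hn hn0'
        field_simp at this
        linarith
      have h3 := (abs_le.1 (hc (σ n) i).1).2
      have h4 := (abs_le.1 (hc' (τ n) i).1).1
      have : (c (σ n) i : ℝ) ≤ c' (τ n) i := by linarith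
      exact_mod_cast this
  filter_upwards [eventually_all.2 hi] with n hn i using hn i

lemma tendsto_sum_count_div {w : ι → ℝ} {c : ℕ → ι → ℕ} (hc : IsApprox w c) {σ : ℕ → ℕ} {s : ℝ}
    (hσ : Tendsto (fun n : ℕ => (σ n : ℝ) / n) atTop (𝓝 s)) :
    Tendsto (fun n : ℕ => ((∑ i, c (σ n) i : ℕ) : ℝ) / n) atTop (𝓝 (s * ∑ i, w i)) := by
  have hi : ∀ i, Tendsto (fun n : ℕ => (c (σ n) i : ℝ) / n) atTop (𝓝 (s * w i)) := by
    intro i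
    have h1 : Tendsto (fun n : ℕ => ((c (σ n) i : ℝ) - σ n * w i) / n) atTop (𝓝 0) := by
      refine squeeze_zero_norm (a := fun n : ℕ => 1 / (n : ℝ)) (fun n => ?_)
        (tendsto_const_div_atTop_nhds_zero_nat 1)
      rw [norm_div, Real.norm_eq_abs, Real.norm_natCast]
      exact div_le_div_of_nonneg_right (hc (σ n) i).1 (Nat.cast_nonneg n)
    have h2 := h1.add (hσ.mul_const (w i))
    rw [zero_add] at h2
    refine h2.congr fun n => ?_
    ring
  have := tendsto_finsetSum Finset.univ fun i _ => hi i
  rw [Finset.mul_sum]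
  refine this.congr fun n => ?_
  push_cast
  rw [Finset.sum_div]

variable {z : ι → Fin d → ℤ} {q : (ι → ℕ) → ℝ}

/-- Comparison of `q` along nearby directions. -/
lemma IsRegular.compare (hq : IsRegular z q) {δ : ℝ} (hδ : 0 < δ) :
    ∃ ε : ℝ, 0 < ε ∧ ∀ (w w' : ι → ℝ) (c c' : ℕ → ι → ℕ) (σ τ : ℕ → ℕ) (s t : ℝ),
      IsApprox w c → IsApprox w' c' → (∀ i, 0 ≤ w i) →
      Tendsto (fun n : ℕ => (σ n : ℝ) / n) atTop (𝓝 s) →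
      Tendsto (fun n : ℕ => (τ n : ℝ) / n) atTop (𝓝 t) →
      (∀ i, 0 < w i → s * w i < t * w' i) → t * ∑ i, w' i < 2 →
      t * ∑ i, w' i - s * ∑ i, w i < ε →
      ∀ᶠ n : ℕ in atTop, q (c (σ n)) - δ * n ≤ q (c' (τ n)) := by
  obtain ⟨ε, hε, n₀, h⟩ := hq.ext δ hδ
  refine ⟨ε, hε, ?_⟩
  intro w w' c c' σ τ s t hc hc' hw hσ hτ hlt h2 hlt'
  have hS' := tendsto_sum_count_div hc' hτ
  have hS := tendsto_sum_count_div hc hσ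
  filter_upwards [eventually_count_le hc hc' hw hσ hτ hlt, eventually_ge_atTop n₀,
    eventually_gt_atTop 0, (tendsto_order.1 hS').2 _ h2, (tendsto_order.1 (hS'.sub hS)).2 _ hlt']
    with n hn hn₀ hn0 hn2 hnε
  have hn0' : (0 : ℝ) < n := by exact_mod_cast hn0
  have hsplit : ∑ i, c' (τ n) i = ∑ i, c (σ n) i + ∑ i, (c' (τ n) i - c (σ n) i) := by
    rw [← Finset.sum_add_distrib]
    exact Finset.sum_congr rfl fun i _ => (Nat.add_sub_cancel' (hn i)).symm
  have h3 := h n hn₀ (c (σ n)) (c' (τ n) - c (σ n)) ?_ ?_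
  · rwa [add_tsub_cancel_of_le hn] at h3
  · rw [div_lt_iff₀ hn0'] at hn2
    have : ∑ i, c' (τ n) i < 2 * n := by exact_mod_cast hn2
    omega
  · rw [← sub_div, div_lt_iff₀ hn0', hsplit] at hnε
    push_cast at hnε ⊢
    simp only [Pi.sub_apply]
    linarith

/-- The global lower bound: long extensions are made of boundedly many short ones. -/
lemma IsRegular.global_bound (hq : IsRegular z q) :
    ∃ K : ℝ, 0 ≤ K ∧ ∃ n₀ : ℕ, ∀ n : ℕ, n₀ ≤ n → ∀ c e : ι → ℕ, ∑ i, c i + ∑ i, e i ≤ 2 * n →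
      q c - K * n ≤ q (c + e) := by
  obtain ⟨ε, hε, n₁, h⟩ := hq.ext 1 one_pos
  obtain ⟨J, hJ⟩ := exists_nat_gt (2 / ε)
  have hJ0 : 0 < J := by
    have : (0 : ℝ) < J := lt_trans (by positivity) hJ
    exact_mod_cast this
  obtain ⟨n₂, hn₂⟩ := exists_nat_gt ((J * Fintype.card ι : ℝ) / ε)
  refine ⟨J + 1, by positivity, max n₁ n₂, ?_⟩
  intro n hn c e hce
  have hn1 : n₁ ≤ n := (le_max_left _ _).trans hn
  have hn2 : (n₂ : ℝ) ≤ n := by exact_mod_cast (le_max_right _ _).trans hn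
  set p : ι → ℕ := fun i => e i / J with hp
  set r : ι → ℕ := fun i => e i % J with hr
  have he : e = J • p + r := by
    funext i
    simp only [hp, hr, Pi.add_apply, Pi.smul_apply, smul_eq_mul]
    exact (Nat.div_add_mod _ _).symm
  have hesum : ∑ i, e i = J * ∑ i, p i + ∑ i, r i := by
    rw [Finset.mul_sum, ← Finset.sum_add_distrib]
    exact Finset.sum_congr rfl fun i _ => (Nat.div_add_mod _ _).symm
  have hpsum : ((∑ i, p i : ℕ) : ℝ) ≤ ε * n := by
    have h1 : J * ∑ i, p i ≤ 2 * n := by omega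
    have h2 : (J : ℝ) * (∑ i, p i : ℕ) ≤ 2 * n := by exact_mod_cast h1
    rw [div_lt_iff₀ hε] at hJ
    have hJ0' : (0 : ℝ) < J := by exact_mod_cast hJ0
    have h3 : (2 : ℝ) * n ≤ J * (ε * n) := by nlinarith [Nat.cast_nonneg (α := ℝ) n]
    exact le_of_mul_le_mul_left (h2.trans h3) hJ0'
  have hrsum : ((∑ i, r i : ℕ) : ℝ) ≤ ε * n := by
    have h1 : ∑ i, r i ≤ ∑ _i : ι, J := Finset.sum_le_sum fun i _ => (Nat.mod_lt _ hJ0).le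
    rw [Finset.sum_const, Finset.card_univ, smul_eq_mul] at h1
    have h2 : ((∑ i, r i : ℕ) : ℝ) ≤ Fintype.card ι * J := by exact_mod_cast h1
    rw [div_lt_iff₀ hε] at hn₂
    nlinarith
  have hstep : ∀ j, j ≤ J → q c - j * n ≤ q (c + j • p) := by
    intro j
    induction j with
    | zero => simp
    | succ j ih =>
      intro hj
      have h1 := ih (by omega)
      have h2 := h n hn1 (c + j • p) p ?_ hpsum
      · rw [succ_nsmul, ← add_assoc]
        push_cast
        linarith
      · have h3 : ∑ i, (c + j • p) i = ∑ i, c i + j * ∑ i, p i := by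
          simp [Finset.sum_add_distrib, Finset.mul_sum]
        have h4 : j * ∑ i, p i ≤ J * ∑ i, p i := Nat.mul_le_mul_right _ (by omega)
        omega
  have h1 := hstep J le_rfl
  have h2 := h n hn1 (c + J • p) r ?_ hrsum
  · rw [he, ← add_assoc]
    linarith
  · have h3 : ∑ i, (c + J • p) i = ∑ i, c i + J * ∑ i, p i := by
      simp [Finset.sum_add_distrib, Finset.mul_sum]
    omega

/-- The crude comparison of `q` along arbitrary ordered directions. -/
lemma IsRegular.compare_global (hq : IsRegular z q) :
    ∃ K : ℝ, 0 ≤ K ∧ ∀ (w w' : ι → ℝ) (c c' : ℕ → ι → ℕ) (σ τ : ℕ → ℕ) (s t : ℝ),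
      IsApprox w c → IsApprox w' c' → (∀ i, 0 ≤ w i) →
      Tendsto (fun n : ℕ => (σ n : ℝ) / n) atTop (𝓝 s) →
      Tendsto (fun n : ℕ => (τ n : ℝ) / n) atTop (𝓝 t) →
      (∀ i, 0 < w i → s * w i < t * w' i) → t * ∑ i, w' i < 2 →
      ∀ᶠ n : ℕ in atTop, q (c (σ n)) - K * n ≤ q (c' (τ n)) := by
  obtain ⟨K, hK, n₀, h⟩ := hq.global_bound
  refine ⟨K, hK, ?_⟩
  intro w w' c c' σ τ s t hc hc' hw hσ hτ hlt h2
  have hS' := tendsto_sum_count_div hc' hτ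
  filter_upwards [eventually_count_le hc hc' hw hσ hτ hlt, eventually_ge_atTop n₀,
    eventually_gt_atTop 0, (tendsto_order.1 hS').2 _ h2] with n hn hn₀ hn0 hn2
  have hn0' : (0 : ℝ) < n := by exact_mod_cast hn0
  have h3 := h n hn₀ (c (σ n)) (c' (τ n) - c (σ n)) ?_
  · rwa [add_tsub_cancel_of_le hn] at h3
  · rw [div_lt_iff₀ hn0'] at hn2
    have h4 : ∑ i, c' (τ n) i < 2 * n := by exact_mod_cast hn2
    rw [← Finset.sum_add_distrib]
    refine le_trans (Finset.sum_le_sum fun i _ => ?_) h4.le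
    exact (Nat.add_sub_cancel' (hn i)).le

omit [Fintype ι] in
/-- A rational direction with almost proportional weights and the same support. -/
lemma exists_floorCount_near [Finite ι] {β : ι → ℝ} {ε : ℝ} (hε : 0 < ε) :
    ∃ k : ℕ, 0 < k ∧ ∀ i, 0 < β i → (k : ℝ) * β i < (1 + ε) * floorCount β k i := by
  have hi : ∀ i, ∀ᶠ k : ℕ in atTop, 0 < β i → (k : ℝ) * β i < (1 + ε) * floorCount β k i := by
    intro i
    rcases le_or_gt (β i) 0 with h | h
    · exact Eventually.of_forall fun k hk => absurd hk (not_lt.2 h)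
    · have h1 : ∀ᶠ k : ℕ in atTop, (1 + ε) / (ε * β i) ≤ (k : ℝ) :=
        tendsto_natCast_atTop_atTop.eventually_ge_atTop _
      filter_upwards [h1] with k hk _
      rw [div_le_iff₀ (by positivity)] at hk
      have h2 := Nat.lt_floor_add_one ((k : ℝ) * β i)
      simp only [floorCount]
      nlinarith
  obtain ⟨k, hk, hk0⟩ := ((eventually_all.2 hi).and (eventually_gt_atTop 0)).exists
  exact ⟨k, hk0, hk⟩

lemma IsRegular.not_cross (hq : IsRegular z q) {β : ι → ℝ} (hβ : β ∈ stdSimplex ℝ ι)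
    {c c' : ℕ → ι → ℕ} (hc : IsApprox β c) (hc' : IsApprox β c') {a b : ℝ} (hab : a < b) :
    ¬ ((∃ᶠ n : ℕ in atTop, q (c n) < a * n) ∧ ∃ᶠ n : ℕ in atTop, b * n < q (c' n)) := by
  rintro ⟨hfa, hfb⟩
  obtain ⟨ε₁, hε₁, hcmp⟩ := hq.compare (δ := (b - a) / 8) (by linarith)
  set δ := (b - a) / 8 with hδ
  obtain ⟨ε, hε0, hε⟩ : ∃ ε : ℝ, 0 < ε ∧ ε < min (min (1 / 2) (ε₁ / 2)) ((b - a) / 2 / (|a| + |b| + 1)) :=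
    exists_between (by
      refine lt_min (lt_min (by norm_num) (by linarith)) (div_pos (by linarith) (by positivity)))
  have hε2 : ε < 1 / 2 := hε.trans_le ((min_le_left _ _).trans (min_le_left _ _))
  have hε3 : ε < ε₁ / 2 := hε.trans_le ((min_le_left _ _).trans (min_le_right _ _))
  have hε4 : ε * (|a| + |b| + 1) < (b - a) / 2 := by
    rw [← lt_div_iff₀ (by positivity)]
    exact hε.trans_le (min_le_right _ _)
  obtain ⟨k, hk0, hk⟩ := exists_floorCount_near (β := β) hε0
  set κ := floorCount β k with hκ
  have hk0' : (0 : ℝ) < k := by exact_mod_cast hk0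
  have hκle : ∀ i, (κ i : ℝ) ≤ k * β i := fun i =>
    Nat.floor_le (mul_nonneg hk0'.le (hβ.1 i))
  have hkκ : ∀ i, (k : ℝ) * β i ≤ (1 + ε) * κ i := by
    intro i
    rcases (hβ.1 i).eq_or_lt with h | h
    · rw [← h, mul_zero]; positivity
    · exact (hk i h).le
  have hκsum : ∑ i, (κ i : ℝ) ≤ k := by
    have := Finset.sum_le_sum fun i (_ : i ∈ Finset.univ) => hκle i
    rwa [← Finset.mul_sum, hβ.2, mul_one] at this
  have hκsum' : (k : ℝ) ≤ (1 + ε) * ∑ i, (κ i : ℝ) := by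
    have := Finset.sum_le_sum fun i (_ : i ∈ Finset.univ) => hkκ i
    rwa [← Finset.mul_sum, ← Finset.mul_sum, hβ.2, mul_one] at this
  have hκ0 : κ ≠ 0 := by
    intro h
    rw [h] at hκsum'
    simp at hκsum'
    linarith
  obtain ⟨l, hl⟩ := hq.lim κ hκ0
  have hlow := hcmp (fun i => (κ i : ℝ)) β (fun m => m • κ) c (fun n => ⌊(1 - ε) / k * n⌋₊) id
    ((1 - ε) / k) 1 (isApprox_smul κ) hc (fun i => Nat.cast_nonneg _)
    (tendsto_floor_mul_div (div_nonneg (by linarith) hk0'.le)) tendsto_id_div ?_ ?_ ?_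
  rotate_left
  · intro i hi
    rw [one_mul, div_mul_eq_mul_div, div_lt_iff₀ hk0']
    nlinarith [hκle i]
  · rw [hβ.2]; norm_num
  · rw [hβ.2, one_mul, div_mul_eq_mul_div]
    have : (1 - 2 * ε) ≤ (1 - ε) * (∑ i, (κ i : ℝ)) / k := by
      rw [le_div_iff₀ hk0']
      nlinarith
    linarith
  have hup := hcmp β (fun i => (κ i : ℝ)) c' (fun m => m • κ) id (fun n => ⌊(1 + ε) / k * n⌋₊)
    1 ((1 + ε) / k) hc' (isApprox_smul κ) hβ.1 tendsto_id_div
    (tendsto_floor_mul_div (div_nonneg (by linarith) hk0'.le)) ?_ ?_ ?_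
  rotate_left
  · intro i hi
    rw [one_mul, div_mul_eq_mul_div, lt_div_iff₀ hk0']
    linarith [hk i hi]
  · rw [div_mul_eq_mul_div, div_lt_iff₀ hk0']
    nlinarith
  · rw [hβ.2, one_mul, div_mul_eq_mul_div, sub_lt_iff_lt_add, div_lt_iff₀ hk0']
    nlinarith
  have h1 : l ≤ (((a + δ) / ((1 - ε) / k) : ℝ) : EReal) := by
    refine limit_le_of_frequently_le (v := fun n => (a + δ) * n) (div_pos (by linarith) hk0') hl
      (tendsto_floor_mul_div (div_nonneg (by linarith) hk0'.le)) (tendsto_const_mul_div _) ?_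
    refine (hfa.and_eventually hlow).mono ?_
    rintro n ⟨h1, h2⟩
    simp only [id] at h2
    linarith
  have h2 : (((b - δ) / ((1 + ε) / k) : ℝ) : EReal) ≤ l := by
    refine le_limit_of_frequently_le (v := fun n => (b - δ) * n) (div_pos (by linarith) hk0') hl
      (tendsto_floor_mul_div (div_nonneg (by linarith) hk0'.le)) (tendsto_const_mul_div _) ?_
    refine (hfb.and_eventually hup).mono ?_
    rintro n ⟨h1, h2⟩
    simp only [id] at h2
    linarith
  have h3 := h2.trans h1
  rw [EReal.coe_le_coe_iff, div_le_div_iff₀ (div_pos (by linarith) hk0') (div_pos (by linarith) hk0'),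
    mul_div_assoc', mul_div_assoc', div_le_div_iff_of_pos_right hk0'] at h3
  have h4 : ε * (a + b) ≤ ε * (|a| + |b| + 1) :=
    mul_le_mul_of_nonneg_left (by linarith [le_abs_self a, le_abs_self b]) hε0.le
  nlinarith

/-- The growth rate exists along every sequence of count vectors which follows `β`. -/
theorem IsRegular.tendsto_rate (hq : IsRegular z q) {β : ι → ℝ} (hβ : β ∈ stdSimplex ℝ ι)
    {c : ℕ → ι → ℕ} (hc : IsApprox β c) :
    Tendsto (fun n : ℕ => ((q (c n) / n : ℝ) : EReal)) atTop (𝓝 (rate q β)) := by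
  have conv : ∀ {c : ℕ → ι → ℕ}, IsApprox β c →
      ∃ l, Tendsto (fun n : ℕ => ((q (c n) / n : ℝ) : EReal)) atTop (𝓝 l) := by
    intro c hc
    refine tendsto_of_no_upcrossings EReal.denseRange_ratCast ?_
    rintro _ ⟨a, rfl⟩ _ ⟨b, rfl⟩ hab ⟨h1, h2⟩
    refine hq.not_cross hβ hc hc (EReal.coe_lt_coe_iff.1 hab) ⟨?_, ?_⟩
    · refine (h1.and_eventually (eventually_gt_atTop 0)).mono ?_
      rintro n ⟨h, hn⟩
      have hn0 : (0 : ℝ) < n := by exact_mod_cast hn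
      rwa [EReal.coe_lt_coe_iff, div_lt_iff₀ hn0] at h
    · refine (h2.and_eventually (eventually_gt_atTop 0)).mono ?_
      rintro n ⟨h, hn⟩
      have hn0 : (0 : ℝ) < n := by exact_mod_cast hn
      rwa [EReal.coe_lt_coe_iff, lt_div_iff₀ hn0] at h
  have uniq : ∀ {c c' : ℕ → ι → ℕ} {l l' : EReal}, IsApprox β c → IsApprox β c' →
      Tendsto (fun n : ℕ => ((q (c n) / n : ℝ) : EReal)) atTop (𝓝 l) →
      Tendsto (fun n : ℕ => ((q (c' n) / n : ℝ) : EReal)) atTop (𝓝 l') → l' ≤ l := by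
    intro c c' l l' hc hc' hl hl'
    by_contra! hlt
    obtain ⟨a, hla, hal⟩ := EReal.lt_iff_exists_real_btwn.1 hlt
    obtain ⟨b, hab, hbl⟩ := EReal.lt_iff_exists_real_btwn.1 hal
    refine hq.not_cross hβ hc hc' (EReal.coe_lt_coe_iff.1 hab) ⟨?_, ?_⟩
    · refine Eventually.frequently ?_
      filter_upwards [(tendsto_order.1 hl).2 _ hla, eventually_gt_atTop 0] with n h hn
      have hn0 : (0 : ℝ) < n := by exact_mod_cast hn
      rwa [EReal.coe_lt_coe_iff, div_lt_iff₀ hn0] at h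
    · refine Eventually.frequently ?_
      filter_upwards [(tendsto_order.1 hl').1 _ hbl, eventually_gt_atTop 0] with n h hn
      have hn0 : (0 : ℝ) < n := by exact_mod_cast hn
      rwa [EReal.coe_lt_coe_iff, lt_div_iff₀ hn0] at h
  have hfl := isApprox_floorCount hβ.1
  obtain ⟨l, hl⟩ := conv hc
  obtain ⟨l', hl'⟩ := conv hfl
  have : rate q β = l' := hl'.limsup_eq
  rw [this, le_antisymm (uniq hc hfl hl hl') (uniq hfl hc hl' hl)]
  exact hl

/-- Rates are bounded below, uniformly in the direction. -/
lemma IsRegular.rate_ge (hq : IsRegular z q) :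
    ∃ K : ℝ, 0 ≤ K ∧ ∀ β ∈ stdSimplex ℝ ι, ((-K : ℝ) : EReal) ≤ rate q β := by
  obtain ⟨K, hK, n₀, h⟩ := hq.global_bound
  refine ⟨K, hK, fun β hβ => ?_⟩
  have hfl := isApprox_floorCount hβ.1
  have h1 := tendsto_sum_count_div hfl tendsto_id_div
  rw [hβ.2, one_mul] at h1
  have h2 : Tendsto (fun n : ℕ => (q 0 - K * n) / n) atTop (𝓝 (0 - K)) := by
    simp only [sub_div]
    exact (tendsto_const_div_atTop_nhds_zero_nat _).sub (tendsto_const_mul_div K)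
  rw [zero_sub] at h2
  have h3 := le_limit_of_frequently_le (τ := id) (v := fun n => q 0 - K * n) one_pos
    (hq.tendsto_rate hβ hfl) tendsto_id_div h2 ?_
  · simpa using h3
  · refine Eventually.frequently ?_
    filter_upwards [(tendsto_order.1 h1).2 2 (by norm_num), eventually_ge_atTop n₀,
      eventually_gt_atTop 0] with n hn hn0 hn1
    have hn1' : (0 : ℝ) < n := by exact_mod_cast hn1
    rw [div_lt_iff₀ hn1'] at hn
    have h5 : ∑ i, floorCount β n i < 2 * n := by exact_mod_cast hn
    have h4 := h n hn0 0 (floorCount β n) (by simpa using h5.le)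
    rwa [zero_add] at h4

/-- Passage from the strict to the weak order of weights, in the lower bounds for rates. -/
lemma rate_lower_of_le {C : ℝ} {θ₀ : ℝ} {q : (ι → ℕ) → ℝ}
    (h : ∀ θ : ℝ, θ₀ < θ → 0 < θ → θ ≤ 1 → ∀ β ∈ stdSimplex ℝ ι, ∀ β' ∈ stdSimplex ℝ ι,
      (∀ i, 0 < β i → θ * β i < β' i) → ∀ a : ℝ, (a : EReal) < rate q β →
      ((θ * a - C : ℝ) : EReal) ≤ rate q β') :
    ∀ θ : ℝ, θ₀ < θ → 0 < θ → θ ≤ 1 → ∀ β ∈ stdSimplex ℝ ι, ∀ β' ∈ stdSimplex ℝ ι,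
      (∀ i, θ * β i ≤ β' i) → ∀ a : ℝ, (a : EReal) ≤ rate q β →
      ((θ * a - C : ℝ) : EReal) ≤ rate q β' := by
  intro θ hθ0 hθ hθ1 β hβ β' hβ' hle a ha
  have h1 : Tendsto (fun x : ℝ => (((θ - x) * (a - x) - C : ℝ) : EReal)) (𝓝[>] 0)
      (𝓝 ((θ * a - C : ℝ) : EReal)) := by
    refine EReal.tendsto_coe.2 ?_
    have : Continuous fun x : ℝ => (θ - x) * (a - x) - C := by fun_prop
    have h2 := this.tendsto 0
    simp only [sub_zero] at h2
    exact h2.mono_left nhdsWithin_le_nhds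
  refine le_of_tendsto h1 ?_
  have hx : ∀ᶠ x : ℝ in 𝓝[>] 0, x < min (θ - θ₀) θ :=
    nhdsWithin_le_nhds (gt_mem_nhds (lt_min (by linarith) hθ))
  filter_upwards [hx, self_mem_nhdsWithin] with x hx hx0
  rw [Set.mem_Ioi] at hx0
  refine h (θ - x) (by linarith [hx.trans_le (min_le_left _ _)])
    (by linarith [hx.trans_le (min_le_right _ _)]) (by linarith) β hβ β' hβ' ?_ _ ?_
  · intro i hi
    nlinarith [hle i]
  · exact lt_of_lt_of_le (EReal.coe_lt_coe_iff.2 (by linarith)) ha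

/-- Lower semicontinuity of the rate in the weights, in quantitative form. -/
theorem IsRegular.rate_lower (hq : IsRegular z q) {δ : ℝ} (hδ : 0 < δ) :
    ∃ ε : ℝ, 0 < ε ∧ ∀ θ : ℝ, 1 - ε < θ → 0 < θ → θ ≤ 1 →
      ∀ β ∈ stdSimplex ℝ ι, ∀ β' ∈ stdSimplex ℝ ι, (∀ i, θ * β i ≤ β' i) →
      ∀ a : ℝ, (a : EReal) ≤ rate q β → ((θ * a - δ : ℝ) : EReal) ≤ rate q β' := by
  obtain ⟨ε, hε, hcmp⟩ := hq.compare hδ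
  refine ⟨ε, hε, rate_lower_of_le ?_⟩
  intro θ hθ0 hθ hθ1 β hβ β' hβ' hlt a ha
  have h1 := hcmp β β' _ _ (fun n => ⌊θ * n⌋₊) id θ 1 (isApprox_floorCount hβ.1)
    (isApprox_floorCount hβ'.1) hβ.1 (tendsto_floor_mul_div hθ.le) tendsto_id_div
    (by simpa using hlt) (by rw [hβ'.2]; norm_num) (by rw [hβ.2, hβ'.2]; linarith)
  have h2 := rate_le_of_eventually (P := fun n => q (floorCount β n))
    (Q := fun n => q (floorCount β' n)) hθ one_pos
    (hq.tendsto_rate hβ (isApprox_floorCount hβ.1))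
    (hq.tendsto_rate hβ' (isApprox_floorCount hβ'.1)) (tendsto_floor_mul_div hθ.le)
    tendsto_id_div h1 ha
  simpa using h2

/-- The crude lower bound for the rate, for arbitrary ordered weights. -/
theorem IsRegular.rate_lower_global (hq : IsRegular z q) :
    ∃ K : ℝ, 0 ≤ K ∧ ∀ θ : ℝ, 0 < θ → θ ≤ 1 →
      ∀ β ∈ stdSimplex ℝ ι, ∀ β' ∈ stdSimplex ℝ ι, (∀ i, θ * β i ≤ β' i) →
      ∀ a : ℝ, (a : EReal) ≤ rate q β → ((θ * a - K : ℝ) : EReal) ≤ rate q β' := by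
  obtain ⟨K, hK, hcmp⟩ := hq.compare_global
  refine ⟨K, hK, fun θ hθ => rate_lower_of_le (θ₀ := 0) ?_ θ hθ hθ⟩
  intro θ _ hθ hθ1 β hβ β' hβ' hlt a ha
  have h1 := hcmp β β' _ _ (fun n => ⌊θ * n⌋₊) id θ 1 (isApprox_floorCount hβ.1)
    (isApprox_floorCount hβ'.1) hβ.1 (tendsto_floor_mul_div hθ.le) tendsto_id_div
    (by simpa using hlt) (by rw [hβ'.2]; norm_num)
  have h2 := rate_le_of_eventually (P := fun n => q (floorCount β n))
    (Q := fun n => q (floorCount β' n)) hθ one_pos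
    (hq.tendsto_rate hβ (isApprox_floorCount hβ.1))
    (hq.tendsto_rate hβ' (isApprox_floorCount hβ'.1)) (tendsto_floor_mul_div hθ.le)
    tendsto_id_div h1 ha
  simpa using h2

end Rate

end RWRP

end

noncomputable section

namespace RWRP

/-! ### Independence of the convex representation, and the variational formula -/

section Rate

variable {d : ℕ} {ι : Type*} [Fintype ι] {z : ι → Fin d → ℤ} {q : (ι → ℕ) → ℝ}

/-- Integer vectors supported in `I` with a bounded number of steps and a bounded endpoint can be
replaced by bounded ones, since these data take only finitely many values. -/
lemma exists_bounded_lift (z : ι → Fin d → ℤ) (I : Set ι) (B : ℤ) :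
    ∃ K : ℕ, ∀ r : ι → ℤ, (∀ i ∉ I, r i = 0) → |∑ i, r i| ≤ B →
      (∀ j, |∑ i, r i * z i j| ≤ B) → ∃ r' : ι → ℤ, (∀ i ∉ I, r' i = 0) ∧
        ∑ i, r' i = ∑ i, r i ∧ (∀ j, ∑ i, r' i * z i j = ∑ i, r i * z i j) ∧
        ∀ i, |r' i| ≤ K := by
  classical
  set φ : (ι → ℤ) → ℤ × (Fin d → ℤ) := fun r => (∑ i, r i, fun j => ∑ i, r i * z i j) with hφ
  set A : Set (ι → ℤ) := {r | (∀ i ∉ I, r i = 0) ∧ |∑ i, r i| ≤ B ∧ ∀ j, |∑ i, r i * z i j| ≤ B}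
    with hA
  have hfin : (φ '' A).Finite := by
    refine (Set.finite_Icc ((-B, fun _ => -B) : ℤ × (Fin d → ℤ)) (B, fun _ => B)).subset ?_
    rintro _ ⟨r, ⟨-, h1, h2⟩, rfl⟩
    exact ⟨⟨(abs_le.1 h1).1, fun j => (abs_le.1 (h2 j)).1⟩,
      ⟨(abs_le.1 h1).2, fun j => (abs_le.1 (h2 j)).2⟩⟩
  have hch : ∀ s : ℤ × (Fin d → ℤ), ∃ r : ι → ℤ, s ∈ φ '' A → r ∈ A ∧ φ r = s := by
    intro s
    by_cases hs : s ∈ φ '' A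
    · obtain ⟨r, hr, h⟩ := hs
      exact ⟨r, fun _ => ⟨hr, h⟩⟩
    · exact ⟨0, fun h => absurd h hs⟩
  choose f hf using hch
  refine ⟨∑ s ∈ hfin.toFinset, ∑ i, (f s i).natAbs, fun r hr1 hr2 hr3 => ?_⟩
  have hmem : φ r ∈ φ '' A := ⟨r, ⟨hr1, hr2, hr3⟩, rfl⟩
  obtain ⟨h1, h2⟩ := hf _ hmem
  refine ⟨f (φ r), h1.1, congrArg Prod.fst h2, fun j => congrFun (congrArg Prod.snd h2) j, ?_⟩
  intro i
  have h3 : (f (φ r) i).natAbs ≤ ∑ i, (f (φ r) i).natAbs :=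
    Finset.single_le_sum (f := fun i => (f (φ r) i).natAbs) (fun _ _ => Nat.zero_le _)
      (Finset.mem_univ i)
  have h4 : ∑ i, (f (φ r) i).natAbs ≤ ∑ s ∈ hfin.toFinset, ∑ i, (f s i).natAbs :=
    Finset.single_le_sum (f := fun s => ∑ i, (f s i).natAbs) (fun _ _ => Nat.zero_le _)
      (hfin.mem_toFinset.2 hmem)
  rw [Int.abs_eq_natAbs]
  exact_mod_cast h3.trans h4

lemma rate_le_of_rep_eq (hq : IsRegular z q) {β β' : ι → ℝ} (hβ : β ∈ stdSimplex ℝ ι)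
    (hβ' : β' ∈ stdSimplex ℝ ι) (heq : ∀ j, ∑ i, β i * z i j = ∑ i, β' i * z i j) :
    rate q β ≤ rate q β' := by
  -- it suffices to lengthen paths in direction `β` by a small fraction so that they end at the
  -- lattice points approximating direction `β'`
  suffices H : ∀ δ : ℝ, 0 < δ → ∃ ε₀ : ℝ, 0 < ε₀ ∧ ∀ ε : ℝ, 0 < ε → ε < ε₀ →
      ∀ᶠ n : ℕ in atTop, q (floorCount β n) - δ * n ≤ q (floorCount β' ⌊(1 + ε) * n⌋₊) by
    refine le_of_forall_lt fun x hx => ?_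
    obtain ⟨a', hxa, ha'⟩ := EReal.lt_iff_exists_real_btwn.1 hx
    refine hxa.trans_le ?_
    have h1 : ∀ δ : ℝ, 0 < δ → ((a' - δ : ℝ) : EReal) ≤ rate q β' := by
      intro δ hδ
      obtain ⟨ε₀, hε₀, h⟩ := H δ hδ
      have hlim : Tendsto (fun ε : ℝ => (((1 * a' - δ) / (1 + ε) : ℝ) : EReal)) (𝓝[>] 0)
          (𝓝 ((a' - δ : ℝ) : EReal)) := by
        refine EReal.tendsto_coe.2 ?_
        have h2 : ContinuousAt (fun ε : ℝ => (1 * a' - δ) / (1 + ε)) 0 :=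
          ContinuousAt.div (by fun_prop) (by fun_prop) (by norm_num)
        have h3 := h2.tendsto
        simp only [add_zero, div_one, one_mul] at h3
        simp only [one_mul]
        exact h3.mono_left nhdsWithin_le_nhds
      refine le_of_tendsto hlim ?_
      filter_upwards [nhdsWithin_le_nhds (gt_mem_nhds hε₀), self_mem_nhdsWithin] with ε h2 h3
      rw [Set.mem_Ioi] at h3
      exact rate_le_of_eventually (P := fun n => q (floorCount β n))
        (Q := fun n => q (floorCount β' n)) one_pos (by linarith)
        (hq.tendsto_rate hβ (isApprox_floorCount hβ.1))
        (hq.tendsto_rate hβ' (isApprox_floorCount hβ'.1)) tendsto_id_div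
        (tendsto_floor_mul_div (by linarith)) (h ε h3 h2) ha'
    have hlim : Tendsto (fun δ : ℝ => ((a' - δ : ℝ) : EReal)) (𝓝[>] 0) (𝓝 (a' : EReal)) := by
      refine EReal.tendsto_coe.2 ?_
      have h2 : Continuous fun δ : ℝ => a' - δ := by fun_prop
      have h3 := h2.tendsto 0
      rw [sub_zero] at h3
      exact h3.mono_left nhdsWithin_le_nhds
    refine le_of_tendsto hlim ?_
    filter_upwards [self_mem_nhdsWithin] with δ hδ using h1 δ hδ
  intro δ hδ
  obtain ⟨ε₁, hε₁, n₀, hext⟩ := hq.ext δ hδ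
  refine ⟨ε₁, hε₁, fun ε hε hεε => ?_⟩
  set c := floorCount β with hc
  set c' := floorCount β' with hc'
  set τ : ℕ → ℕ := fun n => ⌊(1 + ε) * n⌋₊ with hτ
  set γ : ι → ℝ := fun i => (β i + β' i) / 2 with hγ
  set b : ℕ → ι → ℕ := fun n i => ⌊ε * n * γ i⌋₊ with hb
  have hγ0 : ∀ i, 0 ≤ γ i := fun i => by have := hβ.1 i; have := hβ'.1 i; simp only [hγ]; linarith
  have hca := isApprox_floorCount hβ.1
  have hca' := isApprox_floorCount hβ'.1
  -- the total weight of the coefficients bounds the effect of all roundings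
  set B : ℕ := 4 * (Fintype.card ι + ∑ i, ∑ j, (z i j).natAbs) with hB
  obtain ⟨K, hK⟩ := exists_bounded_lift z {i | 0 < γ i} (B : ℤ)
  set r : ℕ → ι → ℤ := fun n i => (c' (τ n) i : ℤ) - c n i - b n i with hr
  have hround : ∀ n i, |(r n i : ℝ) - ((1 + ε) * n * β' i - n * β i - ε * n * γ i)| ≤ 4 := by
    intro n i
    have h1 := abs_le.1 (hca n i).1
    have h2 := abs_le.1 (hca' (τ n) i).1
    have h0 : 0 ≤ ε * n * γ i := mul_nonneg (by positivity) (hγ0 i)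
    have h3 := Nat.floor_le h0
    have h4 := Nat.lt_floor_add_one (ε * n * γ i)
    have h5 : (τ n : ℝ) ≤ (1 + ε) * n := Nat.floor_le (by positivity)
    have h6 : (1 + ε) * n < τ n + 1 := Nat.lt_floor_add_one _
    have h7 := hβ'.1 i
    have h8 : β' i ≤ 1 := by
      rw [← hβ'.2]; exact Finset.single_le_sum (fun i _ => hβ'.1 i) (Finset.mem_univ i)
    have h9 : |(τ n : ℝ) * β' i - (1 + ε) * n * β' i| ≤ 1 := by
      rw [← sub_mul, abs_mul, abs_of_nonneg h7]
      refine mul_le_one₀ ?_ h7 h8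
      rw [abs_le]; constructor <;> linarith
    have h10 := abs_le.1 h9
    simp only [hr]
    push_cast
    rw [abs_le]
    constructor <;> linarith [h1.1, h1.2, h2.1, h2.2, h10.1, h10.2]
  have hsumbound : ∀ (f : ι → ℤ) (F : ℕ), ∑ i, (f i).natAbs ≤ F →
      ∑ i, β i * f i = ∑ i, β' i * f i → ∀ n, |∑ i, r n i * f i| ≤ 4 * F := by
    intro f F hF hfe n
    have h1 : ∑ i, ((1 + ε) * n * β' i - n * β i - ε * n * γ i) * (f i : ℝ) = 0 := by
      have h2 : ∀ i, ((1 + ε) * n * β' i - n * β i - ε * n * γ i) * (f i : ℝ) =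
          ((1 + ε / 2) * n) * (β' i * f i) - ((1 + ε / 2) * n) * (β i * f i) := by
        intro i; simp only [hγ]; ring
      rw [Finset.sum_congr rfl fun i _ => h2 i, Finset.sum_sub_distrib, ← Finset.mul_sum,
        ← Finset.mul_sum, hfe, sub_self]
    have h3 : |∑ i, (r n i : ℝ) * f i| ≤ 4 * F := by
      have h4 : ∑ i, (r n i : ℝ) * f i =
          ∑ i, ((r n i : ℝ) - ((1 + ε) * n * β' i - n * β i - ε * n * γ i)) * f i := by
        simp only [sub_mul] at h1 ⊢
        simp only [Finset.sum_sub_distrib] at h1 ⊢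
        linarith
      rw [h4]
      refine (Finset.abs_sum_le_sum_abs _ _).trans ?_
      have h5 : ∀ i ∈ Finset.univ, |((r n i : ℝ) - ((1 + ε) * n * β' i - n * β i - ε * n * γ i)) * f i|
          ≤ 4 * ((f i).natAbs : ℝ) := by
        intro i _
        rw [abs_mul, ← Int.cast_abs, Int.abs_eq_natAbs, Int.cast_natCast]
        exact mul_le_mul_of_nonneg_right (hround n i) (Nat.cast_nonneg _)
      refine (Finset.sum_le_sum h5).trans ?_
      rw [← Finset.mul_sum]
      have : (∑ i, ((f i).natAbs : ℝ)) ≤ F := by exact_mod_cast hF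
      linarith
    exact_mod_cast h3
  have hsupp : ∀ n, ∀ i ∉ {i | 0 < γ i}, r n i = 0 := by
    intro n i hi
    have h0 : γ i = 0 := le_antisymm (not_lt.1 hi) (hγ0 i)
    have h1 : β i = 0 := by
      have := hβ.1 i; have := hβ'.1 i; simp only [hγ] at h0; linarith
    have h2 : β' i = 0 := by
      have := hβ.1 i; have := hβ'.1 i; simp only [hγ] at h0; linarith
    have h3 : c n i = 0 := (hca n i).2 h1
    have h4 : c' (τ n) i = 0 := (hca' (τ n) i).2 h2
    simp [hr, hb, h0, h3, h4]
  have hlift : ∀ n, ∃ r' : ι → ℤ, (∀ i ∉ {i | 0 < γ i}, r' i = 0) ∧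
        ∑ i, r' i = ∑ i, r n i ∧ (∀ j, ∑ i, r' i * z i j = ∑ i, r n i * z i j) ∧
        ∀ i, |r' i| ≤ K := by
    intro n
    refine hK (r n) (hsupp n) ?_ fun j => ?_
    · have h1 := hsumbound (fun _ => 1) (Fintype.card ι) (by simp) (by simp [hβ.2, hβ'.2]) n
      simp only [mul_one] at h1
      refine h1.trans ?_
      simp only [hB]
      push_cast
      have : (0 : ℤ) ≤ ∑ i, ∑ j, |z i j| :=
        Finset.sum_nonneg fun i _ => Finset.sum_nonneg fun j _ => abs_nonneg _
      linarith
    · have h1 := hsumbound (fun i => z i j) (∑ i, ∑ j, (z i j).natAbs)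
        (Finset.sum_le_sum fun i _ => Finset.single_le_sum (f := fun j => (z i j).natAbs)
          (fun _ _ => Nat.zero_le _) (Finset.mem_univ j)) (heq j) n
      refine h1.trans ?_
      simp only [hB]
      push_cast
      have : (0 : ℤ) ≤ Fintype.card ι := Nat.cast_nonneg _
      linarith
  choose r' hr'1 hr'2 hr'3 hr'4 using hlift
  have hlarge : ∀ᶠ n : ℕ in atTop, ∀ i, 0 < γ i → K ≤ b n i := by
    refine eventually_all.2 fun i => ?_
    rcases le_or_gt (γ i) 0 with h | h
    · exact Eventually.of_forall fun n hn => absurd hn (not_lt.2 h)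
    · have h1 : ∀ᶠ n : ℕ in atTop, (K : ℝ) / (ε * γ i) ≤ n :=
        tendsto_natCast_atTop_atTop.eventually_ge_atTop _
      filter_upwards [h1] with n hn _
      rw [div_le_iff₀ (by positivity)] at hn
      refine Nat.le_floor ?_
      linarith
  have hcard := tendsto_sum_count_div hca tendsto_id_div
  have hcard' := tendsto_sum_count_div hca' (tendsto_floor_mul_div (show 0 ≤ 1 + ε by linarith))
  rw [hβ.2, one_mul] at hcard
  rw [hβ'.2, mul_one] at hcard'
  have hcd := hcard'.sub hcard
  filter_upwards [hlarge, eventually_ge_atTop n₀, (tendsto_order.1 hcard).2 2 (by norm_num),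
    (tendsto_order.1 hcd).2 ε₁ (by linarith), eventually_gt_atTop 0] with n hn hn₀ hn2 hnε hn0
  have hn0' : (0 : ℝ) < n := by exact_mod_cast hn0
  set e : ι → ℕ := fun i => ((b n i : ℤ) + r' n i).toNat with he
  have hecast : ∀ i, (e i : ℤ) = b n i + r' n i := by
    intro i
    refine Int.toNat_of_nonneg ?_
    by_cases hi : 0 < γ i
    · have h1 := abs_le.1 (hr'4 n i)
      have h2 : (K : ℤ) ≤ b n i := by exact_mod_cast hn i hi
      linarith [h1.1]
    · rw [hr'1 n i hi]
      positivity
  have hesum : ∑ i, (c n + e) i = ∑ i, c' (τ n) i := by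
    have h1 : ∑ i, ((c n i : ℤ) + e i) = ∑ i, (c' (τ n) i : ℤ) := by
      have h2 := hr'2 n
      simp only [hecast, hr, Finset.sum_add_distrib, Finset.sum_sub_distrib] at h2 ⊢
      linarith
    simp only [Pi.add_apply]
    exact_mod_cast h1
  have hepos : ∑ i, (c n + e) i • z i = ∑ i, c' (τ n) i • z i := by
    funext j
    have h2 := hr'3 n j
    simp only [Finset.sum_apply, Pi.smul_apply, Pi.add_apply]
    simp only [nsmul_eq_mul, Nat.cast_add]
    simp only [hecast, hr, sub_mul, add_mul, Finset.sum_add_distrib, Finset.sum_sub_distrib] at h2 ⊢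
    linarith
  rw [← hq.congr _ _ hesum hepos]
  refine hext n hn₀ (c n) e ?_ ?_
  · rw [div_lt_iff₀ hn0'] at hn2
    have h1 : ∑ i, c n i < 2 * n := by exact_mod_cast hn2
    exact h1.le
  · rw [← sub_div, div_lt_iff₀ hn0'] at hnε
    have h1 : (∑ i, c n i : ℕ) + (∑ i, e i : ℕ) = ∑ i, c' (τ n) i := by
      rw [← hesum, ← Finset.sum_add_distrib]; rfl
    have h2 : ((∑ i, c n i : ℕ) : ℝ) + (∑ i, e i : ℕ) = (∑ i, c' (τ n) i : ℕ) := by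
      exact_mod_cast h1
    linarith

/-- The rate depends on the weights only through the point they represent. -/
theorem rate_eq_of_rep_eq (hq : IsRegular z q) {β β' : ι → ℝ} (hβ : β ∈ stdSimplex ℝ ι)
    (hβ' : β' ∈ stdSimplex ℝ ι) (heq : ∀ j, ∑ i, β i * z i j = ∑ i, β' i * z i j) :
    rate q β = rate q β' :=
  le_antisymm (rate_le_of_rep_eq hq hβ hβ' heq)
    (rate_le_of_rep_eq hq hβ' hβ fun j => (heq j).symm)

/-- The largest values of `q` at given length grow at the rate `⨆ β, rate q β`: up to a small
extension, the endpoints of paths of a given length come from finitely many directions. -/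
theorem tendsto_of_max_count [Nonempty ι] (hq : IsRegular z q) {Z r : ℕ → ℝ}
    (hlow : ∀ c : ι → ℕ, q c ≤ Z (∑ i, c i))
    (hup : ∀ n, ∃ c : ι → ℕ, ∑ i, c i = n ∧ Z n ≤ r n + q c)
    (hr : Tendsto (fun n : ℕ => r n / n) atTop (𝓝 0)) :
    Tendsto (fun n : ℕ => ((Z n / n : ℝ) : EReal)) atTop
      (𝓝 (⨆ β ∈ stdSimplex ℝ ι, rate q β)) := by
  classical
  rw [tendsto_order]
  constructor
  · intro x hx
    obtain ⟨β, hx⟩ := lt_iSup_iff.1 hx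
    obtain ⟨hβ, hx⟩ := lt_iSup_iff.1 hx
    obtain ⟨a, hxa, hx⟩ := EReal.lt_iff_exists_real_btwn.1 hx
    obtain ⟨a', haa, hx⟩ := EReal.lt_iff_exists_real_btwn.1 hx
    rw [EReal.coe_lt_coe_iff] at haa
    obtain ⟨ε, hε, n₀, hext⟩ := hq.ext (a' - a) (by linarith)
    have hfl := isApprox_floorCount hβ.1
    have hcard := tendsto_sum_count_div hfl tendsto_id_div
    rw [hβ.2, one_mul] at hcard
    obtain ⟨i₀⟩ := ‹Nonempty ι›
    filter_upwards [(tendsto_order.1 (hq.tendsto_rate hβ hfl)).1 _ hx, eventually_ge_atTop n₀,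
      (tendsto_order.1 hcard).1 (1 - ε) (by linarith), eventually_gt_atTop 0] with n hn hn₀ hnε hn0
    have hn0' : (0 : ℝ) < n := by exact_mod_cast hn0
    rw [EReal.coe_lt_coe_iff, lt_div_iff₀ hn0'] at hn
    rw [lt_div_iff₀ hn0'] at hnε
    have hle : ∑ i, floorCount β n i ≤ n := by
      have h1 : ((∑ i, floorCount β n i : ℕ) : ℝ) ≤ n := by
        push_cast
        calc ∑ i, (floorCount β n i : ℝ) ≤ ∑ i, (n : ℝ) * β i :=
              Finset.sum_le_sum fun i _ => Nat.floor_le (mul_nonneg hn0'.le (hβ.1 i))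
          _ = n := by rw [← Finset.mul_sum, hβ.2, mul_one]
      exact_mod_cast h1
    set e : ι → ℕ := Pi.single i₀ (n - ∑ i, floorCount β n i) with he
    have hesum : ∑ i, e i = n - ∑ i, floorCount β n i := by
      rw [he, Finset.sum_pi_single']; simp
    have h1 := hext n hn₀ (floorCount β n) e (by omega) (by
      rw [hesum, Nat.cast_sub hle]
      linarith)
    have h2 := hlow (floorCount β n + e)
    have h3 : ∑ i, (floorCount β n + e) i = n := by
      simp only [Pi.add_apply, Finset.sum_add_distrib, hesum]
      omega
    rw [h3] at h2
    refine hxa.trans ?_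
    rw [EReal.coe_lt_coe_iff, lt_div_iff₀ hn0']
    linarith
  · intro x hx
    obtain ⟨b, hb, hbx⟩ := EReal.lt_iff_exists_real_btwn.1 hx
    set S := ⨆ β ∈ stdSimplex ℝ ι, rate q β with hS
    suffices h : ¬ ∃ᶠ n : ℕ in atTop, b * n ≤ Z n by
      rw [not_frequently] at h
      filter_upwards [h, eventually_gt_atTop 0] with n hn hn0
      have hn0' : (0 : ℝ) < n := by exact_mod_cast hn0
      refine lt_trans ?_ hbx
      rw [EReal.coe_lt_coe_iff, div_lt_iff₀ hn0']
      exact not_le.1 hn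
    intro hfr
    refine not_le.2 hb ?_
    have hmain : ∀ δ : ℝ, 0 < δ → ((b - 3 * δ : ℝ) : EReal) ≤ S := by
      intro δ hδ
      obtain ⟨ε, hε, n₀, hext⟩ := hq.ext δ hδ
      set p : ℕ := Fintype.card ι with hp
      have hN1 : ∀ᶠ N : ℕ in atTop, 2 * p / ε ≤ (N : ℝ) :=
        tendsto_natCast_atTop_atTop.eventually_ge_atTop _
      have hN2 : ∀ᶠ N : ℕ in atTop, |b - 2 * δ| * p / δ ≤ (N : ℝ) :=
        tendsto_natCast_atTop_atTop.eventually_ge_atTop _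
      obtain ⟨N, hN1, hN2, hN0⟩ := (hN1.and (hN2.and (eventually_gt_atTop 0))).exists
      have hN0' : (0 : ℝ) < N := by exact_mod_cast hN0
      rw [div_le_iff₀ hε] at hN1
      rw [div_le_iff₀ hδ] at hN2
      choose c hcn hcZ using hup
      have hlargen : ∀ᶠ n : ℕ in atTop, 2 * (N + p) / ε ≤ (n : ℝ) :=
        tendsto_natCast_atTop_atTop.eventually_ge_atTop _
      -- finitely many directions `κ` dominate all endpoints
      have hκ : ∃ᶠ n : ℕ in atTop, ∃ κ : ι → Fin (N + 2),
          N ≤ ∑ i, (κ i : ℕ) ∧ ∑ i, (κ i : ℕ) ≤ N + p ∧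
          (b - 2 * δ) * n ≤ q ((n / N + 1) • fun i => (κ i : ℕ)) := by
        refine (hfr.and_eventually (hlargen.and ((eventually_ge_atTop n₀).and
          ((eventually_gt_atTop 0).and ((tendsto_order.1 hr).2 δ hδ))))).mono ?_
        rintro n ⟨hbn, hn1, hn₀, hn0, hrn⟩
        have hn0' : (0 : ℝ) < n := by exact_mod_cast hn0
        rw [div_lt_iff₀ hn0'] at hrn
        rw [div_le_iff₀ hε] at hn1
        have hci : ∀ i, c n i ≤ n := fun i => by
          calc c n i ≤ ∑ i, c n i := Finset.single_le_sum (fun _ _ => Nat.zero_le _) (Finset.mem_univ i)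
            _ = n := hcn n
        set κ : ι → ℕ := fun i => c n i * N / n + 1 with hκ
        have hκlt : ∀ i, κ i < N + 2 := by
          intro i
          have : c n i * N / n ≤ N := by
            rw [Nat.div_le_iff_le_mul_add_pred hn0]
            have := Nat.mul_le_mul_right N (hci i)
            rw [mul_comm n N] at this ⊢
            omega
          simp only [hκ]; omega
        have hκc : ∀ i, c n i * N < κ i * n := fun i => by
          rw [mul_comm (κ i)]
          exact Nat.lt_mul_div_succ _ hn0
        have hκc' : ∀ i, (c n i * N / n) * n ≤ c n i * N := fun i => Nat.div_mul_le_self _ _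
        have hsum1 : N ≤ ∑ i, κ i := by
          have h1 : (∑ i, c n i) * N ≤ (∑ i, κ i) * n := by
            rw [Finset.sum_mul, Finset.sum_mul]
            exact Finset.sum_le_sum fun i _ => (hκc i).le
          rw [hcn n, mul_comm n N] at h1
          exact Nat.le_of_mul_le_mul_right h1 hn0
        have hsum2 : ∑ i, κ i ≤ N + p := by
          have h1 : (∑ i, c n i * N / n) * n ≤ N * n := by
            rw [Finset.sum_mul]
            refine (Finset.sum_le_sum fun i _ => hκc' i).trans ?_
            rw [← Finset.sum_mul, hcn n, mul_comm]
          have h2 := Nat.le_of_mul_le_mul_right h1 hn0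
          simp only [hκ, Finset.sum_add_distrib, Finset.sum_const, Finset.card_univ, smul_eq_mul,
            mul_one]
          omega
        set m := n / N + 1 with hm
        have hnm : n < m * N := by
          rw [mul_comm]; exact Nat.lt_mul_div_succ _ hN0
        have hmn : (m : ℝ) * N ≤ n + N := by
          have h1 : n / N * N ≤ n := Nat.div_mul_le_self _ _
          have h2 : m * N ≤ n + N := by simp only [hm]; rw [add_mul, one_mul]; omega
          exact_mod_cast h2
        have hle : c n ≤ m • κ := by
          intro i
          have h1 : c n i * N ≤ (m * κ i) * N := by
            calc c n i * N ≤ κ i * n := (hκc i).le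
              _ ≤ κ i * (m * N) := Nat.mul_le_mul_left _ hnm.le
              _ = m * κ i * N := by ring
          exact Nat.le_of_mul_le_mul_right h1 hN0
        have hd : ∑ i, (m • κ - c n) i + n = m * ∑ i, κ i := by
          have h0 : ∑ i, (m • κ - c n) i + ∑ i, c n i = m * ∑ i, κ i := by
            rw [← Finset.sum_add_distrib, Finset.mul_sum]
            exact Finset.sum_congr rfl fun i _ => Nat.sub_add_cancel (hle i)
          rwa [hcn n] at h0
        have hd' : ((∑ i, (m • κ - c n) i : ℕ) : ℝ) + n = m * (∑ i, κ i : ℕ) := by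
          exact_mod_cast hd
        have hsum2' : ((∑ i, κ i : ℕ) : ℝ) ≤ N + p := by exact_mod_cast hsum2
        have h1 := hext n hn₀ (c n) (m • κ - c n) (by rw [hcn n]; omega) (by
          have hm0 : (0 : ℝ) ≤ m := Nat.cast_nonneg _
          have h2 : (m : ℝ) * (∑ i, κ i : ℕ) ≤ m * (N + p) := mul_le_mul_of_nonneg_left hsum2' hm0
          -- `m p` is at most `(n / N + 1) p`
          have h3 : (m : ℝ) * p ≤ ε / 2 * n + p := by
            have h4 : (m : ℝ) * p * N ≤ (ε / 2 * n + p) * N := by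
              have : (m : ℝ) * N * p ≤ (n + N) * p := mul_le_mul_of_nonneg_right hmn (Nat.cast_nonneg p)
              have h5 : (p : ℝ) * n ≤ N * ε / 2 * n := by
                have := mul_le_mul_of_nonneg_right hN1 hn0'.le
                linarith
              nlinarith
            exact le_of_mul_le_mul_right h4 hN0'
          linarith)
        rw [add_tsub_cancel_of_le hle] at h1
        have h2 := hcZ n
        refine ⟨fun i => ⟨κ i, hκlt i⟩, hsum1, hsum2, ?_⟩
        change _ ≤ q (m • κ)
        linarith
      obtain ⟨κ, hκf⟩ : ∃ κ : ι → Fin (N + 2), ∃ᶠ n : ℕ in atTop,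
          N ≤ ∑ i, (κ i : ℕ) ∧ ∑ i, (κ i : ℕ) ≤ N + p ∧
          (b - 2 * δ) * n ≤ q ((n / N + 1) • fun i => (κ i : ℕ)) := by
        by_contra hcon
        simp only [not_exists, not_frequently] at hcon
        refine hκ ?_
        filter_upwards [eventually_all.2 hcon] with n hn
        rintro ⟨κ, h⟩
        exact hn κ h
      obtain ⟨-, hκ1, hκ2, -⟩ := hκf.exists
      set k : ℕ := ∑ i, (κ i : ℕ) with hk
      have hk0 : 0 < k := hN0.trans_le hκ1
      have hk0' : (0 : ℝ) < k := by exact_mod_cast hk0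
      set β : ι → ℝ := fun i => (κ i : ℝ) / k with hβdef
      have hβ : β ∈ stdSimplex ℝ ι := by
        refine ⟨fun i => by positivity, ?_⟩
        rw [← Finset.sum_div, div_eq_one_iff_eq hk0'.ne', hk]
        push_cast; rfl
      have hfloor : ∀ m : ℕ, floorCount β (k * m) = m • fun i => (κ i : ℕ) := by
        intro m
        funext i
        have : ((k * m : ℕ) : ℝ) * β i = ((m * κ i : ℕ) : ℝ) := by
          simp only [hβdef]; push_cast; field_simp
        simp only [floorCount, this, Nat.floor_natCast, Pi.smul_apply, smul_eq_mul]
      have hτ : Tendsto (fun n : ℕ => ((k * (n / N + 1) : ℕ) : ℝ) / n) atTop (𝓝 (k / N)) := by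
        have h1 : Tendsto (fun n : ℕ => ((n / N : ℕ) : ℝ) / n) atTop (𝓝 (1 / N)) := by
          have h2 := tendsto_floor_mul_div (a := 1 / (N : ℝ)) (by positivity)
          refine h2.congr fun n => ?_
          rw [one_div_mul_eq_div, Nat.floor_div_eq_div]
        have h3 := (h1.add (tendsto_const_div_atTop_nhds_zero_nat (1 : ℝ))).const_mul (k : ℝ)
        rw [add_zero, mul_one_div] at h3
        refine h3.congr fun n => ?_
        push_cast; ring
      have h1 := le_limit_of_frequently_le (Q := fun m => q (floorCount β m))
        (v := fun n => (b - 2 * δ) * n) (div_pos hk0' hN0')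
        (hq.tendsto_rate hβ (isApprox_floorCount hβ.1)) hτ (tendsto_const_mul_div _)
        (hκf.mono fun n hn => by rw [hfloor]; exact hn.2.2)
      refine le_trans ?_ (h1.trans (le_iSup₂_of_le β hβ le_rfl))
      rw [EReal.coe_le_coe_iff, div_div_eq_mul_div, le_div_iff₀ hk0']
      have hk1 : (N : ℝ) ≤ k := by exact_mod_cast hκ1
      have hk2 : (k : ℝ) ≤ N + p := by exact_mod_cast hκ2
      have h2 : (b - 2 * δ) * (k - N) ≤ |b - 2 * δ| * p := by
        calc (b - 2 * δ) * (k - N) ≤ |b - 2 * δ| * (k - N) :=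
              mul_le_mul_of_nonneg_right (le_abs_self _) (by linarith)
          _ ≤ _ := mul_le_mul_of_nonneg_left (by linarith) (abs_nonneg _)
      nlinarith
    have hlim : Tendsto (fun δ : ℝ => ((b - 3 * δ : ℝ) : EReal)) (𝓝[>] 0) (𝓝 (b : EReal)) := by
      refine EReal.tendsto_coe.2 ?_
      have h2 : Continuous fun δ : ℝ => b - 3 * δ := by fun_prop
      have h3 := h2.tendsto 0
      rw [mul_zero, sub_zero] at h3
      exact h3.mono_left nhdsWithin_le_nhds
    refine le_of_tendsto hlim ?_
    filter_upwards [self_mem_nhdsWithin] with δ hδ using hmain δ hδ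

end Rate

end RWRP

end

noncomputable section

namespace RWRP

/-! ### The polytope of mean velocities -/

section Geometry

variable {d : ℕ} {R : Finset (Fin d → ℤ)}

/-- The point of the convex hull with barycentric weights `β`. -/
def bary (R : Finset (Fin d → ℤ)) (β : R → ℝ) : EuclideanSpace ℝ (Fin d) :=
  ∑ z, β z • toReal (z : Fin d → ℤ)

lemma bary_apply (β : R → ℝ) (j : Fin d) : bary R β j = ∑ z : R, β z * ((z : Fin d → ℤ) j : ℝ) := by
  simp [bary, toReal]

lemma continuous_bary : Continuous (bary R) := by
  unfold bary
  fun_prop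

lemma bary_combo (a b : ℝ) (β γ : R → ℝ) :
    bary R (a • β + b • γ) = a • bary R β + b • bary R γ := by
  simp only [bary, Pi.add_apply, Pi.smul_apply, smul_eq_mul, add_smul, mul_smul,
    Finset.sum_add_distrib, Finset.smul_sum]

lemma convex_hull : Convex ℝ (hull R) := convex_convexHull ℝ _

lemma bary_mem_hull {β : R → ℝ} (hβ : β ∈ stdSimplex ℝ R) : bary R β ∈ hull R :=
  convex_hull.sum_mem (fun z _ => hβ.1 z) hβ.2 fun z _ =>
    subset_convexHull ℝ _ ⟨z, z.2, rfl⟩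

lemma hull_eq_image : hull R = bary R '' stdSimplex ℝ R := by
  classical
  refine Set.Subset.antisymm (convexHull_min ?_ ?_) ?_
  · rintro _ ⟨z, hz, rfl⟩
    refine ⟨Pi.single ⟨z, hz⟩ 1, single_mem_stdSimplex ℝ _, ?_⟩
    rw [bary, Finset.sum_eq_single ⟨z, hz⟩]
    · simp
    · intro b _ hb
      simp [Pi.single_eq_of_ne hb]
    · simp
  · rintro _ ⟨β, hβ, rfl⟩ _ ⟨γ, hγ, rfl⟩ a b ha hb hab
    exact ⟨_, convex_stdSimplex ℝ R hβ hγ ha hb hab, bary_combo a b β γ⟩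
  · rintro _ ⟨β, hβ, rfl⟩
    exact bary_mem_hull hβ

lemma coe_mem_of_mem_interior {V : Type*} [NormedAddCommGroup V] [NormedSpace ℝ V] {s : Set V}
    {y : affineSpan ℝ s} (hy : y ∈ interior ((↑) ⁻¹' s : Set (affineSpan ℝ s))) : (y : V) ∈ s := by
  have := interior_subset hy
  exact this

lemma combo_mem_intrinsicInterior {V : Type*} [NormedAddCommGroup V] [NormedSpace ℝ V] {s : Set V}
    (hs : Convex ℝ s) {x u : V} (hx : x ∈ intrinsicInterior ℝ s) (hu : u ∈ s) {θ : ℝ}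
    (hθ : 0 < θ) (hθ1 : θ ≤ 1) : θ • x + (1 - θ) • u ∈ intrinsicInterior ℝ s := by
  obtain ⟨y, hy, rfl⟩ := mem_intrinsicInterior.1 hx
  have hu' : u ∈ affineSpan ℝ s := subset_affineSpan ℝ s hu
  set φ : affineSpan ℝ s → affineSpan ℝ s := fun x =>
    ⟨AffineMap.lineMap u (x : V) θ⁻¹, AffineMap.lineMap_mem _ hu' x.2⟩ with hφ
  have hφc : Continuous φ := by
    refine Continuous.subtype_mk ?_ _
    simp only [AffineMap.lineMap_apply_module]
    fun_prop
  have hinv : ∀ x : V, θ • AffineMap.lineMap u x θ⁻¹ + (1 - θ) • u = x := by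
    intro x
    rw [AffineMap.lineMap_apply_module, smul_add, smul_smul, smul_smul, mul_sub,
      mul_inv_cancel₀ hθ.ne', mul_one, one_smul, add_right_comm, ← add_smul]
    simp
  have hmem : θ • (y : V) + (1 - θ) • u ∈ affineSpan ℝ s := by
    have := AffineMap.lineMap_mem θ hu' y.2
    rwa [AffineMap.lineMap_apply_module, add_comm] at this
  refine mem_intrinsicInterior.2 ⟨⟨_, hmem⟩, ?_, rfl⟩
  have hφy : φ ⟨_, hmem⟩ = y := by
    refine Subtype.ext ?_
    have h1 : AffineMap.lineMap u (θ • (y : V) + (1 - θ) • u) θ⁻¹ = (y : V) := by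
      rw [AffineMap.lineMap_apply_module, smul_add, smul_smul, inv_mul_cancel₀ hθ.ne', one_smul,
        smul_smul, add_left_comm, ← add_smul]
      have : 1 - θ⁻¹ + θ⁻¹ * (1 - θ) = 0 := by field_simp; ring
      rw [this, zero_smul, add_zero]
    exact h1
  refine interior_maximal (t := φ ⁻¹' interior ((↑) ⁻¹' s)) ?_ (isOpen_interior.preimage hφc) ?_
  · intro v hv
    have hv' : φ v ∈ interior ((↑) ⁻¹' s) := hv
    have h1 : ((φ v : affineSpan ℝ s) : V) ∈ s := coe_mem_of_mem_interior hv'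
    have h2 := hs h1 hu hθ.le (by linarith : 0 ≤ 1 - θ) (by ring)
    rw [hφ] at h2
    simp only at h2
    rw [hinv] at h2
    exact h2
  · rw [Set.mem_preimage, hφy]
    exact hy

/-- The points of the relative interior are those with strictly positive barycentric weights. -/
lemma mem_riHull_iff [Nonempty R] {ζ : EuclideanSpace ℝ (Fin d)} :
    ζ ∈ riHull R ↔ ∃ β ∈ stdSimplex ℝ R, (∀ z, 0 < β z) ∧ bary R β = ζ := by
  constructor
  · intro hζ
    obtain ⟨y, hy, rfl⟩ := mem_intrinsicInterior.1 hζ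
    have hcard : (0 : ℝ) < Fintype.card R := by exact_mod_cast Fintype.card_pos
    set u : R → ℝ := fun _ => 1 / Fintype.card R with hu
    have hus : u ∈ stdSimplex ℝ R := by
      refine ⟨fun z => by positivity, ?_⟩
      rw [hu, Finset.sum_const, Finset.card_univ, nsmul_eq_mul, mul_one_div_cancel hcard.ne']
    have hγ : bary R u ∈ affineSpan ℝ (hull R) := subset_affineSpan ℝ _ (bary_mem_hull hus)
    set f : ℝ → affineSpan ℝ (hull R) := fun t =>
      ⟨AffineMap.lineMap (bary R u) (y : EuclideanSpace ℝ (Fin d)) (1 + t),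
        AffineMap.lineMap_mem _ hγ y.2⟩ with hf
    have hfc : Continuous f := by
      refine Continuous.subtype_mk ?_ _
      simp only [AffineMap.lineMap_apply_module]
      fun_prop
    have hf0 : f 0 = y := by
      refine Subtype.ext ?_
      simp [hf]
    have h1 : ∀ᶠ t in 𝓝[>] (0 : ℝ), f t ∈ interior ((↑) ⁻¹' hull R) := by
      refine nhdsWithin_le_nhds (hfc.continuousAt.eventually_mem ?_)
      rw [hf0]
      exact isOpen_interior.mem_nhds hy
    obtain ⟨t, ht, ht0⟩ := (h1.and self_mem_nhdsWithin).exists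
    have h2 : ((f t : affineSpan ℝ (hull R)) : EuclideanSpace ℝ (Fin d)) ∈ hull R :=
      coe_mem_of_mem_interior ht
    obtain ⟨β, hβ, hβe⟩ := hull_eq_image.subset h2
    refine ⟨(1 / (1 + t)) • β + (t / (1 + t)) • u,
      convex_stdSimplex ℝ R hβ hus (by positivity) (by positivity) (by field_simp), ?_, ?_⟩
    · intro z
      have := hβ.1 z
      simp only [Pi.add_apply, Pi.smul_apply, smul_eq_mul, hu]
      positivity
    · rw [bary_combo, hβe]
      simp only [hf, AffineMap.lineMap_apply_module]
      rw [smul_add, smul_smul, smul_smul, add_right_comm, ← add_smul]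
      have h3 : 1 / (1 + t) * (1 - (1 + t)) + t / (1 + t) = 0 := by field_simp; ring
      have h4 : 1 / (1 + t) * (1 + t) = 1 := by field_simp
      rw [h3, h4, zero_smul, zero_add, one_smul]
  · rintro ⟨β, hβ, hpos, rfl⟩
    have hne : (hull R).Nonempty := ⟨_, bary_mem_hull hβ⟩
    obtain ⟨ξ, hξ⟩ := hne.intrinsicInterior convex_hull
    obtain ⟨α, hα, rfl⟩ : ξ ∈ bary R '' stdSimplex ℝ R := by
      rw [← hull_eq_image]; exact intrinsicInterior_subset hξ
    obtain ⟨z₀, hz₀⟩ := Finite.exists_min β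
    obtain ⟨θ, hθ0, hθ⟩ := exists_between (hpos z₀)
    have hβ1 : β z₀ ≤ 1 := by
      rw [← hβ.2]; exact Finset.single_le_sum (fun i _ => hβ.1 i) (Finset.mem_univ z₀)
    have hθ1 : 0 < 1 - θ := by linarith
    have hrest : (1 / (1 - θ)) • (β - θ • α) ∈ stdSimplex ℝ R := by
      constructor
      · intro z
        have h1 : α z ≤ 1 := by
          rw [← hα.2]; exact Finset.single_le_sum (fun i _ => hα.1 i) (Finset.mem_univ z)
        have h2 := hz₀ z
        simp only [Pi.smul_apply, Pi.sub_apply, smul_eq_mul]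
        refine mul_nonneg (by positivity) ?_
        nlinarith
      · simp only [Pi.smul_apply, Pi.sub_apply, smul_eq_mul, ← Finset.mul_sum,
          Finset.sum_sub_distrib, hβ.2, hα.2, mul_one]
        field_simp
    have h := combo_mem_intrinsicInterior convex_hull hξ (bary_mem_hull hrest) hθ0 (by linarith)
    rw [← bary_combo] at h
    have : θ • α + (1 - θ) • (1 / (1 - θ)) • (β - θ • α) = β := by
      rw [smul_smul, mul_one_div_cancel hθ1.ne', one_smul, add_sub_cancel]
    rwa [this] at h

lemma riHull_subset_hull : riHull R ⊆ hull R := intrinsicInterior_subset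

lemma combo_mem_riHull {ζ γ : EuclideanSpace ℝ (Fin d)} (hζ : ζ ∈ hull R) (hγ : γ ∈ riHull R)
    {t : ℝ} (ht : 0 < t) (ht1 : t ≤ 1) : (1 - t) • ζ + t • γ ∈ riHull R := by
  rw [add_comm]
  exact combo_mem_intrinsicInterior convex_hull hγ hζ ht ht1

lemma riHull_nonempty [Nonempty R] : (riHull R).Nonempty := by
  have hne : (hull R).Nonempty := by
    obtain ⟨z⟩ := ‹Nonempty R›
    exact ⟨_, subset_convexHull ℝ _ ⟨z, z.2, rfl⟩⟩
  exact hne.intrinsicInterior convex_hull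

lemma convex_riHull : Convex ℝ (riHull R) := by
  intro x hx y hy a b ha hb hab
  rcases ha.eq_or_lt with rfl | ha'
  · obtain rfl : b = 1 := by linarith
    simpa using hy
  · obtain rfl : b = 1 - a := by linarith
    exact combo_mem_intrinsicInterior convex_hull hx (riHull_subset_hull hy) ha' (by linarith)

lemma tendsto_combo (ζ γ : EuclideanSpace ℝ (Fin d)) :
    Tendsto (fun t : ℝ => (1 - t) • ζ + t • γ) (𝓝[>] 0) (𝓝 ζ) := by
  have h1 : Continuous fun t : ℝ => (1 - t) • ζ + t • γ := by fun_prop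
  have h2 := h1.tendsto 0
  simp only [sub_zero, one_smul, zero_smul, add_zero] at h2
  exact h2.mono_left nhdsWithin_le_nhds

lemma hull_subset_closure_riHull [Nonempty R] : hull R ⊆ closure (riHull R) := by
  intro ζ hζ
  obtain ⟨γ, hγ⟩ := riHull_nonempty (R := R)
  refine mem_closure_of_tendsto (tendsto_combo ζ γ) ?_
  filter_upwards [self_mem_nhdsWithin, nhdsWithin_le_nhds (gt_mem_nhds (zero_lt_one (α := ℝ)))]
    with t ht ht1 using combo_mem_riHull hζ hγ ht ht1.le

/-- A polytope is conic near each of its points `ζ`: nearby points of the polytope lie on segments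
from `ζ` along which they are only a fraction `ε` of the way. This is a compactness argument in the
simplex of barycentric weights. -/
lemma eventually_near_segment {ζ : EuclideanSpace ℝ (Fin d)} {ε : ℝ} (hε : 0 < ε) :
    ∀ᶠ ζ' in 𝓝[hull R] ζ, ∃ γ ∈ hull R, ζ' = (1 - ε) • ζ + ε • γ := by
  set O : Set (R → ℝ) := {β | ∃ α ∈ stdSimplex ℝ R, bary R α = ζ ∧
    ∀ z, 0 < α z → (1 - ε) * α z < β z} with hO
  have hOo : IsOpen O := by
    have : O = ⋃ α ∈ {α | α ∈ stdSimplex ℝ R ∧ bary R α = ζ},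
        ⋂ z, {β : R → ℝ | 0 < α z → (1 - ε) * α z < β z} := by
      ext β
      simp [hO, and_assoc]
    rw [this]
    refine isOpen_biUnion fun α _ => isOpen_iInter_of_finite fun z => ?_
    by_cases h : 0 < α z
    · simp only [h, true_imp_iff]
      exact isOpen_lt continuous_const (continuous_apply z)
    · simp [h]
  have hK : IsCompact (bary R '' (stdSimplex ℝ R \ O)) :=
    ((isCompact_stdSimplex ℝ R).diff hOo).image continuous_bary
  have hζ : ζ ∉ bary R '' (stdSimplex ℝ R \ O) := by
    rintro ⟨α, ⟨hα, hαO⟩, rfl⟩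
    refine hαO ⟨α, hα, rfl, fun z hz => ?_⟩
    nlinarith
  filter_upwards [nhdsWithin_le_nhds (hK.isClosed.isOpen_compl.mem_nhds hζ), self_mem_nhdsWithin]
    with ζ' h1 h2
  rw [hull_eq_image] at h2
  obtain ⟨β, hβ, rfl⟩ := h2
  have hβO : β ∈ O := by
    by_contra h
    exact h1 ⟨β, ⟨hβ, h⟩, rfl⟩
  obtain ⟨α, hα, rfl, hαβ⟩ := hβO
  refine ⟨bary R ((1 / ε) • (β - (1 - ε) • α)), bary_mem_hull ⟨fun z => ?_, ?_⟩, ?_⟩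
  · simp only [Pi.smul_apply, Pi.sub_apply, smul_eq_mul]
    refine mul_nonneg (by positivity) (sub_nonneg.2 ?_)
    rcases (hα.1 z).eq_or_lt with h | h
    · rw [← h, mul_zero]; exact hβ.1 z
    · exact (hαβ z h).le
  · simp only [Pi.smul_apply, Pi.sub_apply, smul_eq_mul, ← Finset.mul_sum,
      Finset.sum_sub_distrib, hβ.2, hα.2, mul_one]
    field_simp
    ring
  · rw [← bary_combo, smul_smul, mul_one_div_cancel hε.ne', one_smul, add_sub_cancel]

/-- Near a point `ζ` of the relative interior, `ζ` lies on segments from the nearby points. -/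
lemma eventually_near_segment_symm {ζ : EuclideanSpace ℝ (Fin d)} (hζ : ζ ∈ riHull R) {ε : ℝ}
    (hε : 0 < ε) : ∀ᶠ ζ' in 𝓝[hull R] ζ, ∃ γ ∈ hull R, ζ = (1 - ε) • ζ' + ε • γ := by
  obtain ⟨y, hy, rfl⟩ := mem_intrinsicInterior.1 hζ
  set ψ : affineSpan ℝ (hull R) → affineSpan ℝ (hull R) := fun x =>
    ⟨AffineMap.lineMap (x : EuclideanSpace ℝ (Fin d)) (y : EuclideanSpace ℝ (Fin d)) ε⁻¹,
      AffineMap.lineMap_mem _ x.2 y.2⟩ with hψ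
  have hψc : Continuous ψ := by
    refine Continuous.subtype_mk ?_ _
    simp only [AffineMap.lineMap_apply_module]
    fun_prop
  have hψy : ψ y = y := Subtype.ext (by simp [hψ])
  have h1 : ∀ᶠ x in 𝓝 y, ψ x ∈ interior ((↑) ⁻¹' hull R) := by
    refine hψc.continuousAt.eventually_mem ?_
    rw [hψy]
    exact isOpen_interior.mem_nhds hy
  have h2 : ∀ᶠ ζ' in 𝓝[(affineSpan ℝ (hull R) : Set (EuclideanSpace ℝ (Fin d)))] (y : EuclideanSpace ℝ (Fin d)),
      ∃ γ ∈ hull R, (y : EuclideanSpace ℝ (Fin d)) = (1 - ε) • ζ' + ε • γ := by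
    rw [nhdsWithin_eq_map_subtype_coe y.2, eventually_map]
    filter_upwards [h1] with x hx
    have hx' : ((ψ x : affineSpan ℝ (hull R)) : EuclideanSpace ℝ (Fin d)) ∈ hull R :=
      coe_mem_of_mem_interior hx
    refine ⟨_, hx', ?_⟩
    simp only [hψ, AffineMap.lineMap_apply_module]
    rw [smul_add, smul_smul, smul_smul, mul_inv_cancel₀ hε.ne', one_smul, ← add_assoc, ← add_smul]
    have : 1 - ε + ε * (1 - ε⁻¹) = 0 := by field_simp; ring
    rw [this, zero_smul, zero_add]
  exact nhdsWithin_mono _ (subset_affineSpan ℝ _) h2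

/-- The function `f` drops by little along short initial pieces of segments, uniformly over all
segments of the polytope. Bounded concave functions have this property. -/
def SegmentLower (R : Finset (Fin d → ℤ)) (f : EuclideanSpace ℝ (Fin d) → ℝ) : Prop :=
  ∀ δ : ℝ, 0 < δ → ∃ ε : ℝ, 0 < ε ∧ ε < 1 ∧ ∀ ζ ∈ hull R, ∀ γ ∈ hull R,
    f ζ - δ ≤ f ((1 - ε) • ζ + ε • γ)

lemma SegmentLower.lowerSemicontinuousOn {f : EuclideanSpace ℝ (Fin d) → ℝ}
    (hf : SegmentLower R f) : LowerSemicontinuousOn f (hull R) := by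
  intro ζ hζ a ha
  obtain ⟨ε, hε, -, h⟩ := hf ((f ζ - a) / 2) (by linarith)
  filter_upwards [eventually_near_segment (R := R) (ζ := ζ) hε] with ζ' hζ'
  obtain ⟨γ, hγ, rfl⟩ := hζ'
  linarith [h ζ hζ γ hγ]

lemma SegmentLower.continuousOn_riHull {f : EuclideanSpace ℝ (Fin d) → ℝ}
    (hf : SegmentLower R f) : ContinuousOn f (riHull R) := by
  rw [continuousOn_iff_lower_upperSemicontinuousOn]
  refine ⟨hf.lowerSemicontinuousOn.mono riHull_subset_hull, ?_⟩
  intro ζ hζ a ha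
  obtain ⟨ε, hε, -, h⟩ := hf ((a - f ζ) / 2) (by linarith)
  filter_upwards [nhdsWithin_mono _ riHull_subset_hull (eventually_near_segment_symm hζ hε),
    self_mem_nhdsWithin] with ζ' hζ' hmem
  obtain ⟨γ, hγ, heq⟩ := hζ'
  have := h ζ' (riHull_subset_hull hmem) γ hγ
  rw [← heq] at this
  linarith

lemma segmentLower_of_concaveOn {f : EuclideanSpace ℝ (Fin d) → ℝ} (hf : ConcaveOn ℝ (hull R) f)
    {C : ℝ} (hC : ∀ ζ ∈ hull R, |f ζ| ≤ C) : SegmentLower R f := by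
  intro δ hδ
  obtain ⟨ε, hε, hε'⟩ := exists_between (show 0 < min 1 (δ / (2 * |C| + 1)) from
    lt_min one_pos (by positivity))
  have hε1 : ε < 1 := hε'.trans_le (min_le_left _ _)
  have hε2 := hε'.trans_le (min_le_right _ _)
  rw [lt_div_iff₀ (by positivity)] at hε2
  refine ⟨ε, hε, hε1, fun ζ hζ γ hγ => ?_⟩
  have h1 := hf.2 hζ hγ (by linarith : 0 ≤ 1 - ε) hε.le (by ring)
  have h2 := abs_le.1 ((hC ζ hζ).trans (le_abs_self C))
  have h3 := abs_le.1 ((hC γ hγ).trans (le_abs_self C))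
  simp only [smul_eq_mul] at h1
  nlinarith [h2.1, h2.2, h3.1, h3.2]

/-- A bounded continuous concave function on the relative interior of a polytope extends
continuously to the polytope. The extension is the infimum over `t` of
`(f ((1 - t) ζ + t γ) - t f γ) / (1 - t)`, for a fixed `γ` in the relative interior: it is concave
and upper semicontinuous, hence also lower semicontinuous because the domain is a polytope. -/
theorem exists_continuous_extension [Nonempty R] {f : EuclideanSpace ℝ (Fin d) → ℝ}
    (hf : ConcaveOn ℝ (riHull R) f) (hfc : ContinuousOn f (riHull R)) {C : ℝ}
    (hC : ∀ ζ ∈ riHull R, |f ζ| ≤ C) :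
    ∃ h : EuclideanSpace ℝ (Fin d) → ℝ, ContinuousOn h (hull R) ∧ Set.EqOn h f (riHull R) := by
  obtain ⟨γ, hγ⟩ := riHull_nonempty (R := R)
  set φ : ℝ → EuclideanSpace ℝ (Fin d) → ℝ :=
    fun t ζ => (f ((1 - t) • ζ + t • γ) - t * f γ) / (1 - t) with hφ
  set I : Set ℝ := Set.Ioc 0 (1 / 2) with hI
  have hI1 : ∀ t ∈ I, 0 < t ∧ t ≤ 1 ∧ 0 < 1 - t ∧ 1 / 2 ≤ 1 - t := by
    rintro t ⟨h1, h2⟩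
    refine ⟨h1, by linarith, by linarith, by linarith⟩
  have hhalf : (1 / 2 : ℝ) ∈ I := ⟨by norm_num, le_rfl⟩
  have : Nonempty I := ⟨⟨_, hhalf⟩⟩
  set h : EuclideanSpace ℝ (Fin d) → ℝ := fun ζ => ⨅ t : I, φ t ζ with hh
  have hφb : ∀ t ∈ I, ∀ ζ ∈ hull R, |φ t ζ| ≤ 4 * C := by
    intro t ht ζ hζ
    obtain ⟨h1, h2, h3, h4⟩ := hI1 t ht
    have h5 := hC _ (combo_mem_riHull hζ hγ h1 h2)
    have h6 := hC _ hγ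
    rw [hφ, abs_div, abs_of_pos h3, div_le_iff₀ h3]
    have h7 : |f ((1 - t) • ζ + t • γ) - t * f γ| ≤ C + t * C := by
      refine (abs_sub _ _).trans (add_le_add h5 ?_)
      rw [abs_mul, abs_of_pos h1]
      exact mul_le_mul_of_nonneg_left h6 h1.le
    have hC0 : 0 ≤ C := (abs_nonneg _).trans h6
    nlinarith
  have hbdd : ∀ ζ ∈ hull R, BddBelow (Set.range fun t : I => φ t ζ) := by
    intro ζ hζ
    refine ⟨-(4 * C), ?_⟩
    rintro _ ⟨t, rfl⟩
    exact (abs_le.1 (hφb t t.2 ζ hζ)).1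
  have hle : ∀ t ∈ I, ∀ ζ ∈ hull R, h ζ ≤ φ t ζ := fun t ht ζ hζ => ciInf_le (hbdd ζ hζ) ⟨t, ht⟩
  have hhb : ∀ ζ ∈ hull R, |h ζ| ≤ 4 * C := by
    intro ζ hζ
    rw [abs_le]
    refine ⟨le_ciInf fun t => (abs_le.1 (hφb t t.2 ζ hζ)).1, ?_⟩
    exact (hle _ hhalf ζ hζ).trans (abs_le.1 (hφb _ hhalf ζ hζ)).2
  have hconc : ConcaveOn ℝ (hull R) h := by
    refine ⟨convex_hull, fun x hx y hy a b ha hb hab => le_ciInf fun ⟨t, ht⟩ => ?_⟩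
    obtain ⟨h1, h2, h3, h4⟩ := hI1 t ht
    have h5 := hf.2 (combo_mem_riHull hx hγ h1 h2) (combo_mem_riHull hy hγ h1 h2) ha hb hab
    have h6 : a • ((1 - t) • x + t • γ) + b • ((1 - t) • y + t • γ) =
        (1 - t) • (a • x + b • y) + t • γ := by
      have hb' : b = 1 - a := by linarith
      rw [hb']
      module
    rw [h6] at h5
    have h7 := mul_le_mul_of_nonneg_left (hle t ht x hx) ha
    have h8 := mul_le_mul_of_nonneg_left (hle t ht y hy) hb
    simp only [smul_eq_mul] at h5 ⊢
    refine (add_le_add h7 h8).trans ?_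
    simp only [hφ]
    rw [mul_div_assoc', mul_div_assoc', ← add_div]
    refine div_le_div_of_nonneg_right ?_ h3.le
    have : t * f γ = a * (t * f γ) + b * (t * f γ) := by rw [← add_mul, hab, one_mul]
    linarith
  have hφc : ∀ t ∈ I, ContinuousOn (φ t) (hull R) := by
    intro t ht
    obtain ⟨h1, h2, h3, h4⟩ := hI1 t ht
    refine ContinuousOn.div_const (ContinuousOn.sub ?_ continuousOn_const) _
    refine hfc.comp (by fun_prop) fun ζ hζ => combo_mem_riHull hζ hγ h1 h2
  refine ⟨h, ?_, ?_⟩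
  · rw [continuousOn_iff_lower_upperSemicontinuousOn]
    refine ⟨(segmentLower_of_concaveOn hconc hhb).lowerSemicontinuousOn, ?_⟩
    intro ζ hζ a ha
    obtain ⟨⟨t, ht⟩, hta⟩ := exists_lt_of_ciInf_lt ha
    filter_upwards [(hφc t ht ζ hζ).eventually_lt_const hta, self_mem_nhdsWithin] with ζ' h1 h2
    exact (hle t ht ζ' h2).trans_lt h1
  · intro ζ hζ
    refine le_antisymm ?_ (le_ciInf fun ⟨t, ht⟩ => ?_)
    · have hlim : Tendsto (fun t => φ t ζ) (𝓝[>] 0) (𝓝 (f ζ)) := by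
        have h1 : Tendsto (fun t : ℝ => f ((1 - t) • ζ + t • γ)) (𝓝[>] 0) (𝓝 (f ζ)) := by
          refine (hfc ζ hζ).tendsto.comp (tendsto_nhdsWithin_iff.2 ⟨tendsto_combo ζ γ, ?_⟩)
          filter_upwards [self_mem_nhdsWithin,
            nhdsWithin_le_nhds (gt_mem_nhds (zero_lt_one (α := ℝ)))] with t ht ht1
            using combo_mem_riHull (riHull_subset_hull hζ) hγ ht ht1.le
        have h2 : Tendsto (fun t : ℝ => t) (𝓝[>] 0) (𝓝 0) := nhdsWithin_le_nhds
        have h3 := (h1.sub (h2.mul_const (f γ))).div (h2.const_sub 1) (by norm_num)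
        rw [zero_mul, sub_zero, sub_zero, div_one] at h3
        exact h3
      refine ge_of_tendsto hlim ?_
      filter_upwards [self_mem_nhdsWithin,
        nhdsWithin_le_nhds (gt_mem_nhds (show (0 : ℝ) < 1 / 2 by norm_num))] with t ht ht1
      exact hle t ⟨ht, ht1.le⟩ ζ (riHull_subset_hull hζ)
    · obtain ⟨h1, h2, h3, h4⟩ := hI1 t ht
      have h5 := hf.2 hζ hγ h3.le h1.le (by ring)
      simp only [smul_eq_mul] at h5
      simp only [hφ]
      rw [le_div_iff₀ h3]
      linarith

lemma uscReg_eq_of_isContExtension [Nonempty R] {f : EuclideanSpace ℝ (Fin d) → EReal}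
    {h : EuclideanSpace ℝ (Fin d) → ℝ} (hh : IsContExtension R f h)
    (hle : ∀ ζ ∈ hull R, f ζ ≤ h ζ) (hout : ∀ ζ ∉ hull R, f ζ = ⊥)
    {ζ : EuclideanSpace ℝ (Fin d)} (hζ : ζ ∈ hull R) : uscReg f ζ = (h ζ : EReal) := by
  refine le_antisymm ?_ ?_
  · refine le_of_forall_gt_imp_ge_of_dense fun x hx => ?_
    obtain ⟨a, ha, hax⟩ := EReal.lt_iff_exists_real_btwn.1 hx
    refine le_trans ?_ hax.le
    have h1 : ∀ᶠ ζ' in 𝓝[hull R] ζ, h ζ' < a :=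
      (hh.1 ζ hζ).eventually_lt_const (EReal.coe_lt_coe_iff.1 ha)
    obtain ⟨B, hB, hζB, hBs⟩ := mem_nhdsWithin.1 h1
    refine iInf₂_le_of_le B ⟨hB, hζB⟩ (iSup₂_le fun ζ' hζ' => ?_)
    by_cases hm : ζ' ∈ hull R
    · exact (hle ζ' hm).trans (EReal.coe_le_coe_iff.2 (hBs ⟨hζ', hm⟩ : h ζ' < a).le)
    · rw [hout ζ' hm]
      exact bot_le
  · refine le_iInf₂ fun B ⟨hB, hζB⟩ => ?_
    obtain ⟨γ, hγ⟩ := riHull_nonempty (R := R)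
    have hev : ∀ᶠ t in 𝓝[>] (0 : ℝ), (1 - t) • ζ + t • γ ∈ riHull R := by
      filter_upwards [self_mem_nhdsWithin,
        nhdsWithin_le_nhds (gt_mem_nhds (zero_lt_one (α := ℝ)))] with t ht ht1
        using combo_mem_riHull hζ hγ ht ht1.le
    have hlim : Tendsto (fun t : ℝ => ((h ((1 - t) • ζ + t • γ) : ℝ) : EReal)) (𝓝[>] 0)
        (𝓝 (h ζ : EReal)) := by
      refine EReal.tendsto_coe.2 ((hh.1 ζ hζ).tendsto.comp
        (tendsto_nhdsWithin_iff.2 ⟨tendsto_combo ζ γ, ?_⟩))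
      filter_upwards [hev] with t ht using riHull_subset_hull ht
    refine le_of_tendsto hlim ?_
    filter_upwards [hev, (tendsto_combo ζ γ).eventually_mem (hB.mem_nhds hζB)] with t ht htB
    rw [← hh.2 _ ht]
    exact le_iSup₂_of_le _ htB le_rfl

lemma eqOn_of_isContExtension [Nonempty R] {f : EuclideanSpace ℝ (Fin d) → EReal}
    {h h' : EuclideanSpace ℝ (Fin d) → ℝ} (hh : IsContExtension R f h)
    (hh' : IsContExtension R f h') : Set.EqOn h' h (hull R) := by
  have h1 : Set.EqOn h' h (riHull R) := fun ζ hζ => by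
    have h2 := (hh'.2 ζ hζ).symm.trans (hh.2 ζ hζ)
    exact_mod_cast h2
  exact h1.of_subset_closure hh'.1 hh.1 riHull_subset_hull hull_subset_closure_riHull

end Geometry

end RWRP

end

noncomputable section

namespace RWRP

/-! ### Path measures and superadditivity -/

section Walk

variable {d ℓ : ℕ} {R : Finset (Fin d → ℤ)}

/-- The step sequence which follows `a` for the first `m` steps and `b` afterwards. -/
def concat (m : ℕ) (a b : ℕ → R) : ℕ → R := fun i => if i < m then a i else b (i - m)

lemma concat_of_lt {m : ℕ} {a b : ℕ → R} {i : ℕ} (h : i < m) : concat m a b i = a i := if_pos h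

lemma concat_add {m : ℕ} {a b : ℕ → R} (i : ℕ) : concat m a b (m + i) = b i := by
  simp [concat]

instance [Nonempty R] : IsProbabilityMeasure (walkLaw R) := by
  unfold walkLaw
  infer_instance

lemma measurePreserving_concat [Nonempty R] (m : ℕ) :
    MeasurePreserving (fun p : (ℕ → R) × (ℕ → R) => concat m p.1 p.2)
      ((walkLaw R).prod (walkLaw R)) (walkLaw R) := by
  classical
  have hm : Measurable fun p : (ℕ → R) × (ℕ → R) => concat m p.1 p.2 := by
    refine measurable_pi_lambda _ fun i => ?_
    by_cases h : i < m
    · simp only [concat, h, if_true]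
      fun_prop
    · simp only [concat, h, if_false]
      fun_prop
  refine ⟨hm, Measure.eq_infinitePi _ fun s t ht => ?_⟩
  rw [Measure.map_apply hm (MeasurableSet.pi s.countable_toSet fun i _ => ht i)]
  set s₁ := s.filter (· < m) with hs₁
  set s₂ := s.filter (fun i => ¬ i < m) with hs₂
  have hpre : (fun p : (ℕ → R) × (ℕ → R) => concat m p.1 p.2) ⁻¹' Set.pi s t =
      (Set.pi s₁ t) ×ˢ (Set.pi (s₂.image (· - m) : Finset ℕ) fun i => t (m + i)) := by
    ext ⟨a, b⟩
    simp only [Set.mem_preimage, Set.mem_pi, Set.mem_prod, Finset.mem_coe, Finset.mem_image,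
      hs₁, hs₂, Finset.mem_filter]
    constructor
    · intro h
      refine ⟨fun i ⟨hi, him⟩ => ?_, ?_⟩
      · have := h i hi
        rwa [concat_of_lt him] at this
      · rintro _ ⟨i, ⟨hi, him⟩, rfl⟩
        have := h i hi
        rw [← Nat.add_sub_cancel' (not_lt.1 him), concat_add] at this
        exact this
    · rintro ⟨h1, h2⟩ i hi
      by_cases him : i < m
      · rw [concat_of_lt him]
        exact h1 i ⟨hi, him⟩
      · have := h2 (i - m) ⟨i, ⟨hi, him⟩, rfl⟩
        rw [Nat.add_sub_cancel' (not_lt.1 him)] at this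
        rw [← Nat.add_sub_cancel' (not_lt.1 him), concat_add, Nat.add_sub_cancel' (not_lt.1 him)]
        exact this
  rw [hpre, Measure.prod_prod, walkLaw, Measure.infinitePi_pi _ fun i _ => ht i,
    Measure.infinitePi_pi _ fun i _ => ht (m + i), Finset.prod_image]
  · rw [← Finset.prod_filter_mul_prod_filter_not s (· < m)]
    congr 1
    refine Finset.prod_congr rfl fun i hi => ?_
    rw [Nat.add_sub_cancel' (not_lt.1 (Finset.mem_filter.1 hi).2)]
  · intro i hi j hj hij
    have h1 := (Finset.mem_filter.1 hi).2
    have h2 := (Finset.mem_filter.1 hj).2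
    simp only at hij
    omega

/-- A step sequence with prescribed first `N` steps. -/
def extendSteps [Nonempty R] (N : ℕ) (u : Fin N → R) : ℕ → R :=
  fun i => if h : i < N then u ⟨i, h⟩ else Classical.arbitrary R

lemma extendSteps_apply [Nonempty R] {N : ℕ} (s : ℕ → R) {i : ℕ} (hi : i < N) :
    extendSteps N (fun k : Fin N => s k) i = s i := by
  simp [extendSteps, hi]

lemma eq_comp_restrict [Nonempty R] {β : Type*} {N : ℕ} {f : (ℕ → R) → β}
    (hf : ∀ s s', (∀ i < N, s i = s' i) → f s = f s') (s : ℕ → R) :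
    f s = f (extendSteps N fun k : Fin N => s k) :=
  hf _ _ fun _ hi => (extendSteps_apply s hi).symm

lemma measurable_of_finite_dep [Nonempty R] {β : Type*} [MeasurableSpace β] {N : ℕ}
    {f : (ℕ → R) → β} (hf : ∀ s s', (∀ i < N, s i = s' i) → f s = f s') : Measurable f := by
  have h1 : f = (fun u => f (extendSteps N u)) ∘ fun (s : ℕ → R) (k : Fin N) => s k :=
    funext fun s => eq_comp_restrict hf s
  rw [h1]
  refine Measurable.comp (measurable_of_countable _) ?_
  fun_prop

lemma measurable_prod_of_finite_dep [Nonempty R] {Ω β : Type*} [MeasurableSpace Ω]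
    [MeasurableSpace β] {N : ℕ} {f : Ω → (ℕ → R) → β} (hfm : ∀ s, Measurable fun ω => f ω s)
    (hf : ∀ ω s s', (∀ i < N, s i = s' i) → f ω s = f ω s') :
    Measurable fun p : Ω × (ℕ → R) => f p.1 p.2 := by
  have h1 : (fun p : Ω × (ℕ → R) => f p.1 p.2) =
      (fun p : Ω × (Fin N → R) => f p.1 (extendSteps N p.2)) ∘
        fun p : Ω × (ℕ → R) => (p.1, fun k : Fin N => p.2 k) :=
    funext fun p => eq_comp_restrict (hf p.1) p.2
  rw [h1]
  refine Measurable.comp (measurable_from_prod_countable_left fun u => hfm (extendSteps N u)) ?_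
  fun_prop

lemma exists_bound_of_finite_dep [Nonempty R] {N : ℕ} {f : (ℕ → R) → ℝ}
    (hf : ∀ s s', (∀ i < N, s i = s' i) → f s = f s') : ∃ M, ∀ s, |f s| ≤ M := by
  refine ⟨∑ u : Fin N → R, |f (extendSteps N u)|, fun s => ?_⟩
  rw [eq_comp_restrict hf s]
  exact Finset.single_le_sum (f := fun u : Fin N → R => |f (extendSteps N u)|)
    (fun _ _ => abs_nonneg _) (Finset.mem_univ _)

lemma pos_congr {s s' : ℕ → R} {n : ℕ} (h : ∀ i < n, s i = s' i) : pos s n = pos s' n :=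
  Finset.sum_congr rfl fun k hk => by rw [h k (Finset.mem_range.1 hk)]

lemma pos_add (s : ℕ → R) (m n : ℕ) : pos s (m + n) = pos s m + pos (fun i => s (m + i)) n := by
  simp only [pos, Finset.sum_range_add]

/-- The endpoint of a path with `c z` steps `z`, for all `z`. -/
def endpoint (c : R → ℕ) : stepGroup R := ∑ z, c z • step z

lemma coe_endpoint (c : R → ℕ) :
    ((endpoint c : stepGroup R) : Fin d → ℤ) = ∑ z : R, c z • (z : Fin d → ℤ) := by
  simp [endpoint, step]

lemma endpoint_add (c e : R → ℕ) : endpoint (c + e) = endpoint c + endpoint e := by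
  simp [endpoint, add_smul, Finset.sum_add_distrib]

lemma endpoint_smul (m : ℕ) (c : R → ℕ) : endpoint (m • c) = m • endpoint c := by
  simp [endpoint, Finset.smul_sum, mul_smul]

lemma endpoint_zero : endpoint (0 : R → ℕ) = 0 := by simp [endpoint]

lemma endpoint_single [DecidableEq R] (z : R) (j : ℕ) : endpoint (Pi.single z j) = j • step z := by
  rw [endpoint, Finset.sum_eq_single z]
  · simp
  · intro b _ hb
    simp [Pi.single_eq_of_ne hb]
  · simp

lemma sum_single [DecidableEq R] (z : R) (j : ℕ) : ∑ i, (Pi.single z j : R → ℕ) i = j := by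
  rw [Finset.sum_pi_single']
  simp

lemma count_induction [DecidableEq R] {P : (R → ℕ) → Prop} (h0 : P 0)
    (h1 : ∀ c z, P c → P (c + Pi.single z 1)) (c : R → ℕ) : P c := by
  induction hn : ∑ z, c z generalizing c with
  | zero =>
    have : c = 0 := by
      funext z
      exact Finset.sum_eq_zero_iff.1 hn z (Finset.mem_univ z)
    rwa [this]
  | succ n ih =>
    obtain ⟨z, hz⟩ : ∃ z, c z ≠ 0 := by
      by_contra! h
      rw [Finset.sum_eq_zero fun z _ => h z] at hn
      exact absurd hn (by omega)
    have hc : c = (c - Pi.single z 1) + Pi.single z 1 := by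
      funext i
      by_cases hi : i = z
      · subst hi
        simp only [Pi.add_apply, Pi.sub_apply, Pi.single_eq_same]
        omega
      · simp [Pi.single_eq_of_ne hi]
    rw [hc]
    refine h1 _ z (ih _ ?_)
    have h2 : ∑ i, c i = (∑ i, (c - Pi.single z 1 : R → ℕ) i) + 1 := by
      conv_lhs => rw [hc]
      simp only [Pi.add_apply, Finset.sum_add_distrib, sum_single]
    omega

/-- The number of visits to every step among the first `n` steps. -/
lemma exists_endpoint_eq_pos (s : ℕ → R) (n : ℕ) :
    ∃ c : R → ℕ, ∑ z, c z = n ∧ endpoint c = pos s n := by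
  classical
  induction n with
  | zero => exact ⟨0, by simp, by simp [endpoint_zero, pos]⟩
  | succ n ih =>
    obtain ⟨c, h1, h2⟩ := ih
    refine ⟨c + Pi.single (s n) 1, ?_, ?_⟩
    · simp only [Pi.add_apply, Finset.sum_add_distrib, sum_single, h1]
    · rw [endpoint_add, endpoint_single, h2, one_smul, pos, pos, Finset.sum_range_succ]

variable {Ω : Type*} [AddAction (stepGroup R) Ω]

/-- The sum over all words of the absolute values of the potential. -/
def absPot (g : Ω → (Fin ℓ → R) → ℝ) (ω : Ω) : ℝ := ∑ w, |g ω w|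

omit [AddAction (stepGroup R) Ω] in
lemma absPot_nonneg (g : Ω → (Fin ℓ → R) → ℝ) (ω : Ω) : 0 ≤ absPot g ω :=
  Finset.sum_nonneg fun _ _ => abs_nonneg _

omit [AddAction (stepGroup R) Ω] in
lemma abs_le_absPot (g : Ω → (Fin ℓ → R) → ℝ) (ω : Ω) (w : Fin ℓ → R) : |g ω w| ≤ absPot g ω :=
  Finset.single_le_sum (f := fun w => |g ω w|) (fun _ _ => abs_nonneg _) (Finset.mem_univ w)

/-- A bound for the effect, on the energy of a path which ends at the origin, of changing the steps
after its end: it involves the sites visited during the last `ℓ` steps. -/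
def tailError (g : Ω → (Fin ℓ → R) → ℝ) (ω : Ω) : ℝ :=
  2 * ∑ j ∈ Finset.range (ℓ + 1), ∑ u : Fin j → R, absPot g (-(∑ i, step (u i)) +ᵥ ω)

lemma tailError_nonneg (g : Ω → (Fin ℓ → R) → ℝ) (ω : Ω) : 0 ≤ tailError g ω :=
  mul_nonneg zero_le_two (Finset.sum_nonneg fun _ _ => Finset.sum_nonneg fun _ _ =>
    absPot_nonneg _ _)

lemma energy_congr (g : Ω → (Fin ℓ → R) → ℝ) (ω : Ω) {n : ℕ} {s s' : ℕ → R}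
    (h : ∀ i < n + ℓ, s i = s' i) : energy R g ω n s = energy R g ω n s' := by
  refine Finset.sum_congr rfl fun k hk => ?_
  have hk' := Finset.mem_range.1 hk
  have h1 : stepBlock ℓ s k = stepBlock ℓ s' k := funext fun i => h _ (by omega)
  rw [pos_congr (fun i hi => h i (by omega) : ∀ i < k, s i = s' i), h1]

lemma energy_add (g : Ω → (Fin ℓ → R) → ℝ) (ω : Ω) (m n : ℕ) (s : ℕ → R) :
    energy R g ω (m + n) s =
      energy R g ω m s + energy R g (pos s m +ᵥ ω) n (fun i => s (m + i)) := by
  unfold energy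
  rw [Finset.sum_range_add]
  congr 1
  refine Finset.sum_congr rfl fun k _ => ?_
  have h1 : stepBlock ℓ s (m + k) = stepBlock ℓ (fun i => s (m + i)) k :=
    funext fun i => by simp only [stepBlock, add_assoc]
  rw [pos_add, h1, vadd_vadd, add_comm (pos s m)]

/-- Changing the steps after time `m` changes the energy of the first `m` steps by at most the
tail error at the endpoint. -/
lemma energy_sub_le (g : Ω → (Fin ℓ → R) → ℝ) (ω : Ω) {m : ℕ} {s s' : ℕ → R}
    (h : ∀ i < m, s i = s' i) :
    energy R g ω m s - tailError g (pos s m +ᵥ ω) ≤ energy R g ω m s' := by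
  classical
  set W : ℕ → ℝ := fun j => ∑ u : Fin j → R, absPot g (-(∑ i, step (u i)) +ᵥ (pos s m +ᵥ ω))
    with hW
  have hW0 : ∀ j, 0 ≤ W j := fun j => Finset.sum_nonneg fun _ _ => absPot_nonneg _ _
  have hterm : ∀ k ∈ Finset.range m, g (pos s k +ᵥ ω) (stepBlock ℓ s k) -
      g (pos s' k +ᵥ ω) (stepBlock ℓ s' k) ≤ if m - k ≤ ℓ then 2 * W (m - k) else 0 := by
    intro k hk
    have hk' := Finset.mem_range.1 hk
    rw [← pos_congr (fun i hi => h i (by omega) : ∀ i < k, s i = s' i)]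
    split_ifs with hkl
    · have h1 : absPot g (pos s k +ᵥ ω) ≤ W (m - k) := by
        have h2 : pos s k +ᵥ ω = -(∑ i : Fin (m - k), step (s (k + i))) +ᵥ (pos s m +ᵥ ω) := by
          rw [vadd_vadd]
          congr 1
          have h3 := pos_add s k (m - k)
          rw [Nat.add_sub_cancel' hk'.le] at h3
          rw [h3, pos, pos, ← Fin.sum_univ_eq_sum_range (fun i => step (s (k + i)))]
          abel
        rw [h2]
        exact Finset.single_le_sum
          (f := fun u : Fin (m - k) → R => absPot g (-(∑ i, step (u i)) +ᵥ (pos s m +ᵥ ω)))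
          (fun _ _ => absPot_nonneg _ _) (Finset.mem_univ fun i : Fin (m - k) => s (k + i))
      have h2 := abs_le.1 (abs_le_absPot g (pos s k +ᵥ ω) (stepBlock ℓ s k))
      have h3 := abs_le.1 (abs_le_absPot g (pos s k +ᵥ ω) (stepBlock ℓ s' k))
      linarith [h2.2, h3.1]
    · have h1 : stepBlock ℓ s k = stepBlock ℓ s' k := funext fun i => h _ (by omega)
      rw [h1, sub_self]
  have hsum : energy R g ω m s - energy R g ω m s' ≤
      ∑ k ∈ Finset.range m, if m - k ≤ ℓ then 2 * W (m - k) else 0 := by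
    unfold energy
    rw [← Finset.sum_sub_distrib]
    exact Finset.sum_le_sum hterm
  have hre : (∑ k ∈ Finset.range m, if m - k ≤ ℓ then 2 * W (m - k) else 0) ≤
      ∑ j ∈ Finset.range (ℓ + 1), 2 * W j := by
    rw [← Finset.sum_filter, ← Finset.sum_image (f := fun j => 2 * W j) (g := fun k => m - k)]
    · refine Finset.sum_le_sum_of_subset_of_nonneg ?_ fun j _ _ => mul_nonneg zero_le_two (hW0 j)
      intro j hj
      obtain ⟨k, hk, rfl⟩ := Finset.mem_image.1 hj
      have := (Finset.mem_filter.1 hk).2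
      exact Finset.mem_range.2 (by omega)
    · intro i hi j hj hij
      have h1 := Finset.mem_range.1 (Finset.mem_filter.1 hi).1
      have h2 := Finset.mem_range.1 (Finset.mem_filter.1 hj).1
      simp only at hij
      omega
  rw [← Finset.mul_sum] at hre
  have : tailError g (pos s m +ᵥ ω) = 2 * ∑ j ∈ Finset.range (ℓ + 1), W j := rfl
  linarith

variable [Nonempty R]

/-- The point-to-point partition function `E[exp(energy) 1{X_n = y}]`. -/
def partAt (g : Ω → (Fin ℓ → R) → ℝ) (ω : Ω) (n : ℕ) (y : stepGroup R) : ℝ≥0∞ :=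
  ∫⁻ s in {s : ℕ → R | pos s n = y}, ENNReal.ofReal (Real.exp (energy R g ω n s)) ∂walkLaw R

/-- The partition function `E[exp(energy)]`. -/
def partTotal (g : Ω → (Fin ℓ → R) → ℝ) (ω : Ω) (n : ℕ) : ℝ≥0∞ :=
  ∫⁻ s, ENNReal.ofReal (Real.exp (energy R g ω n s)) ∂walkLaw R

omit [AddAction (stepGroup R) Ω] in
lemma measurableSet_pos_eq (n : ℕ) (y : stepGroup R) : MeasurableSet {s : ℕ → R | pos s n = y} := by
  have : Measurable fun s : ℕ → R => pos s n := measurable_of_finite_dep (N := n) fun _ _ => pos_congr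
  exact this (measurableSet_singleton y)

lemma measurable_energy (g : Ω → (Fin ℓ → R) → ℝ) (ω : Ω) (n : ℕ) :
    Measurable fun s => energy R g ω n s :=
  measurable_of_finite_dep (N := n + ℓ) fun _ _ => energy_congr g ω

lemma measurable_weight (g : Ω → (Fin ℓ → R) → ℝ) (ω : Ω) (n : ℕ) :
    Measurable fun s => ENNReal.ofReal (Real.exp (energy R g ω n s)) :=
  (Real.measurable_exp.comp (measurable_energy g ω n)).ennreal_ofReal

lemma partAt_eq_indicator (g : Ω → (Fin ℓ → R) → ℝ) (ω : Ω) (n : ℕ) (y : stepGroup R) :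
    partAt g ω n y = ∫⁻ s, {s : ℕ → R | pos s n = y}.indicator
      (fun s => ENNReal.ofReal (Real.exp (energy R g ω n s))) s ∂walkLaw R :=
  (lintegral_indicator (measurableSet_pos_eq n y) _).symm

lemma partAt_superadditive (g : Ω → (Fin ℓ → R) → ℝ) (ω : Ω) (m n : ℕ) (y y' : stepGroup R) :
    partAt g ω m y * partAt g (y +ᵥ ω) n y' * ENNReal.ofReal (Real.exp (-tailError g (y +ᵥ ω))) ≤
      partAt g ω (m + n) (y + y') := by
  set fA : (ℕ → R) → ℝ≥0∞ := {s : ℕ → R | pos s m = y}.indicator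
    (fun s => ENNReal.ofReal (Real.exp (energy R g ω m s))) with hfA
  set fB : (ℕ → R) → ℝ≥0∞ := {s : ℕ → R | pos s n = y'}.indicator
    (fun s => ENNReal.ofReal (Real.exp (energy R g (y +ᵥ ω) n s))) with hfB
  set F : (ℕ → R) → ℝ≥0∞ := {s : ℕ → R | pos s (m + n) = y + y'}.indicator
    (fun s => ENNReal.ofReal (Real.exp (energy R g ω (m + n) s))) with hF
  have hfAm : Measurable fA := (measurable_weight g ω m).indicator (measurableSet_pos_eq m y)
  have hfBm : Measurable fB :=
    (measurable_weight g (y +ᵥ ω) n).indicator (measurableSet_pos_eq n y')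
  have hFm : Measurable F :=
    (measurable_weight g ω (m + n)).indicator (measurableSet_pos_eq (m + n) (y + y'))
  rw [partAt_eq_indicator, partAt_eq_indicator, partAt_eq_indicator,
    ← (measurePreserving_concat m).lintegral_comp hFm,
    ← lintegral_prod_mul hfAm.aemeasurable hfBm.aemeasurable,
    ← lintegral_mul_const _ (by fun_prop)]
  refine lintegral_mono fun ⟨a, b⟩ => ?_
  simp only [hfA, hfB, hF]
  by_cases ha : pos a m = y
  swap
  · rw [Set.indicator_of_notMem (by exact ha)]; simp
  by_cases hb : pos b n = y'
  swap
  · rw [Set.indicator_of_notMem (s := {s : ℕ → R | pos s n = y'}) (by exact hb)]; simp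
  have hagree : ∀ i < m, a i = concat m a b i := fun i hi => (concat_of_lt hi).symm
  have hpos : pos (concat m a b) m = y := by rw [← pos_congr hagree, ha]
  have htail : (fun i => concat m a b (m + i)) = b := funext concat_add
  have hmem : concat m a b ∈ {s : ℕ → R | pos s (m + n) = y + y'} := by
    rw [Set.mem_ofPred_eq, pos_add, hpos, htail, hb]
  rw [Set.indicator_of_mem (by exact ha), Set.indicator_of_mem (by exact hb),
    Set.indicator_of_mem hmem, ← ENNReal.ofReal_mul (Real.exp_pos _).le,
    ← ENNReal.ofReal_mul (by positivity), ← Real.exp_add, ← Real.exp_add]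
  refine ENNReal.ofReal_le_ofReal (Real.exp_le_exp.2 ?_)
  have h1 := energy_sub_le g ω hagree
  rw [ha] at h1
  rw [energy_add, hpos, htail]
  linarith

lemma partAt_lt_top (g : Ω → (Fin ℓ → R) → ℝ) (ω : Ω) (n : ℕ) (y : stepGroup R) :
    partAt g ω n y < ⊤ := by
  obtain ⟨M, hM⟩ := exists_bound_of_finite_dep (N := n + ℓ) fun s s' => energy_congr g ω (n := n) (s := s) (s' := s')
  refine lt_of_le_of_lt (lintegral_mono (g := fun _ => ENNReal.ofReal (Real.exp M)) fun s =>
    ENNReal.ofReal_le_ofReal (Real.exp_le_exp.2 ((le_abs_self _).trans (hM s)))) ?_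
  rw [lintegral_const]
  exact ENNReal.mul_lt_top ENNReal.ofReal_lt_top (measure_lt_top _ _)

lemma partTotal_lt_top (g : Ω → (Fin ℓ → R) → ℝ) (ω : Ω) (n : ℕ) : partTotal g ω n < ⊤ := by
  obtain ⟨M, hM⟩ := exists_bound_of_finite_dep (N := n + ℓ) fun s s' => energy_congr g ω (n := n) (s := s) (s' := s')
  refine lt_of_le_of_lt (lintegral_mono (g := fun _ => ENNReal.ofReal (Real.exp M)) fun s =>
    ENNReal.ofReal_le_ofReal (Real.exp_le_exp.2 ((le_abs_self _).trans (hM s)))) ?_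
  rw [lintegral_const]
  exact ENNReal.mul_lt_top ENNReal.ofReal_lt_top (measure_lt_top _ _)

lemma partAt_zero (g : Ω → (Fin ℓ → R) → ℝ) (ω : Ω) : partAt g ω 0 0 = 1 := by
  simp [partAt, pos, energy]

omit [AddAction (stepGroup R) Ω] in
lemma walkLaw_first_step (z : R) : walkLaw R {s | s 0 = z} = (Fintype.card R : ℝ≥0∞)⁻¹ := by
  have h1 : {s : ℕ → R | s 0 = z} = Set.pi ((({0} : Finset ℕ)) : Set ℕ) fun _ => {z} := by
    ext s; simp
  rw [h1, walkLaw, Measure.infinitePi_pi _ fun i _ => measurableSet_singleton z,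
    Finset.prod_singleton, PMF.toMeasure_apply_singleton _ _ (measurableSet_singleton z),
    PMF.uniformOfFintype_apply]

lemma partAt_one_ge (g : Ω → (Fin ℓ → R) → ℝ) (ω : Ω) (z : R) :
    ENNReal.ofReal (Real.exp (-(Real.log (Fintype.card R) + absPot g ω))) ≤
      partAt g ω 1 (step z) := by
  have hset : {s : ℕ → R | pos s 1 = step z} = {s | s 0 = z} := by
    ext s
    have h : pos s 1 = step (s 0) := by simp [pos]
    rw [Set.mem_ofPred_eq, Set.mem_ofPred_eq, h]
    exact ⟨fun h => Subtype.ext (congrArg (fun x : stepGroup R => (x : Fin d → ℤ)) h),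
      fun h => by rw [h]⟩
  have hcard : (0 : ℝ) < Fintype.card R := by exact_mod_cast Fintype.card_pos
  have h1 : ∫⁻ _ in {s : ℕ → R | s 0 = z}, ENNReal.ofReal (Real.exp (-absPot g ω)) ∂walkLaw R ≤
      partAt g ω 1 (step z) := by
    rw [partAt, hset]
    refine lintegral_mono fun s => ENNReal.ofReal_le_ofReal (Real.exp_le_exp.2 ?_)
    have h2 := abs_le.1 (abs_le_absPot g ω (stepBlock ℓ s 0))
    simp only [energy, Finset.sum_range_one, pos, Finset.sum_range_zero, zero_vadd]
    exact h2.1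
  refine le_trans (le_of_eq ?_) h1
  rw [setLIntegral_const, walkLaw_first_step, neg_add, Real.exp_add, Real.exp_neg,
    Real.exp_log hcard, mul_comm, ENNReal.ofReal_mul (Real.exp_pos _).le,
    ENNReal.ofReal_inv_of_pos hcard, ENNReal.ofReal_natCast]

lemma partAt_endpoint_pos (g : Ω → (Fin ℓ → R) → ℝ) (ω : Ω) (c : R → ℕ) :
    0 < partAt g ω (∑ z, c z) (endpoint c) := by
  classical
  induction c using count_induction with
  | h0 => simp [endpoint_zero, partAt_zero]
  | h1 c z ih =>
    have h1 := partAt_superadditive g ω (∑ z, c z) 1 (endpoint c) (step z)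
    have h2 := partAt_one_ge g (endpoint c +ᵥ ω) z
    rw [endpoint_add, endpoint_single, one_smul]
    simp only [Pi.add_apply, Finset.sum_add_distrib, sum_single]
    refine lt_of_lt_of_le ?_ h1
    refine ENNReal.mul_pos (ENNReal.mul_pos ih.ne' ?_).ne' ?_
    · exact (lt_of_lt_of_le (ENNReal.ofReal_pos.2 (Real.exp_pos _)) h2).ne'
    · exact (ENNReal.ofReal_pos.2 (Real.exp_pos _)).ne'

/-- The logarithm of the point-to-point partition function, as a function of a count vector. -/
def logPart (g : Ω → (Fin ℓ → R) → ℝ) (ω : Ω) (c : R → ℕ) : ℝ :=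
  Real.log (partAt g ω (∑ z, c z) (endpoint c)).toReal

/-- The logarithm of the partition function. -/
def logTotal (g : Ω → (Fin ℓ → R) → ℝ) (ω : Ω) (n : ℕ) : ℝ :=
  Real.log (partTotal g ω n).toReal

lemma partAt_toReal_pos (g : Ω → (Fin ℓ → R) → ℝ) (ω : Ω) (c : R → ℕ) :
    0 < (partAt g ω (∑ z, c z) (endpoint c)).toReal :=
  ENNReal.toReal_pos (partAt_endpoint_pos g ω c).ne' (partAt_lt_top _ _ _ _).ne

lemma logPart_zero (g : Ω → (Fin ℓ → R) → ℝ) (ω : Ω) : logPart g ω 0 = 0 := by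
  simp [logPart, endpoint_zero, partAt_zero]

lemma logPart_congr (g : Ω → (Fin ℓ → R) → ℝ) (ω : Ω) {c c' : R → ℕ}
    (h1 : ∑ z, c z = ∑ z, c' z)
    (h2 : ∑ z : R, c z • (z : Fin d → ℤ) = ∑ z : R, c' z • (z : Fin d → ℤ)) :
    logPart g ω c = logPart g ω c' := by
  have h3 : endpoint c = endpoint c' := Subtype.ext (by rw [coe_endpoint, coe_endpoint, h2])
  rw [logPart, logPart, h1, h3]

/-- Superadditivity of the logarithm of the point-to-point partition function. -/
lemma logPart_add_ge (g : Ω → (Fin ℓ → R) → ℝ) (ω : Ω) (c e : R → ℕ) :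
    logPart g ω c + logPart g (endpoint c +ᵥ ω) e - tailError g (endpoint c +ᵥ ω) ≤
      logPart g ω (c + e) := by
  have h1 := partAt_superadditive g ω (∑ z, c z) (∑ z, e z) (endpoint c) (endpoint e)
  rw [← endpoint_add, ← Finset.sum_add_distrib] at h1
  have h2 := ENNReal.toReal_mono (partAt_lt_top _ _ _ _).ne h1
  rw [ENNReal.toReal_mul, ENNReal.toReal_mul, ENNReal.toReal_ofReal (Real.exp_pos _).le] at h2
  have h3 := partAt_toReal_pos g ω c
  have h4 := partAt_toReal_pos g (endpoint c +ᵥ ω) e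
  have h5 := Real.log_le_log (by positivity) h2
  rw [Real.log_mul (by positivity) (by positivity), Real.log_mul h3.ne' h4.ne', Real.log_exp] at h5
  exact h5

lemma logPart_single_ge [DecidableEq R] (g : Ω → (Fin ℓ → R) → ℝ) (ω : Ω) (z : R) :
    -(Real.log (Fintype.card R) + absPot g ω) ≤ logPart g ω (Pi.single z 1) := by
  have h1 := partAt_one_ge g ω z
  rw [← ENNReal.ofReal_toReal (partAt_lt_top g ω 1 (step z)).ne,
    ENNReal.ofReal_le_ofReal_iff ENNReal.toReal_nonneg] at h1
  have h2 := Real.log_le_log (Real.exp_pos _) h1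
  rw [Real.log_exp] at h2
  rw [logPart, sum_single, endpoint_single, one_smul]
  exact h2

lemma partAt_le_partTotal (g : Ω → (Fin ℓ → R) → ℝ) (ω : Ω) (n : ℕ) (y : stepGroup R) :
    partAt g ω n y ≤ partTotal g ω n := setLIntegral_le_lintegral _ _

lemma partTotal_pos (g : Ω → (Fin ℓ → R) → ℝ) (ω : Ω) (n : ℕ) : 0 < partTotal g ω n := by
  classical
  have h := partAt_endpoint_pos g ω (Pi.single (Classical.arbitrary R) n)
  rw [sum_single] at h
  exact h.trans_le (partAt_le_partTotal _ _ _ _)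

lemma logPart_le_logTotal (g : Ω → (Fin ℓ → R) → ℝ) (ω : Ω) (c : R → ℕ) :
    logPart g ω c ≤ logTotal g ω (∑ z, c z) :=
  Real.log_le_log (partAt_toReal_pos g ω c)
    (ENNReal.toReal_mono (partTotal_lt_top _ _ _).ne (partAt_le_partTotal _ _ _ _))

/-- The partition function is carried, up to a polynomial factor, by a single endpoint. -/
lemma exists_logTotal_le (g : Ω → (Fin ℓ → R) → ℝ) (ω : Ω) (n : ℕ) :
    ∃ c : R → ℕ, ∑ z, c z = n ∧
      logTotal g ω n ≤ Fintype.card R * Real.log (n + 1) + logPart g ω c := by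
  classical
  set S : Finset (R → ℕ) := (Fintype.piFinset fun _ : R => Finset.range (n + 1)).filter
    fun c => ∑ z, c z = n with hS
  have hmemS : ∀ c : R → ℕ, ∑ z, c z = n → c ∈ S := by
    intro c hc
    refine Finset.mem_filter.2 ⟨Fintype.mem_piFinset.2 fun z => Finset.mem_range.2 ?_, hc⟩
    have : c z ≤ ∑ z, c z := Finset.single_le_sum (fun _ _ => Nat.zero_le _) (Finset.mem_univ z)
    omega
  have hcard : (S.card : ℝ) ≤ ((n : ℝ) + 1) ^ Fintype.card R := by
    have h1 : S.card ≤ (n + 1) ^ Fintype.card R := by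
      refine (Finset.card_filter_le _ _).trans (le_of_eq ?_)
      rw [Fintype.card_piFinset]
      simp
    exact_mod_cast h1
  have hne : S.Nonempty := by
    obtain ⟨z⟩ := ‹Nonempty R›
    exact ⟨_, hmemS (Pi.single z n) (sum_single z n)⟩
  obtain ⟨c, hcS, hmax⟩ := S.exists_max_image (fun c => partAt g ω n (endpoint c)) hne
  have hcn : ∑ z, c z = n := (Finset.mem_filter.1 hcS).2
  have hle : partTotal g ω n ≤ S.card * partAt g ω n (endpoint c) := by
    calc partTotal g ω n ≤ ∫⁻ s, ∑ c ∈ S, {s : ℕ → R | pos s n = endpoint c}.indicator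
          (fun s => ENNReal.ofReal (Real.exp (energy R g ω n s))) s ∂walkLaw R := by
          refine lintegral_mono fun s => ?_
          obtain ⟨c, hc, hcs⟩ := exists_endpoint_eq_pos s n
          refine le_trans (le_of_eq ?_) (Finset.single_le_sum
            (f := fun c => {s : ℕ → R | pos s n = endpoint c}.indicator
              (fun s => ENNReal.ofReal (Real.exp (energy R g ω n s))) s)
            (fun _ _ => zero_le) (hmemS c hc))
          rw [Set.indicator_of_mem]
          exact hcs.symm
      _ = ∑ c ∈ S, partAt g ω n (endpoint c) := by
          rw [lintegral_finsetSum _ fun c _ =>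
            (measurable_weight g ω n).indicator (measurableSet_pos_eq n (endpoint c))]
          exact Finset.sum_congr rfl fun c _ => (partAt_eq_indicator g ω n (endpoint c)).symm
      _ ≤ ∑ _c ∈ S, partAt g ω n (endpoint c) := Finset.sum_le_sum fun c hc => hmax c hc
      _ = S.card * partAt g ω n (endpoint c) := by rw [Finset.sum_const, nsmul_eq_mul]
  refine ⟨c, hcn, ?_⟩
  have hpos := partAt_toReal_pos g ω c
  have h1 := ENNReal.toReal_mono
    (ENNReal.mul_lt_top (ENNReal.natCast_lt_top _) (partAt_lt_top g ω n (endpoint c))).ne hle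
  rw [ENNReal.toReal_mul, ENNReal.toReal_natCast] at h1
  have hn1 : (0 : ℝ) < (n : ℝ) + 1 := by positivity
  have h2 : (partTotal g ω n).toReal ≤
      ((n : ℝ) + 1) ^ Fintype.card R * (partAt g ω (∑ z, c z) (endpoint c)).toReal := by
    rw [hcn] at hpos ⊢
    exact h1.trans (mul_le_mul_of_nonneg_right hcard hpos.le)
  have h3 := Real.log_le_log
    (ENNReal.toReal_pos (partTotal_pos g ω n).ne' (partTotal_lt_top g ω n).ne) h2
  rwa [Real.log_mul (by positivity) hpos.ne', Real.log_pow] at h3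

lemma logPartition_eq (g : Ω → (Fin ℓ → R) → ℝ) (ω : Ω) (n : ℕ) :
    logPartition R g ω n = ((logTotal g ω n / n : ℝ) : EReal) := by
  have h1 := ENNReal.log_pos_real (partTotal_pos g ω n).ne' (partTotal_lt_top g ω n).ne
  rw [logPartition, ← partTotal, h1, ← EReal.coe_mul, logTotal, div_eq_inv_mul]

lemma logPartitionAt_eq (g : Ω → (Fin ℓ → R) → ℝ) (ω : Ω) {n : ℕ} {c : R → ℕ}
    (hc : ∑ z, c z = n) :
    logPartitionAt R g ω n (∑ z : R, c z • (z : Fin d → ℤ)) =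
      ((logPart g ω c / n : ℝ) : EReal) := by
  subst hc
  have hset : {s : ℕ → R | (pos s (∑ z, c z) : Fin d → ℤ) = ∑ z : R, c z • (z : Fin d → ℤ)} =
      {s | pos s (∑ z, c z) = endpoint c} := by
    ext s
    rw [Set.mem_ofPred_eq, Set.mem_ofPred_eq, ← coe_endpoint, Subtype.ext_iff]
  have h1 := ENNReal.log_pos_real (partAt_endpoint_pos g ω c).ne' (partAt_lt_top _ _ _ _).ne
  rw [logPartitionAt, hset, ← partAt, h1, ← EReal.coe_mul, logPart, div_eq_inv_mul]

variable [MeasurableSpace Ω] [MeasurableConstVAdd (stepGroup R) Ω] {g : Ω → (Fin ℓ → R) → ℝ}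

omit [Nonempty R] in
lemma measurable_energy_env (hg : ∀ w, Measurable fun ω => g ω w) (n : ℕ) (s : ℕ → R) :
    Measurable fun ω => energy R g ω n s :=
  Finset.measurable_sum _ fun _ _ => (hg _).comp (measurable_const_vadd _)

lemma measurable_weight_prod (hg : ∀ w, Measurable fun ω => g ω w) (n : ℕ) :
    Measurable fun p : Ω × (ℕ → R) => ENNReal.ofReal (Real.exp (energy R g p.1 n p.2)) :=
  (Real.measurable_exp.comp (measurable_prod_of_finite_dep (N := n + ℓ)
    (measurable_energy_env hg n) fun ω _ _ => energy_congr g ω)).ennreal_ofReal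

lemma measurable_logPart (hg : ∀ w, Measurable fun ω => g ω w) (c : R → ℕ) :
    Measurable fun ω => logPart g ω c :=
  ((measurable_weight_prod hg _).lintegral_prod_right').ennreal_toReal.log

lemma measurable_logTotal (hg : ∀ w, Measurable fun ω => g ω w) (n : ℕ) :
    Measurable fun ω => logTotal g ω n :=
  ((measurable_weight_prod hg _).lintegral_prod_right').ennreal_toReal.log

end Walk

end RWRP

end

noncomputable section

namespace RWRP

/-! ### Typical environments -/

section Typical

variable {d ℓ : ℕ} {R : Finset (Fin d → ℤ)}

lemma toReal_add (x y : Fin d → ℤ) : toReal (x + y) = toReal x + toReal y := by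
  ext i
  simp [toReal]

lemma toReal_smul (n : ℕ) (x : Fin d → ℤ) : toReal (n • x) = (n : ℝ) • toReal x := by
  ext i
  simp [toReal]

lemma toReal_zero : toReal (0 : Fin d → ℤ) = 0 := by
  ext i
  simp [toReal]

lemma toReal_sum {ι : Type*} (s : Finset ι) (f : ι → Fin d → ℤ) :
    toReal (∑ i ∈ s, f i) = ∑ i ∈ s, toReal (f i) := by
  classical
  induction s using Finset.induction_on with
  | empty => simp [toReal_zero]
  | insert a s ha ih => rw [Finset.sum_insert ha, Finset.sum_insert ha, toReal_add, ih]

/-- A common bound for the lengths of the steps. -/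
lemma exists_step_bound (R : Finset (Fin d → ℤ)) :
    ∃ A : ℕ, 1 ≤ A ∧ ∀ c : R → ℕ, ‖toReal ((endpoint c : stepGroup R) : Fin d → ℤ)‖ ≤
      A * (∑ z, c z : ℕ) := by
  obtain ⟨A, hA⟩ := exists_nat_ge (∑ z : R, ‖toReal (z : Fin d → ℤ)‖)
  refine ⟨A + 1, by omega, fun c => ?_⟩
  rw [coe_endpoint, toReal_sum]
  refine (norm_sum_le _ _).trans ?_
  push_cast
  rw [Finset.mul_sum]
  refine Finset.sum_le_sum fun z _ => ?_
  rw [toReal_smul, norm_smul, Real.norm_natCast, mul_comm]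
  refine mul_le_mul_of_nonneg_right ?_ (Nat.cast_nonneg _)
  have : ‖toReal (z : Fin d → ℤ)‖ ≤ ∑ z : R, ‖toReal (z : Fin d → ℤ)‖ :=
    Finset.single_le_sum (f := fun z : R => ‖toReal (z : Fin d → ℤ)‖)
      (fun _ _ => norm_nonneg _) (Finset.mem_univ z)
  linarith

variable {Ω : Type*} [AddAction (stepGroup R) Ω]

variable (R) in
/-- In the environment `ω`, the sums of `f` over segments of length `ε n` in a ball of radius `n`
are of small order `n` when `ε` is small: the defining property of the class `𝓛`. -/
def SegmentSmall (f : Ω → ℝ) (ω : Ω) : Prop :=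
  ∀ z : R, (z : Fin d → ℤ) ≠ 0 → ∀ δ : ℝ, 0 < δ → ∀ᶠ ε : ℝ in 𝓝[>] (0 : ℝ), ∀ᶠ n : ℕ in atTop,
    ∀ x : stepGroup R, ‖toReal (x : Fin d → ℤ)‖ ≤ n →
      ∑ k ∈ Finset.range (⌊ε * n⌋₊ + 1), f ((x + k • step z) +ᵥ ω) ≤ δ * n

lemma SegmentSmall.add {f g : Ω → ℝ} {ω : Ω} (hf : SegmentSmall R f ω) (hg : SegmentSmall R g ω) :
    SegmentSmall R (fun ω => f ω + g ω) ω := by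
  intro z hz δ hδ
  filter_upwards [hf z hz (δ / 2) (by positivity), hg z hz (δ / 2) (by positivity)] with ε h1 h2
  filter_upwards [h1, h2] with n h3 h4 x hx
  rw [Finset.sum_add_distrib]
  linarith [h3 x hx, h4 x hx]

lemma segmentSmall_const (c : ℝ) (ω : Ω) : SegmentSmall R (fun _ : Ω => c) ω := by
  intro z hz δ hδ
  have h1 : ∀ᶠ ε in 𝓝[>] (0 : ℝ), ε * |c| < δ / 2 := by
    have : Tendsto (fun ε : ℝ => ε * |c|) (𝓝[>] 0) (𝓝 (0 * |c|)) :=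
      (continuous_mul_const |c|).continuousAt.tendsto.mono_left nhdsWithin_le_nhds
    rw [zero_mul] at this
    exact (tendsto_order.1 this).2 _ (by positivity)
  filter_upwards [h1, self_mem_nhdsWithin] with ε hε hε0
  have hε0' : (0 : ℝ) < ε := hε0
  have h2 : ∀ᶠ n : ℕ in atTop, |c| / (δ / 2) ≤ (n : ℝ) :=
    tendsto_natCast_atTop_atTop.eventually_ge_atTop _
  filter_upwards [h2] with n hn x _
  rw [div_le_iff₀ (by positivity)] at hn
  rw [Finset.sum_const, Finset.card_range, nsmul_eq_mul]
  push_cast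
  have h3 : (⌊ε * n⌋₊ : ℝ) ≤ ε * n := Nat.floor_le (by positivity)
  have h4 : ((⌊ε * n⌋₊ : ℝ) + 1) * c ≤ (ε * n + 1) * |c| :=
    (mul_le_mul_of_nonneg_left (le_abs_self c) (by positivity)).trans
      (mul_le_mul_of_nonneg_right (by linarith) (abs_nonneg c))
  nlinarith [Nat.cast_nonneg (α := ℝ) n]

lemma SegmentSmall.sum {ι : Type*} (s : Finset ι) {f : ι → Ω → ℝ} {ω : Ω}
    (hf : ∀ i ∈ s, SegmentSmall R (f i) ω) : SegmentSmall R (fun ω => ∑ i ∈ s, f i ω) ω := by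
  classical
  induction s using Finset.induction_on with
  | empty => simpa using segmentSmall_const (R := R) 0 ω
  | insert a s ha ih =>
    simp only [Finset.sum_insert ha]
    exact (hf a (Finset.mem_insert_self a s)).add
      (ih fun i hi => hf i (Finset.mem_insert_of_mem hi))

lemma SegmentSmall.shift {f : Ω → ℝ} {ω : Ω} (hf : SegmentSmall R f ω) (hf0 : ∀ ω, 0 ≤ f ω)
    (u : stepGroup R) : SegmentSmall R (fun ω => f (u +ᵥ ω)) ω := by
  intro z hz δ hδ
  obtain ⟨B, hB⟩ := exists_nat_ge ‖toReal (u : Fin d → ℤ)‖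
  filter_upwards [hf z hz (δ / 2) (by positivity), self_mem_nhdsWithin] with ε h1 hε0
  have hε0' : (0 : ℝ) < ε := hε0
  filter_upwards [(tendsto_add_atTop_nat B).eventually h1, eventually_ge_atTop B] with n hn hnB x hx
  have h2 := hn (x + u) (by
    rw [AddSubgroup.coe_add, toReal_add]
    push_cast
    exact (norm_add_le _ _).trans (add_le_add hx hB))
  have hnB' : (B : ℝ) ≤ n := by exact_mod_cast hnB
  push_cast at h2
  calc ∑ k ∈ Finset.range (⌊ε * n⌋₊ + 1), f (u +ᵥ ((x + k • step z) +ᵥ ω))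
      ≤ ∑ k ∈ Finset.range (⌊ε * ((n : ℝ) + B)⌋₊ + 1), f (((x + u) + k • step z) +ᵥ ω) := by
        have h3 : ∀ k : ℕ, f (u +ᵥ ((x + k • step z) +ᵥ ω)) = f (((x + u) + k • step z) +ᵥ ω) := by
          intro k
          rw [vadd_vadd]
          congr 2
          abel
        simp only [h3]
        refine Finset.sum_le_sum_of_subset_of_nonneg (Finset.range_subset_range.2 ?_)
          fun _ _ _ => hf0 _
        refine Nat.succ_le_succ (Nat.floor_mono ?_)
        exact mul_le_mul_of_nonneg_left (by linarith [Nat.cast_nonneg (α := ℝ) B]) hε0'.le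
    _ ≤ δ / 2 * (n + B) := h2
    _ ≤ δ * n := by nlinarith

/-- The cost of one step, relative to the environment seen from its starting point. -/
def stepCost (g : Ω → (Fin ℓ → R) → ℝ) (ω : Ω) : ℝ :=
  Real.log (Fintype.card R) + absPot g ω + tailError g ω

lemma stepCost_nonneg (g : Ω → (Fin ℓ → R) → ℝ) (ω : Ω) : 0 ≤ stepCost g ω :=
  add_nonneg (add_nonneg (Real.log_natCast_nonneg _) (absPot_nonneg g ω)) (tailError_nonneg g ω)

lemma segmentSmall_tailError {g : Ω → (Fin ℓ → R) → ℝ} {ω : Ω}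
    (h : SegmentSmall R (absPot g) ω) : SegmentSmall R (tailError g) ω := by
  have h1 := SegmentSmall.sum (Finset.range (ℓ + 1)) (f := fun j ω => ∑ u : Fin j → R,
    absPot g (-(∑ i, step (u i)) +ᵥ ω)) (ω := ω) fun j _ =>
      SegmentSmall.sum Finset.univ fun u _ => h.shift (absPot_nonneg g) _
  have h2 := h1.add h1
  simp only [← two_mul] at h2
  exact h2

lemma segmentSmall_stepCost {g : Ω → (Fin ℓ → R) → ℝ} {ω : Ω}
    (h : SegmentSmall R (absPot g) ω) : SegmentSmall R (stepCost g) ω :=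
  ((segmentSmall_const _ ω).add h).add (segmentSmall_tailError h)

/-- The tail errors in a ball of radius of order `n` are of small order `n`. -/
lemma eventually_tailError_le {g : Ω → (Fin ℓ → R) → ℝ} {ω : Ω}
    (h : SegmentSmall R (absPot g) ω) (B : ℕ) {δ : ℝ} (hδ : 0 < δ) :
    ∀ᶠ n : ℕ in atTop, ∀ x : stepGroup R, ‖toReal (x : Fin d → ℤ)‖ ≤ B * n →
      tailError g (x +ᵥ ω) ≤ δ * n := by
  by_cases hz : ∃ z : R, (z : Fin d → ℤ) ≠ 0
  · obtain ⟨z, hz⟩ := hz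
    obtain ⟨ε, hε⟩ := (segmentSmall_tailError h z hz (δ / (B + 1)) (by positivity)).exists
    have hmul : Tendsto (fun n : ℕ => (B + 1) * n) atTop atTop :=
      tendsto_id.const_mul_atTop' (by omega)
    filter_upwards [hmul.eventually hε] with n hn x hx
    have h1 := hn x (by push_cast; linarith [Nat.cast_nonneg (α := ℝ) n])
    have h2 : tailError g (x +ᵥ ω) ≤ ∑ k ∈ Finset.range (⌊ε * ((B + 1) * n : ℕ)⌋₊ + 1),
        tailError g ((x + k • step z) +ᵥ ω) := by
      have h3 := Finset.single_le_sum (f := fun k => tailError g ((x + k • step z) +ᵥ ω))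
        (fun _ _ => tailError_nonneg g _)
        (Finset.mem_range.2 (Nat.succ_pos ⌊ε * ((B + 1) * n : ℕ)⌋₊))
      simpa using h3
    refine h2.trans (h1.trans (le_of_eq ?_))
    push_cast
    field_simp
  · -- all steps vanish, so the group is trivial
    push Not at hz
    have htriv : ∀ x : stepGroup R, x = 0 := by
      rintro ⟨x, hx⟩
      refine Subtype.ext ?_
      have hsub : (R : Set (Fin d → ℤ)) ⊆ ((⊥ : AddSubgroup (Fin d → ℤ)) : Set (Fin d → ℤ)) := by
        intro y hy
        exact hz ⟨y, hy⟩
      exact AddSubgroup.mem_bot.1 ((AddSubgroup.closure_le ⊥).2 hsub hx)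
    have h1 : ∀ᶠ n : ℕ in atTop, tailError g ω / δ ≤ (n : ℝ) :=
      tendsto_natCast_atTop_atTop.eventually_ge_atTop _
    filter_upwards [h1] with n hn x _
    rw [htriv x, zero_vadd]
    rwa [div_le_iff₀' hδ] at hn

variable [Nonempty R]

lemma logPart_add_single_ge [DecidableEq R] (g : Ω → (Fin ℓ → R) → ℝ) (ω : Ω) (c : R → ℕ) (z : R) :
    logPart g ω c - stepCost g (endpoint c +ᵥ ω) ≤ logPart g ω (c + Pi.single z 1) := by
  have h1 := logPart_add_ge g ω c (Pi.single z 1)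
  have h2 := logPart_single_ge g (endpoint c +ᵥ ω) z
  simp only [stepCost]
  linarith

lemma logPart_add_single_ge_sum [DecidableEq R] (g : Ω → (Fin ℓ → R) → ℝ) (ω : Ω) (c : R → ℕ)
    (z : R) (j : ℕ) :
    logPart g ω c - ∑ k ∈ Finset.range j, stepCost g ((endpoint c + k • step z) +ᵥ ω) ≤
      logPart g ω (c + Pi.single z j) := by
  induction j with
  | zero => simp
  | succ j ih =>
    have h1 := logPart_add_single_ge g ω (c + Pi.single z j) z
    rw [add_assoc, ← Pi.single_add, endpoint_add, endpoint_single] at h1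
    rw [Finset.sum_range_succ]
    linarith

/-- Paths can be prolonged by few steps in one direction at little cost. Zero steps are made at the
start of the path, where their cost is fixed, the other steps at its end. -/
lemma eventually_extend_direction [DecidableEq R] {g : Ω → (Fin ℓ → R) → ℝ} {ω : Ω}
    (h : SegmentSmall R (absPot g) ω) (z : R) {δ : ℝ} (hδ : 0 < δ) :
    ∀ᶠ ε in 𝓝[>] (0 : ℝ), ∀ᶠ n : ℕ in atTop, ∀ (c : R → ℕ) (j : ℕ), ∑ z, c z ≤ 3 * n →
      (j : ℝ) ≤ ε * n → logPart g ω c - δ * n ≤ logPart g ω (c + Pi.single z j) := by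
  by_cases hz : (z : Fin d → ℤ) = 0
  · have hz' : step z = 0 := Subtype.ext hz
    have h1 : ∀ᶠ ε in 𝓝[>] (0 : ℝ), ε * stepCost g ω < δ / 2 := by
      have : Tendsto (fun ε : ℝ => ε * stepCost g ω) (𝓝[>] 0) (𝓝 (0 * stepCost g ω)) :=
        (continuous_mul_const (stepCost g ω)).continuousAt.tendsto.mono_left nhdsWithin_le_nhds
      rw [zero_mul] at this
      exact (tendsto_order.1 this).2 _ (by positivity)
    filter_upwards [h1] with ε hε
    have h2 : ∀ᶠ n : ℕ in atTop, tailError g ω / (δ / 2) ≤ (n : ℝ) :=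
      tendsto_natCast_atTop_atTop.eventually_ge_atTop _
    filter_upwards [h2] with n hn c j _ hj
    rw [div_le_iff₀ (by positivity)] at hn
    have h3 := logPart_add_single_ge_sum g ω 0 z j
    have h4 := logPart_add_ge g ω (Pi.single z j) c
    simp only [hz', smul_zero, endpoint_zero, add_zero, zero_vadd, Finset.sum_const,
      Finset.card_range, nsmul_eq_mul, logPart_zero, zero_add] at h3
    rw [endpoint_single, hz', smul_zero, zero_vadd, add_comm (Pi.single z j) c] at h4
    have h5 := mul_le_mul_of_nonneg_right hj (stepCost_nonneg g ω)
    nlinarith [Nat.cast_nonneg (α := ℝ) n]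
  · obtain ⟨A, hA1, hA⟩ := exists_step_bound R
    have hA1' : (1 : ℝ) ≤ A := by exact_mod_cast hA1
    filter_upwards [segmentSmall_stepCost h z hz (δ / (3 * A)) (by positivity), self_mem_nhdsWithin]
      with ε hε hε0
    have hε0' : (0 : ℝ) < ε := hε0
    have hmul : Tendsto (fun n : ℕ => (3 * A) * n) atTop atTop :=
      tendsto_id.const_mul_atTop' (by omega)
    filter_upwards [hmul.eventually hε] with n hn c j hc hj
    have hc' : ((∑ z, c z : ℕ) : ℝ) ≤ 3 * n := by exact_mod_cast hc
    have hn0 : (0 : ℝ) ≤ n := Nat.cast_nonneg n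
    have h1 := hn (endpoint c) ((hA c).trans (by push_cast at hc' ⊢; nlinarith))
    have h2 := logPart_add_single_ge_sum g ω c z j
    have h3 : ∑ k ∈ Finset.range j, stepCost g ((endpoint c + k • step z) +ᵥ ω) ≤
        ∑ k ∈ Finset.range (⌊ε * ((3 * A) * n : ℕ)⌋₊ + 1),
          stepCost g ((endpoint c + k • step z) +ᵥ ω) := by
      refine Finset.sum_le_sum_of_subset_of_nonneg (Finset.range_subset_range.2 ?_)
        fun _ _ _ => stepCost_nonneg g _
      refine (Nat.le_floor ?_).trans (Nat.le_succ _)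
      push_cast
      refine hj.trans (mul_le_mul_of_nonneg_left ?_ hε0'.le)
      nlinarith
    have h4 : δ / (3 * A) * ((3 * A) * n : ℕ) = δ * n := by
      push_cast
      field_simp
    rw [h4] at h1
    linarith

lemma eventually_extend [DecidableEq R] {g : Ω → (Fin ℓ → R) → ℝ} {ω : Ω}
    (h : SegmentSmall R (absPot g) ω) (S : Finset R) {δ : ℝ} (hδ : 0 < δ) :
    ∀ᶠ ε in 𝓝[>] (0 : ℝ), ∀ᶠ n : ℕ in atTop, ∀ c e : R → ℕ, ∑ z, c z + ∑ z, e z ≤ 3 * n →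
      (∀ z, (e z : ℝ) ≤ ε * n) →
      logPart g ω c - δ * n ≤ logPart g ω (c + ∑ z ∈ S, Pi.single z (e z)) := by
  induction S using Finset.induction_on generalizing δ with
  | empty =>
    refine Eventually.of_forall fun ε => Eventually.of_forall fun n c e _ _ => ?_
    rw [Finset.sum_empty, add_zero]
    have := mul_nonneg hδ.le (Nat.cast_nonneg (α := ℝ) n)
    linarith
  | insert a S ha ih =>
    filter_upwards [ih (half_pos hδ), eventually_extend_direction h a (half_pos hδ)] with ε h1 h2
    filter_upwards [h1, h2] with n h3 h4 c e hce he
    have h5 := h3 c e hce he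
    have h6 := h4 (c + ∑ z ∈ S, Pi.single z (e z)) (e a) ?_ (he a)
    · rw [Finset.sum_insert ha, add_comm (Pi.single a (e a) : R → ℕ), ← add_assoc]
      linarith
    · refine le_trans ?_ hce
      simp only [Pi.add_apply, Finset.sum_add_distrib]
      refine Nat.add_le_add_left (Finset.sum_le_sum fun i _ => ?_) _
      rw [Finset.sum_apply, Finset.sum_pi_single]
      split_ifs <;> simp

lemma logPart_extension {g : Ω → (Fin ℓ → R) → ℝ} {ω : Ω} (h : SegmentSmall R (absPot g) ω)
    {δ : ℝ} (hδ : 0 < δ) : ∃ ε : ℝ, 0 < ε ∧ ∃ n₀ : ℕ, ∀ n : ℕ, n₀ ≤ n → ∀ c e : R → ℕ,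
      ∑ i, c i ≤ 2 * n → ((∑ i, e i : ℕ) : ℝ) ≤ ε * n →
      logPart g ω c - δ * n ≤ logPart g ω (c + e) := by
  classical
  obtain ⟨ε, ⟨h1, hε1⟩, hε0⟩ := (((eventually_extend h Finset.univ hδ).and
    (nhdsWithin_le_nhds (gt_mem_nhds (zero_lt_one (α := ℝ))))).and self_mem_nhdsWithin).exists
  obtain ⟨n₀, hn₀⟩ := eventually_atTop.1 h1
  refine ⟨ε, hε0, n₀, fun n hn c e hc he => ?_⟩
  have h2 : ((∑ i, e i : ℕ) : ℝ) ≤ n :=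
    he.trans (by nlinarith [Nat.cast_nonneg (α := ℝ) n])
  have h3 : ∑ i, e i ≤ n := by exact_mod_cast h2
  have h4 := hn₀ n hn c e (by omega) fun z => by
    refine le_trans ?_ he
    exact_mod_cast Finset.single_le_sum (f := e) (fun _ _ => Nat.zero_le _) (Finset.mem_univ z)
  rwa [Finset.univ_sum_single] at h4

variable [MeasurableSpace Ω] {ℙ : Measure Ω} {g : Ω → (Fin ℓ → R) → ℝ}

omit [Nonempty R] in
lemma MemClassL.measurable (hg : MemClassL R ℙ g) (w : Fin ℓ → R) :
    Measurable fun ω => g ω w := (hg w).1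

omit [Nonempty R] in
/-- The class `𝓛` in terms of finite bounds. -/
lemma MemClassL.ae_segmentSmall (hg : MemClassL R ℙ g) :
    ∀ᵐ ω ∂ℙ, SegmentSmall R (absPot g) ω := by
  have hall : ∀ᵐ ω ∂ℙ, ∀ w : Fin ℓ → R, SegmentSmall R (fun ω => |g ω w|) ω := by
    rw [ae_all_iff]
    intro w
    have h1 : ∀ᵐ ω ∂ℙ, ∀ z : R, (z : Fin d → ℤ) ≠ 0 → limsup (fun ε : ℝ =>
        limsup (fun n : ℕ =>
          ⨆ x : stepGroup R, ⨆ _ : ‖toReal (x : Fin d → ℤ)‖ ≤ n,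
            ENNReal.ofReal ((n : ℝ)⁻¹ *
              ∑ k ∈ Finset.range (⌊ε * n⌋₊ + 1), |g ((x + k • step z) +ᵥ ω) w|)) atTop)
        (𝓝[>] (0 : ℝ)) = 0 := by
      rw [ae_all_iff]
      intro z
      by_cases hz : (z : Fin d → ℤ) = 0
      · exact Eventually.of_forall fun ω h => absurd hz h
      · filter_upwards [(hg w).2.2 z hz] with ω hω _ using hω
    filter_upwards [h1] with ω hω z hz δ hδ
    have h2 := hω z hz
    have h3 := eventually_lt_of_limsup_lt (lt_of_eq_of_lt h2 (ENNReal.ofReal_pos.2 hδ))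
    filter_upwards [h3] with ε hε
    filter_upwards [eventually_lt_of_limsup_lt hε, eventually_gt_atTop 0] with n hn hn0 x hx
    have hn0' : (0 : ℝ) < n := by exact_mod_cast hn0
    have h4 := lt_of_le_of_lt (le_iSup₂ (f := fun (x : stepGroup R)
      (_ : ‖toReal (x : Fin d → ℤ)‖ ≤ n) => ENNReal.ofReal ((n : ℝ)⁻¹ *
        ∑ k ∈ Finset.range (⌊ε * n⌋₊ + 1), |g ((x + k • step z) +ᵥ ω) w|)) x hx) hn
    have h5 := (ENNReal.ofReal_lt_ofReal_iff hδ).1 h4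
    rw [inv_mul_lt_iff₀ hn0'] at h5
    linarith
  filter_upwards [hall] with ω hω
  exact SegmentSmall.sum Finset.univ fun w _ => hω w

variable [MeasurableConstVAdd (stepGroup R) Ω]

omit [AddAction (stepGroup R) Ω] [Nonempty R] [MeasurableConstVAdd (stepGroup R) Ω] in
lemma measurable_absPot (hg : ∀ w, Measurable fun ω => g ω w) : Measurable (absPot g) :=
  Finset.measurable_sum _ fun w _ => (hg w).norm

omit [Nonempty R] in
lemma measurable_tailError (hg : ∀ w, Measurable fun ω => g ω w) : Measurable (tailError g) :=
  (Finset.measurable_sum _ fun _ _ => Finset.measurable_sum _ fun _ _ =>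
    (measurable_absPot hg).comp (measurable_const_vadd _)).const_mul 2

omit [Nonempty R] in
lemma measurable_stepCost (hg : ∀ w, Measurable fun ω => g ω w) : Measurable (stepCost g) :=
  (measurable_const.add (measurable_absPot hg)).add (measurable_tailError hg)

variable [VAddInvariantMeasure (stepGroup R) Ω ℙ]

omit [Nonempty R] [MeasurableConstVAdd (stepGroup R) Ω]
  [VAddInvariantMeasure (stepGroup R) Ω ℙ] in
lemma MemClassL.integrable_absPot (hg : MemClassL R ℙ g) : Integrable (absPot g) ℙ :=
  integrable_finsetSum _ fun w _ => (hg w).2.1.abs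

omit [Nonempty R] in
lemma MemClassL.integrable_tailError (hg : MemClassL R ℙ g) : Integrable (tailError g) ℙ :=
  (integrable_finsetSum _ fun _ _ => integrable_finsetSum _ fun _ _ =>
    (measurePreserving_vadd _ ℙ).integrable_comp_of_integrable hg.integrable_absPot).const_mul 2

omit [Nonempty R] in
lemma MemClassL.integrable_stepCost [IsFiniteMeasure ℙ] (hg : MemClassL R ℙ g) :
    Integrable (stepCost g) ℙ :=
  ((integrable_const _).add hg.integrable_absPot).add hg.integrable_tailError

lemma MemClassL.exists_logPart_ge [IsFiniteMeasure ℙ] (hg : MemClassL R ℙ g) (c : R → ℕ) :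
    ∃ a : Ω → ℝ, Measurable a ∧ (∀ ω, 0 ≤ a ω) ∧ Integrable a ℙ ∧ ∀ ω, -a ω ≤ logPart g ω c := by
  classical
  induction c using count_induction with
  | h0 => exact ⟨fun _ => 0, measurable_const, fun _ => le_rfl, integrable_const _,
      fun ω => by rw [logPart_zero, neg_zero]⟩
  | h1 c z ih =>
    obtain ⟨a, h1, h2, h3, h4⟩ := ih
    refine ⟨fun ω => a ω + stepCost g (endpoint c +ᵥ ω),
      h1.add ((measurable_stepCost hg.measurable).comp (measurable_const_vadd _)),
      fun ω => add_nonneg (h2 ω) (stepCost_nonneg g _),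
      h3.add ((measurePreserving_vadd _ ℙ).integrable_comp_of_integrable hg.integrable_stepCost),
      fun ω => ?_⟩
    have h5 := logPart_add_single_ge g ω c z
    linarith [h4 ω]

omit [Nonempty R] [MeasurableSpace Ω] [MeasurableConstVAdd (stepGroup R) Ω] in
lemma iterate_vadd (y : stepGroup R) (m : ℕ) (ω : Ω) :
    (fun ω : Ω => y +ᵥ ω)^[m] ω = (m • y) +ᵥ ω := by
  induction m with
  | zero => simp
  | succ m ih => rw [Function.iterate_succ_apply', ih, vadd_vadd, succ_nsmul']

/-- In almost every environment the growth rate exists in every lattice direction, by the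
subadditive ergodic theorem for the shift in that direction. -/
lemma MemClassL.ae_tendsto_lattice [IsFiniteMeasure ℙ] (hg : MemClassL R ℙ g) (κ : R → ℕ) :
    ∀ᵐ ω ∂ℙ, ∃ l : EReal,
      Tendsto (fun m : ℕ => ((logPart g ω (m • κ) / m : ℝ) : EReal)) atTop (𝓝 l) := by
  obtain ⟨a, h1, h2, h3, h4⟩ := hg.exists_logPart_ge κ
  refine ae_tendsto_of_almost_superadditive (measurePreserving_vadd (endpoint κ) ℙ)
    (fun n => measurable_logPart hg.measurable _) (measurable_tailError hg.measurable)
    (tailError_nonneg g) hg.integrable_tailError h1 h2 h3 ?_ ?_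
  · intro m n ω _ _
    rw [iterate_vadd, ← endpoint_smul, add_smul]
    exact logPart_add_ge g ω (m • κ) (n • κ)
  · intro ω
    rw [one_smul]
    exact h4 ω

/-- In almost every environment the point-to-point partition functions are regular. -/
theorem MemClassL.ae_isRegular [IsFiniteMeasure ℙ] (hg : MemClassL R ℙ g) :
    ∀ᵐ ω ∂ℙ, IsRegular (fun z : R => (z : Fin d → ℤ)) (logPart g ω) := by
  filter_upwards [hg.ae_segmentSmall, ae_all_iff.2 hg.ae_tendsto_lattice] with ω h1 h2
  exact ⟨fun c c' h3 h4 => logPart_congr g ω h3 h4, fun δ hδ => logPart_extension h1 hδ,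
    fun κ _ => h2 κ⟩

/-! ### Functions decreasing along all steps are constant -/

omit [Nonempty R] in
lemma preimage_vadd_ae_eq {A : Set Ω} (hA : ∀ z : R, (fun ω => step z +ᵥ ω) ⁻¹' A =ᵐ[ℙ] A)
    (x : stepGroup R) : (fun ω => x +ᵥ ω) ⁻¹' A =ᵐ[ℙ] A := by
  obtain ⟨x, hx⟩ := x
  induction hx using AddSubgroup.closure_induction with
  | mem x hx => exact hA ⟨x, hx⟩
  | zero =>
    have : (fun ω : Ω => (⟨0, zero_mem _⟩ : stepGroup R) +ᵥ ω) = id :=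
      funext fun ω => zero_vadd _ ω
    rw [this, Set.preimage_id]
    exact EventuallyEq.rfl
  | add x y hx hy ihx ihy =>
    have h1 := (measurePreserving_vadd (⟨y, hy⟩ : stepGroup R) ℙ).quasiMeasurePreserving.preimage_ae_eq ihx
    rw [← Set.preimage_comp] at h1
    have h2 : (fun ω : Ω => (⟨x + y, add_mem hx hy⟩ : stepGroup R) +ᵥ ω) =
        (fun ω : Ω => (⟨x, hx⟩ : stepGroup R) +ᵥ ω) ∘ fun ω => (⟨y, hy⟩ : stepGroup R) +ᵥ ω :=
      funext fun ω => add_vadd (⟨x, hx⟩ : stepGroup R) ⟨y, hy⟩ ω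
    rw [h2]
    exact h1.trans ihy
  | neg x hx ih =>
    have h1 := (measurePreserving_vadd (-⟨x, hx⟩ : stepGroup R) ℙ).quasiMeasurePreserving.preimage_ae_eq ih
    rw [← Set.preimage_comp] at h1
    have h2 : (fun ω : Ω => (⟨x, hx⟩ : stepGroup R) +ᵥ ω) ∘
        (fun ω => (-⟨x, hx⟩ : stepGroup R) +ᵥ ω) = id :=
      funext fun ω => vadd_neg_vadd _ ω
    rw [h2, Set.preimage_id] at h1
    exact h1.symm

omit [Nonempty R] in
lemma IsErgodic.measure_zero_or_one [IsProbabilityMeasure ℙ] (hℙ : IsErgodic R ℙ) {A : Set Ω}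
    (hAm : MeasurableSet A) (hA : ∀ z : R, (fun ω => step z +ᵥ ω) ⁻¹' A =ᵐ[ℙ] A) :
    ℙ A = 0 ∨ ℙ A = 1 := by
  -- an almost invariant event differs by a null set from the invariant event that the whole orbit
  -- lies in it
  set A' : Set Ω := ⋂ x : stepGroup R, (fun ω => x +ᵥ ω) ⁻¹' A with hA'
  have hA'm : MeasurableSet A' := MeasurableSet.iInter fun x => measurable_const_vadd x hAm
  have hae : A' =ᵐ[ℙ] A := by
    have h1 : ∀ᵐ ω ∂ℙ, ∀ x : stepGroup R, (x +ᵥ ω ∈ A ↔ ω ∈ A) := by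
      rw [ae_all_iff]
      intro x
      filter_upwards [preimage_vadd_ae_eq hA x] with ω hω
      exact iff_of_eq hω
    filter_upwards [h1] with ω hω
    refine propext ⟨fun h => ?_, fun h => ?_⟩
    · exact (hω 0).1 (Set.mem_iInter.1 h 0)
    · exact Set.mem_iInter.2 fun x => (hω x).2 h
  rw [← measure_congr hae]
  refine hℙ A' hA'm fun z => ?_
  ext ω
  simp only [hA', Set.mem_preimage, Set.mem_iInter]
  constructor
  · intro h x
    have := h (x - step z)
    rwa [vadd_vadd, sub_add_cancel] at this
  · intro h x
    rw [vadd_vadd]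
    exact h _

omit [Nonempty R] in
/-- A function which almost surely does not increase along the steps is almost surely constant. -/
theorem IsErgodic.ae_const_of_le [IsProbabilityMeasure ℙ] (hℙ : IsErgodic R ℙ) {f : Ω → EReal}
    (hf : Measurable f) (hle : ∀ z : R, ∀ᵐ ω ∂ℙ, f (step z +ᵥ ω) ≤ f ω) :
    ∃ c : EReal, ∀ᵐ ω ∂ℙ, f ω = c := by
  have hdich : ∀ a : EReal, (∀ᵐ ω ∂ℙ, f ω ≤ a) ∨ ∀ᵐ ω ∂ℙ, a < f ω := by
    intro a
    have hm : MeasurableSet {ω | f ω ≤ a} := hf measurableSet_Iic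
    have h1 : ∀ z : R, (fun ω => step z +ᵥ ω) ⁻¹' {ω | f ω ≤ a} =ᵐ[ℙ] {ω | f ω ≤ a} := by
      intro z
      have hmp := measurePreserving_vadd (step z) ℙ
      have hsub : {ω | f ω ≤ a} ≤ᵐ[ℙ] (fun ω => step z +ᵥ ω) ⁻¹' {ω | f ω ≤ a} := by
        filter_upwards [hle z] with ω hω h
        exact hω.trans h
      exact (ae_eq_of_ae_subset_of_measure_ge hsub (hmp.measure_preimage hm.nullMeasurableSet).le
        hm.nullMeasurableSet (measure_ne_top _ _)).symm
    rcases hℙ.measure_zero_or_one hm h1 with h | h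
    · right
      filter_upwards [measure_eq_zero_iff_ae_notMem.1 h] with ω hω
      exact not_le.1 hω
    · left
      have h2 := (prob_compl_eq_zero_iff hm).2 h
      filter_upwards [measure_eq_zero_iff_ae_notMem.1 h2] with ω hω
      by_contra hcon
      exact hω hcon
  set c : EReal := sInf {a : EReal | ∃ q : ℚ, a = ((q : ℝ) : EReal) ∧ ∀ᵐ ω ∂ℙ, f ω ≤ a} with hc
  refine ⟨c, ?_⟩
  have hup : ∀ᵐ ω ∂ℙ, ∀ q : ℚ, (∀ᵐ ω ∂ℙ, f ω ≤ ((q : ℝ) : EReal)) → f ω ≤ ((q : ℝ) : EReal) := by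
    rw [ae_all_iff]
    intro q
    by_cases h : ∀ᵐ ω ∂ℙ, f ω ≤ ((q : ℝ) : EReal)
    · filter_upwards [h] with ω hω _ using hω
    · exact Eventually.of_forall fun ω h' => absurd h' h
  have hlow : ∀ᵐ ω ∂ℙ, ∀ q : ℚ, ((q : ℝ) : EReal) < c → ((q : ℝ) : EReal) < f ω := by
    rw [ae_all_iff]
    intro q
    by_cases h : ((q : ℝ) : EReal) < c
    · rcases hdich ((q : ℝ) : EReal) with h1 | h1
      · have h2 : c ≤ ((q : ℝ) : EReal) := sInf_le ⟨q, rfl, h1⟩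
        exact absurd h2 (not_le.2 h)
      · filter_upwards [h1] with ω hω _ using hω
    · exact Eventually.of_forall fun ω h' => absurd h' h
  filter_upwards [hup, hlow] with ω h1 h2
  refine le_antisymm (le_sInf ?_) ?_
  · rintro _ ⟨q, rfl, hq⟩
    exact h1 q hq
  · by_contra! hlt
    obtain ⟨q, hq1, hq2⟩ := EReal.lt_iff_exists_rat_btwn.1 hlt
    exact absurd (h2 q hq2) (not_lt.2 hq1.le)

end Typical

end RWRP

end

noncomputable section

namespace RWRP

/-! ### The rate as a function on the polytope -/

section Profile

variable {d : ℕ} {R : Finset (Fin d → ℤ)} {q : (R → ℕ) → ℝ}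
  {F : EuclideanSpace ℝ (Fin d) → EReal}

lemma combo_mem_stdSimplex {ι : Type*} [Fintype ι] {β γ : ι → ℝ} (hβ : β ∈ stdSimplex ℝ ι)
    (hγ : γ ∈ stdSimplex ℝ ι) {t : ℝ} (ht : 0 ≤ t) (ht1 : t ≤ 1) :
    (1 - t) • β + t • γ ∈ stdSimplex ℝ ι :=
  convex_stdSimplex ℝ ι hβ hγ (by linarith) ht (by ring)

lemma exists_neg_le (hq : IsRegular (fun z : R => (z : Fin d → ℤ)) q)
    (hF : ∀ β ∈ stdSimplex ℝ R, F (bary R β) = rate q β) :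
    ∃ K : ℝ, 0 ≤ K ∧ ∀ ζ ∈ hull R, ((-K : ℝ) : EReal) ≤ F ζ := by
  obtain ⟨K, hK, h⟩ := hq.rate_ge
  refine ⟨K, hK, fun ζ hζ => ?_⟩
  rw [hull_eq_image] at hζ
  obtain ⟨β, hβ, rfl⟩ := hζ
  rw [hF β hβ]
  exact h β hβ

/-- Weights bounded below dominate a multiple of every other weights, so an infinite rate anywhere
makes the rate infinite throughout the relative interior. -/
lemma eq_top_of_iSup_eq_top [Nonempty R] (hq : IsRegular (fun z : R => (z : Fin d → ℤ)) q)
    (hF : ∀ β ∈ stdSimplex ℝ R, F (bary R β) = rate q β)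
    (htop : ⨆ β ∈ stdSimplex ℝ R, rate q β = ⊤) {ζ : EuclideanSpace ℝ (Fin d)}
    (hζ : ζ ∈ riHull R) : F ζ = ⊤ := by
  obtain ⟨β₀, hβ₀, hpos, rfl⟩ := mem_riHull_iff.1 hζ
  obtain ⟨K, -, hK⟩ := hq.rate_lower_global
  obtain ⟨z₀, hz₀⟩ := Finite.exists_min β₀
  have hη1 : β₀ z₀ ≤ 1 := by
    rw [← hβ₀.2]
    exact Finset.single_le_sum (fun z _ => hβ₀.1 z) (Finset.mem_univ z₀)
  rw [hF β₀ hβ₀, EReal.eq_top_iff_forall_lt]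
  intro y
  have h1 : (((y + 1 + K) / β₀ z₀ : ℝ) : EReal) < ⨆ β ∈ stdSimplex ℝ R, rate q β := by
    rw [htop]
    exact EReal.coe_lt_top _
  simp only [lt_iSup_iff] at h1
  obtain ⟨β, hβ, h2⟩ := h1
  have h3 := hK (β₀ z₀) (hpos z₀) hη1 β hβ β₀ hβ₀ (fun z => by
    have h4 : β z ≤ 1 := by
      rw [← hβ.2]
      exact Finset.single_le_sum (fun z _ => hβ.1 z) (Finset.mem_univ z)
    nlinarith [hz₀ z, hpos z₀]) _ h2.le
  refine lt_of_lt_of_le (EReal.coe_lt_coe_iff.2 ?_) h3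
  rw [mul_div_cancel₀ _ (hpos z₀).ne']
  linarith

lemma eqOn_coe_toReal {C : ℝ} (hC : ∀ ζ ∈ hull R, ((-C : ℝ) : EReal) ≤ F ζ ∧ F ζ ≤ C) :
    Set.EqOn (fun ζ => (((F ζ).toReal : ℝ) : EReal)) F (hull R) := fun ζ hζ =>
  EReal.coe_toReal ((hC ζ hζ).2.trans_lt (EReal.coe_lt_top _)).ne
    ((EReal.bot_lt_coe _).trans_le (hC ζ hζ).1).ne'

lemma segmentLower_toReal (hq : IsRegular (fun z : R => (z : Fin d → ℤ)) q)
    (hF : ∀ β ∈ stdSimplex ℝ R, F (bary R β) = rate q β) {C : ℝ} (hC0 : 0 ≤ C)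
    (hC : ∀ ζ ∈ hull R, ((-C : ℝ) : EReal) ≤ F ζ ∧ F ζ ≤ C) :
    SegmentLower R fun ζ => (F ζ).toReal := by
  have hcoe : ∀ ζ ∈ hull R, (((F ζ).toReal : ℝ) : EReal) = F ζ := fun ζ hζ =>
    eqOn_coe_toReal hC hζ
  intro δ hδ
  obtain ⟨ε₀, hε₀, h⟩ := hq.rate_lower (half_pos hδ)
  set ε := min (ε₀ / 2) (min (1 / 2) (δ / (2 * (C + 1)))) with hε
  have hεpos : 0 < ε := by positivity
  have hε1 : ε ≤ ε₀ / 2 := min_le_left _ _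
  have hε2 : ε ≤ 1 / 2 := (min_le_right _ _).trans (min_le_left _ _)
  have hε3 : ε ≤ δ / (2 * (C + 1)) := (min_le_right _ _).trans (min_le_right _ _)
  refine ⟨ε, hεpos, by linarith, fun ζ hζ γ hγ => ?_⟩
  have hmem : (1 - ε) • ζ + ε • γ ∈ hull R :=
    convex_hull hζ hγ (by linarith) hεpos.le (by ring)
  have hζ' := hζ
  have hγ' := hγ
  rw [hull_eq_image] at hζ' hγ'
  obtain ⟨β, hβ, rfl⟩ := hζ'
  obtain ⟨β', hβ', rfl⟩ := hγ'
  have hcomb := combo_mem_stdSimplex hβ hβ' hεpos.le (by linarith)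
  have h1 := h (1 - ε) (by linarith) (by linarith) (by linarith) β hβ _ hcomb (fun i => by
    have := mul_nonneg hεpos.le (hβ'.1 i)
    simp only [Pi.add_apply, Pi.smul_apply, smul_eq_mul]
    linarith) (F (bary R β)).toReal (by rw [hcoe _ hζ, hF β hβ])
  rw [← hF _ hcomb, bary_combo, ← hcoe _ hmem, EReal.coe_le_coe_iff] at h1
  have h2 : (F (bary R β)).toReal ≤ C := by
    rw [← EReal.coe_le_coe_iff, hcoe _ hζ]
    exact (hC _ hζ).2
  rw [le_div_iff₀ (by positivity)] at hε3
  have h3 : ε * (F (bary R β)).toReal ≤ δ / 2 :=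
    (mul_le_mul_of_nonneg_left h2 hεpos.le).trans (by linarith)
  simp only
  linarith

lemma lowerSemicontinuousOn_of_toReal {C : ℝ}
    (hC : ∀ ζ ∈ hull R, ((-C : ℝ) : EReal) ≤ F ζ ∧ F ζ ≤ C)
    (hs : SegmentLower R fun ζ => (F ζ).toReal) : LowerSemicontinuousOn F (hull R) := by
  have h1 := continuous_coe_real_ereal.comp_lowerSemicontinuousOn hs.lowerSemicontinuousOn
    EReal.coe_strictMono.monotone
  intro ζ hζ a ha
  rw [← eqOn_coe_toReal hC hζ] at ha
  filter_upwards [h1 ζ hζ a ha, self_mem_nhdsWithin] with ζ' h2 h3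
  rwa [← eqOn_coe_toReal hC h3]

lemma continuousOn_of_toReal {C : ℝ}
    (hC : ∀ ζ ∈ hull R, ((-C : ℝ) : EReal) ≤ F ζ ∧ F ζ ≤ C)
    (hs : SegmentLower R fun ζ => (F ζ).toReal) : ContinuousOn F (riHull R) :=
  (continuous_coe_real_ereal.comp_continuousOn hs.continuousOn_riHull).congr
    fun _ hζ => (eqOn_coe_toReal hC (riHull_subset_hull hζ)).symm

/-- A lower semicontinuous function lies below the continuous extension of its restriction to the
relative interior. -/
lemma le_of_isContExtension [Nonempty R] {h : EuclideanSpace ℝ (Fin d) → ℝ}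
    (hF : LowerSemicontinuousOn F (hull R)) (hh : IsContExtension R F h)
    {ζ : EuclideanSpace ℝ (Fin d)} (hζ : ζ ∈ hull R) : F ζ ≤ h ζ := by
  by_contra! hlt
  obtain ⟨a, ha1, ha2⟩ := EReal.lt_iff_exists_real_btwn.1 hlt
  have hne : (𝓝[riHull R] ζ).NeBot := mem_closure_iff_nhdsWithin_neBot.1
    (hull_subset_closure_riHull hζ)
  have h1 : ∀ᶠ ζ' in 𝓝[riHull R] ζ, (a : EReal) < F ζ' :=
    nhdsWithin_mono _ riHull_subset_hull (hF ζ hζ a ha2)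
  have h2 : ∀ᶠ ζ' in 𝓝[riHull R] ζ, h ζ' < a :=
    nhdsWithin_mono _ riHull_subset_hull
      ((hh.1 ζ hζ).eventually (gt_mem_nhds (EReal.coe_lt_coe_iff.1 ha1)))
  obtain ⟨ζ', h3, h4, h5⟩ := (h1.and (h2.and self_mem_nhdsWithin)).exists
  rw [hh.2 ζ' h5, EReal.coe_lt_coe_iff] at h3
  exact lt_asymm h3 h4

end Profile

/-! ### Nonrandom rates -/

section Nonrandom

lemma le_of_eventually_sub_le {P Q : ℕ → ℝ} {τ : ℕ → ℕ} {l l' : EReal}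
    (hP : Tendsto (fun n : ℕ => ((P n / n : ℝ) : EReal)) atTop (𝓝 l))
    (hQ : Tendsto (fun n : ℕ => ((Q n / n : ℝ) : EReal)) atTop (𝓝 l'))
    (hτ : Tendsto (fun n : ℕ => (τ n : ℝ) / n) atTop (𝓝 1))
    (h : ∀ δ : ℝ, 0 < δ → ∀ᶠ n : ℕ in atTop, P n - δ * n ≤ Q (τ n)) : l ≤ l' := by
  refine EReal.ge_of_forall_gt_iff_ge.1 fun y hy => ?_
  obtain ⟨a, ha1, ha2⟩ := EReal.lt_iff_exists_real_btwn.1 hy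
  have hya : y < a := EReal.coe_lt_coe_iff.1 ha1
  have h1 := rate_le_of_eventually one_pos one_pos hP hQ tendsto_id_div hτ
    (h (a - y) (by linarith)) ha2
  have h2 : (1 * a - (a - y)) / 1 = y := by ring
  rwa [h2] at h1

lemma eventually_le_mul (C : ℝ) {δ : ℝ} (hδ : 0 < δ) : ∀ᶠ n : ℕ in atTop, C ≤ δ * n := by
  have h : ∀ᶠ n : ℕ in atTop, C / δ ≤ (n : ℝ) :=
    tendsto_natCast_atTop_atTop.eventually_ge_atTop _
  filter_upwards [h] with n hn
  rwa [div_le_iff₀' hδ] at hn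

lemma tendsto_log_succ_div (C : ℝ) :
    Tendsto (fun n : ℕ => C * Real.log (n + 1) / n) atTop (𝓝 0) := by
  have h1 : Tendsto (fun n : ℕ => Real.log ((n + 1 : ℕ) : ℝ) / ((n + 1 : ℕ) : ℝ)) atTop (𝓝 0) := by
    have h2 : Tendsto (fun x : ℝ => Real.log x / x) atTop (𝓝 0) := by
      simpa using Real.tendsto_pow_log_div_mul_add_atTop 1 0 1 one_ne_zero
    exact (h2.comp tendsto_natCast_atTop_atTop).comp (tendsto_add_atTop_nat 1)
  have h3 : Tendsto (fun n : ℕ => ((n + 1 : ℕ) : ℝ) / (n : ℝ)) atTop (𝓝 1) := by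
    have h4 : Tendsto (fun n : ℕ => 1 + 1 / (n : ℝ)) atTop (𝓝 (1 + 0)) :=
      tendsto_const_nhds.add tendsto_one_div_atTop_nhds_zero_nat
    rw [add_zero] at h4
    refine h4.congr' ?_
    filter_upwards [eventually_gt_atTop 0] with n hn
    have : (n : ℝ) ≠ 0 := by exact_mod_cast hn.ne'
    push_cast
    field_simp
  have h5 := (h1.mul h3).const_mul C
  rw [zero_mul, mul_zero] at h5
  refine h5.congr fun n => ?_
  have : ((n + 1 : ℕ) : ℝ) ≠ 0 := by positivity
  push_cast at this ⊢
  rcases eq_or_ne (n : ℝ) 0 with h0 | h0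
  · simp [h0]
  · field_simp

/-- If almost every point eventually lies in `G n`, then its images under any measure preserving
maps lie in `G n` infinitely often. -/
lemma ae_frequently_preimage {Ω : Type*} [MeasurableSpace Ω] {ℙ : Measure Ω}
    [IsProbabilityMeasure ℙ] {T : ℕ → Ω → Ω} (hT : ∀ n, MeasurePreserving (T n) ℙ ℙ)
    {G : ℕ → Set Ω} (hGm : ∀ n, MeasurableSet (G n)) (hG : ∀ᵐ ω ∂ℙ, ∀ᶠ n in atTop, ω ∈ G n) :
    ∀ᵐ ω ∂ℙ, ∃ᶠ n in atTop, T n ω ∈ G n := by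
  have h1 : Tendsto (fun n => ℙ (G n)ᶜ) atTop (𝓝 (ℙ ∅)) := by
    refine tendsto_measure_of_ae_tendsto_indicator_of_isFiniteMeasure atTop MeasurableSet.empty
      (fun n => (hGm n).compl) ?_
    filter_upwards [hG] with ω hω
    filter_upwards [hω] with n hn
    simp [hn]
  rw [measure_empty] at h1
  have h2 : ∀ N : ℕ, ∀ᵐ ω ∂ℙ, ∃ n ≥ N, T n ω ∈ G n := by
    intro N
    have h3 : ℙ {ω | ¬ ∃ n ≥ N, T n ω ∈ G n} ≤ 0 := by
      refine ge_of_tendsto h1 ?_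
      filter_upwards [eventually_ge_atTop N] with n hn
      rw [← (hT n).measure_preimage (hGm n).compl.nullMeasurableSet]
      refine measure_mono fun ω hω hn' => hω ⟨n, hn, hn'⟩
    exact nonpos_iff_eq_zero.1 h3
  filter_upwards [ae_all_iff.2 h2] with ω hω
  exact frequently_atTop.2 hω

variable {d ℓ : ℕ} {R : Finset (Fin d → ℤ)} [Nonempty R] {Ω : Type*} [AddAction (stepGroup R) Ω]

/-- One more initial step does not lower the rate for weights which charge that step. -/
lemma rate_shift_le (g : Ω → (Fin ℓ → R) → ℝ) {ω : Ω} {z : R}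
    (hω : IsRegular (fun z : R => (z : Fin d → ℤ)) (logPart g ω))
    (hω' : IsRegular (fun z : R => (z : Fin d → ℤ)) (logPart g (step z +ᵥ ω)))
    {β : R → ℝ} (hβ : β ∈ stdSimplex ℝ R) (hpos : ∀ z, 0 < β z) :
    rate (logPart g (step z +ᵥ ω)) β ≤ rate (logPart g ω) β := by
  classical
  -- one extra step is within the tolerance of `IsApprox`, since all weights are positive
  have happ : IsApprox β fun n => Pi.single z 1 + floorCount β n := by
    intro n i
    refine ⟨?_, fun h => absurd h (hpos i).ne'⟩
    have h1 := Nat.floor_le (mul_nonneg (Nat.cast_nonneg (α := ℝ) n) (hβ.1 i))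
    have h2 := Nat.lt_floor_add_one ((n : ℝ) * β i)
    have h3 : ((Pi.single z 1 : R → ℕ) i : ℝ) = 0 ∨ ((Pi.single z 1 : R → ℕ) i : ℝ) = 1 := by
      rcases eq_or_ne i z with rfl | h
      · simp
      · simp [h]
    rw [abs_le]
    simp only [Pi.add_apply]
    push_cast
    rcases h3 with h3 | h3 <;> rw [h3] <;> constructor <;> simp only [floorCount] <;> linarith
  refine le_of_eventually_sub_le (hω'.tendsto_rate hβ (isApprox_floorCount hβ.1))
    (hω.tendsto_rate hβ happ) tendsto_id_div fun δ hδ => ?_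
  filter_upwards [eventually_le_mul
    (tailError g (step z +ᵥ ω) - logPart g ω (Pi.single z 1)) hδ] with n hn
  have h1 := logPart_add_ge g ω (Pi.single z 1) (floorCount β n)
  rw [endpoint_single, one_smul] at h1
  linarith

lemma tendsto_logTotal (g : Ω → (Fin ℓ → R) → ℝ) {ω : Ω}
    (hω : IsRegular (fun z : R => (z : Fin d → ℤ)) (logPart g ω)) :
    Tendsto (fun n : ℕ => ((logTotal g ω n / n : ℝ) : EReal)) atTop
      (𝓝 (⨆ β ∈ stdSimplex ℝ R, rate (logPart g ω) β)) :=
  tendsto_of_max_count hω (fun c => logPart_le_logTotal g ω c)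
    (fun n => exists_logTotal_le g ω n) (tendsto_log_succ_div _)

lemma iSup_rate_shift_le (g : Ω → (Fin ℓ → R) → ℝ) {ω : Ω} {z : R}
    (hω : IsRegular (fun z : R => (z : Fin d → ℤ)) (logPart g ω))
    (hω' : IsRegular (fun z : R => (z : Fin d → ℤ)) (logPart g (step z +ᵥ ω))) :
    ⨆ β ∈ stdSimplex ℝ R, rate (logPart g (step z +ᵥ ω)) β ≤
      ⨆ β ∈ stdSimplex ℝ R, rate (logPart g ω) β := by
  classical
  have hτ : Tendsto (fun n : ℕ => ((1 + n : ℕ) : ℝ) / n) atTop (𝓝 1) := by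
    have h4 : Tendsto (fun n : ℕ => 1 / (n : ℝ) + 1) atTop (𝓝 (0 + 1)) :=
      tendsto_one_div_atTop_nhds_zero_nat.add tendsto_const_nhds
    rw [zero_add] at h4
    refine h4.congr' ?_
    filter_upwards [eventually_gt_atTop 0] with n hn
    have : (n : ℝ) ≠ 0 := by exact_mod_cast hn.ne'
    push_cast
    field_simp
  refine le_of_eventually_sub_le (tendsto_logTotal g hω') (tendsto_logTotal g hω) hτ
    fun δ hδ => ?_
  have h0 : ∀ᶠ n : ℕ in atTop, Fintype.card R * Real.log (n + 1) / n < δ / 2 :=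
    (tendsto_log_succ_div _).eventually (gt_mem_nhds (half_pos hδ))
  filter_upwards [eventually_le_mul
    (tailError g (step z +ᵥ ω) - logPart g ω (Pi.single z 1)) (half_pos hδ), h0,
    eventually_gt_atTop 0] with n hn h0 hn0
  have hn0' : (0 : ℝ) < n := by exact_mod_cast hn0
  rw [div_lt_iff₀ hn0'] at h0
  obtain ⟨c, hc, h2⟩ := exists_logTotal_le g (step z +ᵥ ω) n
  have h1 := logPart_add_ge g ω (Pi.single z 1) c
  rw [endpoint_single, one_smul] at h1
  have h3 := logPart_le_logTotal g ω (Pi.single z 1 + c)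
  simp only [Pi.add_apply, Finset.sum_add_distrib, sum_single, hc] at h3
  linarith

variable [MeasurableSpace Ω] [MeasurableConstVAdd (stepGroup R) Ω] {ℙ : Measure Ω}
  [VAddInvariantMeasure (stepGroup R) Ω ℙ] {g : Ω → (Fin ℓ → R) → ℝ}

omit [VAddInvariantMeasure (stepGroup R) Ω ℙ] in
lemma measurable_rate (hg : ∀ w, Measurable fun ω => g ω w) (β : R → ℝ) :
    Measurable fun ω => rate (logPart g ω) β :=
  Measurable.limsup fun _ => ((measurable_logPart hg _).div_const _).coe_real_ereal

lemma MemClassL.ae_isRegular_shift [IsFiniteMeasure ℙ] (hg : MemClassL R ℙ g)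
    (x : stepGroup R) :
    ∀ᵐ ω ∂ℙ, IsRegular (fun z : R => (z : Fin d → ℤ)) (logPart g (x +ᵥ ω)) :=
  (measurePreserving_vadd x ℙ).quasiMeasurePreserving.ae hg.ae_isRegular

/-- The rate is nonrandom in the directions of the relative interior. -/
lemma MemClassL.exists_rate_eq [IsProbabilityMeasure ℙ] (hg : MemClassL R ℙ g)
    (hℙ : IsErgodic R ℙ) {β : R → ℝ} (hβ : β ∈ stdSimplex ℝ R) (hpos : ∀ z, 0 < β z) :
    ∃ l : EReal, ∀ᵐ ω ∂ℙ, rate (logPart g ω) β = l :=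
  hℙ.ae_const_of_le (measurable_rate hg.measurable β) fun z => by
    filter_upwards [hg.ae_isRegular, hg.ae_isRegular_shift (step z)] with ω h1 h2
    exact rate_shift_le g h1 h2 hβ hpos

lemma MemClassL.exists_iSup_rate_eq [IsProbabilityMeasure ℙ] (hg : MemClassL R ℙ g)
    (hℙ : IsErgodic R ℙ) :
    ∃ l : EReal, ∀ᵐ ω ∂ℙ, ⨆ β ∈ stdSimplex ℝ R, rate (logPart g ω) β = l := by
  have hm : Measurable fun ω => limsup (fun n : ℕ => ((logTotal g ω n / n : ℝ) : EReal)) atTop :=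
    Measurable.limsup fun n => ((measurable_logTotal hg.measurable n).div_const _).coe_real_ereal
  obtain ⟨l, hl⟩ := hℙ.ae_const_of_le hm fun z => by
    filter_upwards [hg.ae_isRegular, hg.ae_isRegular_shift (step z)] with ω h1 h2
    rw [(tendsto_logTotal g h1).limsup_eq, (tendsto_logTotal g h2).limsup_eq]
    exact iSup_rate_shift_le g h1 h2
  refine ⟨l, ?_⟩
  filter_upwards [hl, hg.ae_isRegular] with ω h1 h2
  rw [← h1, (tendsto_logTotal g h2).limsup_eq]

omit [Nonempty R] in
/-- A path following `β` and then one following `γ` extend, by boundedly many steps, to a path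
following the combined weights. -/
lemma floorCount_add_le {a b : ℝ} (ha : 0 ≤ a) (hb : 0 ≤ b) {β γ : R → ℝ} (hβ : ∀ z, 0 ≤ β z)
    (hγ : ∀ z, 0 ≤ γ z) (n : ℕ) :
    ∃ e : R → ℕ, floorCount β ⌊a * n⌋₊ + floorCount γ ⌊b * n⌋₊ + e =
      floorCount (a • β + b • γ) n ∧ ∀ z, (e z : ℝ) ≤ β z + γ z + 2 := by
  have hn : (0 : ℝ) ≤ n := Nat.cast_nonneg n
  have h1 := Nat.floor_le (mul_nonneg ha hn)
  have h2 := Nat.floor_le (mul_nonneg hb hn)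
  have hle : floorCount β ⌊a * n⌋₊ + floorCount γ ⌊b * n⌋₊ ≤ floorCount (a • β + b • γ) n := by
    intro z
    refine Nat.le_floor ?_
    have h3 := Nat.floor_le (mul_nonneg (Nat.cast_nonneg (α := ℝ) ⌊a * n⌋₊) (hβ z))
    have h4 := Nat.floor_le (mul_nonneg (Nat.cast_nonneg (α := ℝ) ⌊b * n⌋₊) (hγ z))
    have h5 := mul_le_mul_of_nonneg_right h1 (hβ z)
    have h6 := mul_le_mul_of_nonneg_right h2 (hγ z)
    simp only [floorCount, Pi.add_apply, Pi.smul_apply, smul_eq_mul]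
    push_cast
    linarith
  refine ⟨_, add_tsub_cancel_of_le hle, fun z => ?_⟩
  rw [Pi.sub_apply, Nat.cast_sub (hle z)]
  have h3 := Nat.lt_floor_add_one ((⌊a * n⌋₊ : ℝ) * β z)
  have h4 := Nat.lt_floor_add_one ((⌊b * n⌋₊ : ℝ) * γ z)
  have h5 := mul_le_mul_of_nonneg_right (Nat.lt_floor_add_one (a * n)).le (hβ z)
  have h6 := mul_le_mul_of_nonneg_right (Nat.lt_floor_add_one (b * n)).le (hγ z)
  have h7 : (⌊(n : ℝ) * (a * β z + b * γ z)⌋₊ : ℝ) ≤ n * (a * β z + b * γ z) :=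
    Nat.floor_le (mul_nonneg hn (add_nonneg (mul_nonneg ha (hβ z)) (mul_nonneg hb (hγ z))))
  simp only [floorCount, Pi.add_apply, Pi.smul_apply, smul_eq_mul]
  push_cast
  linarith

omit [Nonempty R] in
lemma sum_floorCount_le {β : R → ℝ} (hβ : β ∈ stdSimplex ℝ R) (n : ℕ) :
    ∑ z, floorCount β n z ≤ n := by
  have h : ((∑ z, floorCount β n z : ℕ) : ℝ) ≤ n := by
    push_cast
    calc ∑ z, (floorCount β n z : ℝ) ≤ ∑ z, (n : ℝ) * β z :=
          Finset.sum_le_sum fun z _ => Nat.floor_le (mul_nonneg (Nat.cast_nonneg n) (hβ.1 z))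
      _ = n := by rw [← Finset.mul_sum, hβ.2, mul_one]
  exact_mod_cast h

/-- Concavity of nonrandom rates. The second piece of a path starts from a point which moves with
`n`; the environment seen from there has the same law, so that the second piece has its typical
weight for infinitely many `n`. -/
theorem MemClassL.ae_rate_concave [IsProbabilityMeasure ℙ] (hg : MemClassL R ℙ g)
    {β γ : R → ℝ} (hβ : β ∈ stdSimplex ℝ R) (hγ : γ ∈ stdSimplex ℝ R) {a b : ℝ} (ha : 0 < a)
    (hb : 0 < b) (hab : a + b = 1) {l l' : ℝ} (hl : ∀ᵐ ω ∂ℙ, rate (logPart g ω) β = l)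
    (hl' : ∀ᵐ ω ∂ℙ, rate (logPart g ω) γ = l') :
    ∀ᵐ ω ∂ℙ, ((a * l + b * l' : ℝ) : EReal) ≤ rate (logPart g ω) (a • β + b • γ) := by
  set α := a • β + b • γ with hα
  have hαmem : α ∈ stdSimplex ℝ R := convex_stdSimplex ℝ R hβ hγ ha.le hb.le hab
  have hlow : ∀ {κ : R → ℝ} {t y : ℝ}, κ ∈ stdSimplex ℝ R → 0 < t →
      (∀ᵐ ω ∂ℙ, rate (logPart g ω) κ = y) → ∀ δ : ℝ, 0 < δ →
      ∀ᵐ ω ∂ℙ, ∀ᶠ n : ℕ in atTop, (t * y - δ) * n ≤ logPart g ω (floorCount κ ⌊t * n⌋₊) := by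
    intro κ t y hκ ht hy δ hδ
    filter_upwards [hy, hg.ae_isRegular] with ω h1 h2
    have h3 := h2.tendsto_rate hκ (isApprox_floorCount hκ.1)
    rw [h1] at h3
    by_contra hcon
    have h4 := limit_le_of_frequently_le ht h3 (tendsto_floor_mul_div ht.le)
      (tendsto_const_mul_div (t * y - δ)) ((not_eventually.1 hcon).mono fun n hn => (not_le.1 hn).le)
    rw [EReal.coe_le_coe_iff, le_div_iff₀ ht] at h4
    linarith
  -- each of the two pieces, their junction and the rounding of the counts costs at most `δ n`
  have hmain : ∀ k : ℕ, ∀ᵐ ω ∂ℙ,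
      ((a * l + b * l' - 4 * (1 / ((k : ℝ) + 1)) : ℝ) : EReal) ≤ rate (logPart g ω) α := by
    intro k
    set δ : ℝ := 1 / ((k : ℝ) + 1) with hδdef
    have hδ : 0 < δ := by positivity
    have hfreq := ae_frequently_preimage (ℙ := ℙ)
      (T := fun n ω => endpoint (floorCount β ⌊a * (n : ℝ)⌋₊) +ᵥ ω)
      (fun n => measurePreserving_vadd _ ℙ)
      (G := fun n => {ω | (b * l' - δ) * n ≤ logPart g ω (floorCount γ ⌊b * (n : ℝ)⌋₊)})
      (fun n => measurableSet_le measurable_const (measurable_logPart hg.measurable _))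
      (hlow hγ hb hl' δ hδ)
    obtain ⟨A, -, hA⟩ := exists_step_bound R
    filter_upwards [hfreq, hlow hβ ha hl δ hδ, hg.ae_isRegular, hg.ae_segmentSmall]
      with ω h1 h2 h3 h4
    obtain ⟨ε, hε, n₀, hext⟩ := h3.ext δ hδ
    have h5 := eventually_tailError_le h4 A hδ
    have h6 := h3.tendsto_rate hαmem (isApprox_floorCount hαmem.1)
    have h7 := le_limit_of_frequently_le (v := fun n => (a * l + b * l' - 4 * δ) * n) (τ := id)
      one_pos h6 tendsto_id_div (tendsto_const_mul_div _) ?_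
    · rwa [div_one] at h7
    have hev := h2.and (h5.and ((eventually_ge_atTop n₀).and
      (eventually_le_mul (∑ z, (β z + γ z + 2)) hε)))
    refine (h1.and_eventually hev).mono ?_
    rintro n ⟨h8, h9, h10, h11, h12⟩
    obtain ⟨e, he, hle⟩ := floorCount_add_le ha.le hb.le hβ.1 hγ.1 n
    have hsum1 : ∑ z, floorCount β ⌊a * (n : ℝ)⌋₊ z ≤ n := by
      refine (sum_floorCount_le hβ _).trans (Nat.floor_le_of_le ?_)
      nlinarith [Nat.cast_nonneg (α := ℝ) n]
    have hsum2 : ∑ z, floorCount γ ⌊b * (n : ℝ)⌋₊ z ≤ n := by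
      refine (sum_floorCount_le hγ _).trans (Nat.floor_le_of_le ?_)
      nlinarith [Nat.cast_nonneg (α := ℝ) n]
    have h13 := h10 (endpoint (floorCount β ⌊a * (n : ℝ)⌋₊))
      ((hA _).trans (mul_le_mul_of_nonneg_left (by exact_mod_cast hsum1) (Nat.cast_nonneg A)))
    have h14 := hext n h11 (floorCount β ⌊a * (n : ℝ)⌋₊ + floorCount γ ⌊b * (n : ℝ)⌋₊) e
      (by simp only [Pi.add_apply, Finset.sum_add_distrib]; omega)
      (le_trans (by push_cast; exact Finset.sum_le_sum fun z _ => hle z) h12)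
    rw [he] at h14
    have h15 := logPart_add_ge g ω (floorCount β ⌊a * (n : ℝ)⌋₊) (floorCount γ ⌊b * (n : ℝ)⌋₊)
    have h16 : (b * l' - δ) * n ≤ logPart g (endpoint (floorCount β ⌊a * (n : ℝ)⌋₊) +ᵥ ω)
      (floorCount γ ⌊b * (n : ℝ)⌋₊) := h8
    simp only [id]
    linarith
  filter_upwards [ae_all_iff.2 hmain] with ω hω
  have h1 : Tendsto (fun k : ℕ => a * l + b * l' - 4 * (1 / ((k : ℝ) + 1))) atTop
      (𝓝 (a * l + b * l' - 4 * 0)) :=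
    tendsto_const_nhds.sub (tendsto_one_div_add_atTop_nhds_zero_nat.const_mul 4)
  rw [mul_zero, sub_zero] at h1
  exact le_of_tendsto ((continuous_coe_real_ereal.tendsto _).comp h1)
    (Eventually.of_forall hω)

end Nonrandom

end RWRP

end

noncomputable section

namespace RWRP

/-! ### The point-to-point free energy -/

section FreeEnergy

variable {d ℓ : ℕ} {R : Finset (Fin d → ℤ)} [Nonempty R] {Ω : Type*} [AddAction (stepGroup R) Ω]
  {xhat : EuclideanSpace ℝ (Fin d) → ℕ → Fin d → ℤ} {g : Ω → (Fin ℓ → R) → ℝ} {ω : Ω}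

/-- The limit does not depend on the weights which the approximating lattice points come from. -/
lemma tendsto_logPartitionAt (hω : IsRegular (fun z : R => (z : Fin d → ℤ)) (logPart g ω))
    {β : R → ℝ} (hβ : β ∈ stdSimplex ℝ R) {x : ℕ → Fin d → ℤ}
    (hx : IsLatticeApprox R (bary R β) x) :
    Tendsto (fun n => logPartitionAt R g ω n (x n)) atTop (𝓝 (rate (logPart g ω) β)) := by
  obtain ⟨γ, b, hγ0, hγ1, hγ, -, hb01, hb0, hsum, hxn⟩ := hx
  have hγmem : γ ∈ stdSimplex ℝ R := ⟨hγ0, hγ1⟩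
  have hrate : rate (logPart g ω) γ = rate (logPart g ω) β := by
    refine rate_eq_of_rep_eq hω hγmem hβ fun j => ?_
    rw [← bary_apply, ← bary_apply, ← hγ, bary]
  have happ : IsApprox γ fun n z => ⌊(n : ℝ) * γ z⌋₊ + b n z := by
    intro n z
    refine ⟨?_, fun h => by simp [h, hb0 n z h]⟩
    have h1 := Nat.floor_le (mul_nonneg (Nat.cast_nonneg (α := ℝ) n) (hγ0 z))
    have h2 := Nat.lt_floor_add_one ((n : ℝ) * γ z)
    rw [abs_le]
    push_cast
    rcases hb01 n z with h3 | h3 <;> rw [h3] <;> push_cast <;> constructor <;> linarith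
  rw [← hrate]
  refine (hω.tendsto_rate hγmem happ).congr fun n => ?_
  rw [hxn n, logPartitionAt_eq g ω (hsum n)]

variable (hxhat : ∀ ζ ∈ hull R, IsLatticeApprox R ζ (xhat ζ))
include hxhat

lemma pointFreeEnergy_bary (hω : IsRegular (fun z : R => (z : Fin d → ℤ)) (logPart g ω))
    {β : R → ℝ} (hβ : β ∈ stdSimplex ℝ R) :
    pointFreeEnergy R xhat g ω (bary R β) = rate (logPart g ω) β := by
  rw [pointFreeEnergy, if_pos (bary_mem_hull hβ)]
  exact (tendsto_logPartitionAt hω hβ (hxhat _ (bary_mem_hull hβ))).limUnder_eq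

variable [MeasurableSpace Ω] [MeasurableConstVAdd (stepGroup R) Ω] {ℙ : Measure Ω}
  [IsProbabilityMeasure ℙ] [VAddInvariantMeasure (stepGroup R) Ω ℙ]

/-- If it is bounded, the point-to-point free energy agrees on the relative interior with a nonrandom
concave function. -/
theorem MemClassL.exists_concave_profile (hg : MemClassL R ℙ g) (hℙ : IsErgodic R ℙ)
    (hC : ∀ᵐ ω ∂ℙ, ∃ C : ℝ, 0 ≤ C ∧ ∀ ζ ∈ hull R,
      ((-C : ℝ) : EReal) ≤ pointFreeEnergy R xhat g ω ζ ∧ pointFreeEnergy R xhat g ω ζ ≤ C) :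
    ∃ f : EuclideanSpace ℝ (Fin d) → ℝ, ConcaveOn ℝ (riHull R) f ∧
      ∀ᵐ ω ∂ℙ, ∀ ζ ∈ riHull R, pointFreeEnergy R xhat g ω ζ = f ζ := by
  have hne : Nonempty (riHull R) := riHull_nonempty.to_subtype
  have hcont : ∀ᵐ ω ∂ℙ, ContinuousOn (pointFreeEnergy R xhat g ω) (riHull R) := by
    filter_upwards [hg.ae_isRegular, hC] with ω h1 ⟨C, h2, h3⟩
    exact continuousOn_of_toReal h3
      (segmentLower_toReal h1 (fun β hβ => pointFreeEnergy_bary hxhat h1 hβ) h2 h3)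
  have hconst : ∀ ζ : riHull R, ∃ l : EReal, ∀ᵐ ω ∂ℙ, pointFreeEnergy R xhat g ω ζ = l := by
    rintro ⟨ζ, hζ⟩
    obtain ⟨β, hβ, hpos, rfl⟩ := mem_riHull_iff.1 hζ
    obtain ⟨l, hl⟩ := hg.exists_rate_eq hℙ hβ hpos
    refine ⟨l, ?_⟩
    filter_upwards [hl, hg.ae_isRegular] with ω h1 h2
    rw [pointFreeEnergy_bary hxhat h2 hβ, h1]
  choose L hL using hconst
  -- the exceptional sets are collected over a dense sequence, and continuity does the rest
  have hdense := ae_all_iff.2 fun k => hL (TopologicalSpace.denseSeq (riHull R) k)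
  obtain ⟨ω₀, h01, ⟨C, -, h02⟩, h03⟩ := (hcont.and (hC.and hdense)).exists
  have hcoe : ∀ ζ ∈ riHull R, pointFreeEnergy R xhat g ω₀ ζ =
      (((pointFreeEnergy R xhat g ω₀ ζ).toReal : ℝ) : EReal) := fun ζ hζ =>
    (eqOn_coe_toReal h02 (riHull_subset_hull hζ)).symm
  have heq : ∀ᵐ ω ∂ℙ, ∀ ζ ∈ riHull R, pointFreeEnergy R xhat g ω ζ =
      (((pointFreeEnergy R xhat g ω₀ ζ).toReal : ℝ) : EReal) := by
    filter_upwards [hcont, hdense] with ω h1 h2 ζ hζ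
    rw [← hcoe ζ hζ]
    have h3 := Continuous.ext_on (TopologicalSpace.denseRange_denseSeq (riHull R))
      (continuousOn_iff_continuous_domRestrict.1 h1) (continuousOn_iff_continuous_domRestrict.1 h01)
      (by
        rintro _ ⟨k, rfl⟩
        exact (h2 k).trans (h03 k).symm)
    exact congrFun h3 ⟨ζ, hζ⟩
  refine ⟨_, ⟨convex_riHull, ?_⟩, heq⟩
  intro ζ hζ ξ hξ a b ha hb hab
  rcases ha.eq_or_lt with rfl | ha
  · obtain rfl : b = 1 := by linarith
    simp
  rcases hb.eq_or_lt with rfl | hb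
  · obtain rfl : a = 1 := by linarith
    simp
  have hmem := convex_riHull hζ hξ ha.le hb.le hab
  obtain ⟨β, hβ, -, rfl⟩ := mem_riHull_iff.1 hζ
  obtain ⟨γ, hγ, -, rfl⟩ := mem_riHull_iff.1 hξ
  have hrate : ∀ {κ : R → ℝ}, κ ∈ stdSimplex ℝ R → bary R κ ∈ riHull R → ∀ᵐ ω ∂ℙ,
      rate (logPart g ω) κ = (((pointFreeEnergy R xhat g ω₀ (bary R κ)).toReal : ℝ) : EReal) := by
    intro κ hκ hκri
    filter_upwards [heq, hg.ae_isRegular] with ω h1 h2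
    rw [← h1 _ hκri, pointFreeEnergy_bary hxhat h2 hκ]
  have hcomb : a • β + b • γ ∈ stdSimplex ℝ R := convex_stdSimplex ℝ R hβ hγ ha.le hb.le hab
  rw [← bary_combo] at hmem
  obtain ⟨ω, h1, h2⟩ := ((hg.ae_rate_concave hβ hγ ha hb hab (hrate hβ hζ) (hrate hγ hξ)).and
    (hrate hcomb hmem)).exists
  rw [h2, EReal.coe_le_coe_iff] at h1
  simp only [smul_eq_mul, ← bary_combo]
  exact h1

end FreeEnergy

end RWRP

end

theorem mainTheorem3 {d ℓ : ℕ} (R : Finset (Fin d → ℤ)) [Nonempty R]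
    {Ω : Type*} [MeasurableSpace Ω] [AddAction (RWRP.stepGroup R) Ω]
    [MeasurableConstVAdd (RWRP.stepGroup R) Ω]
    (ℙ : Measure Ω) [IsProbabilityMeasure ℙ] [VAddInvariantMeasure (RWRP.stepGroup R) Ω ℙ]
    (hℙ : RWRP.IsErgodic R ℙ)
    (g : Ω → (Fin ℓ → R) → ℝ) (hg : RWRP.MemClassL R ℙ g)
    (xhat : EuclideanSpace ℝ (Fin d) → ℕ → Fin d → ℤ)
    (hxhat : ∀ ζ ∈ RWRP.hull R, RWRP.IsLatticeApprox R ζ (xhat ζ)) :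
    -- the limits defining the point-to-point free energy exist in `(-∞, ∞]`
    (∀ᵐ ω ∂ℙ, ∀ ζ ∈ RWRP.hull R,
      Tendsto (fun n => RWRP.logPartitionAt R g ω n (xhat ζ n)) atTop
        (𝓝 (RWRP.pointFreeEnergy R xhat g ω ζ)) ∧
      ⊥ < RWRP.pointFreeEnergy R xhat g ω ζ) ∧
    -- the free energy exists in `(-∞, ∞]` and is deterministic, with value `c`
    ∃ c : EReal, ⊥ < c ∧
      (∀ᵐ ω ∂ℙ, Tendsto (RWRP.logPartition R g ω) atTop (𝓝 (RWRP.freeEnergy R g ω)) ∧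
        RWRP.freeEnergy R g ω = c) ∧
      -- (a)
      (c = ⊤ → ∀ᵐ ω ∂ℙ, ∀ ζ ∈ RWRP.riHull R, RWRP.pointFreeEnergy R xhat g ω ζ = ⊤) ∧
      -- (b)
      (c < ⊤ →
        (∀ᵐ ω ∂ℙ,
          LowerSemicontinuousOn (RWRP.pointFreeEnergy R xhat g ω) (RWRP.hull R) ∧
          (∃ C : ℝ, ∀ ζ ∈ RWRP.hull R, ((-C : ℝ) : EReal) ≤ RWRP.pointFreeEnergy R xhat g ω ζ ∧
            RWRP.pointFreeEnergy R xhat g ω ζ ≤ (C : EReal)) ∧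
          ConcaveOn ℝ (RWRP.riHull R) (fun ζ => (RWRP.pointFreeEnergy R xhat g ω ζ).toReal) ∧
          ContinuousOn (RWRP.pointFreeEnergy R xhat g ω) (RWRP.riHull R)) ∧
        -- one nonrandom function `h` is a.s. the unique continuous extension of the
        -- point-to-point free energy and its upper semicontinuous regularization on `U`
        ∃ h : EuclideanSpace ℝ (Fin d) → ℝ, ∀ᵐ ω ∂ℙ,
          RWRP.IsContExtension R (RWRP.pointFreeEnergy R xhat g ω) h ∧
          (∀ h' : EuclideanSpace ℝ (Fin d) → ℝ,
            RWRP.IsContExtension R (RWRP.pointFreeEnergy R xhat g ω) h' →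
              Set.EqOn h' h (RWRP.hull R)) ∧
          ∀ ζ ∈ RWRP.hull R,
            RWRP.uscReg (RWRP.pointFreeEnergy R xhat g ω) ζ = (h ζ : EReal)) := by
  open RWRP in
  have hreg := hg.ae_isRegular
  have hF : ∀ {ω}, IsRegular (fun z : R => (z : Fin d → ℤ)) (logPart g ω) →
      ∀ β ∈ stdSimplex ℝ R, pointFreeEnergy R xhat g ω (bary R β) = rate (logPart g ω) β :=
    fun h β hβ => pointFreeEnergy_bary hxhat h hβ
  obtain ⟨c, hc⟩ := hg.exists_iSup_rate_eq hℙ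
  have hfree : ∀ᵐ ω ∂ℙ, Tendsto (logPartition R g ω) atTop (𝓝 c) := by
    filter_upwards [hc, hreg] with ω h1 h2
    rw [← h1]
    exact (tendsto_logTotal g h2).congr fun n => (logPartition_eq g ω n).symm
  refine ⟨?_, c, ?_, ?_, ?_, ?_⟩
  · filter_upwards [hreg] with ω h1 ζ hζ
    obtain ⟨K, -, hK⟩ := exists_neg_le h1 (hF h1)
    refine ⟨?_, (EReal.bot_lt_coe _).trans_le (hK ζ hζ)⟩
    obtain ⟨β, hβ, rfl⟩ := (hull_eq_image (R := R)).le hζ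
    rw [hF h1 β hβ]
    exact tendsto_logPartitionAt h1 hβ (hxhat _ hζ)
  · obtain ⟨ω, h1, h2⟩ := (hc.and hreg).exists
    obtain ⟨K, -, hK⟩ := h2.rate_ge
    obtain ⟨z⟩ := ‹Nonempty R›
    classical
    have h3 := hK _ (single_mem_stdSimplex ℝ z)
    rw [← h1]
    exact (EReal.bot_lt_coe _).trans_le
      (h3.trans (le_iSup₂ (f := fun β (_ : β ∈ stdSimplex ℝ R) => rate (logPart g ω) β) _
        (single_mem_stdSimplex ℝ z)))
  · filter_upwards [hfree] with ω h1
    rw [freeEnergy, h1.limUnder_eq]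
    exact ⟨h1, rfl⟩
  · rintro rfl
    filter_upwards [hc, hreg] with ω h1 h2 ζ hζ
    exact eq_top_of_iSup_eq_top h2 (hF h2) h1 hζ
  · intro hctop
    have hbound : ∀ᵐ ω ∂ℙ, ∃ C : ℝ, 0 ≤ C ∧ ∀ ζ ∈ hull R,
        ((-C : ℝ) : EReal) ≤ pointFreeEnergy R xhat g ω ζ ∧
          pointFreeEnergy R xhat g ω ζ ≤ C := by
      obtain ⟨B, hcB, -⟩ := EReal.lt_iff_exists_real_btwn.1 hctop
      filter_upwards [hc, hreg] with ω h1 h2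
      obtain ⟨K, hK0, hK⟩ := exists_neg_le h2 (hF h2)
      refine ⟨max K B, hK0.trans (le_max_left _ _), fun ζ hζ => ⟨?_, ?_⟩⟩
      · exact (EReal.coe_le_coe_iff.2 (neg_le_neg (le_max_left _ _))).trans (hK ζ hζ)
      · obtain ⟨β, hβ, rfl⟩ := (hull_eq_image (R := R)).le hζ
        rw [hF h2 β hβ]
        refine (le_iSup₂ (f := fun β (_ : β ∈ stdSimplex ℝ R) => rate (logPart g ω) β) β hβ).trans ?_
        rw [h1]
        exact hcB.le.trans (EReal.coe_le_coe_iff.2 (le_max_right _ _))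
    obtain ⟨f, hf, hfeq⟩ := hg.exists_concave_profile hxhat hℙ hbound
    have hb : ∀ᵐ ω ∂ℙ,
        LowerSemicontinuousOn (pointFreeEnergy R xhat g ω) (hull R) ∧
        (∃ C : ℝ, ∀ ζ ∈ hull R, ((-C : ℝ) : EReal) ≤ pointFreeEnergy R xhat g ω ζ ∧
          pointFreeEnergy R xhat g ω ζ ≤ (C : EReal)) ∧
        ConcaveOn ℝ (riHull R) (fun ζ => (pointFreeEnergy R xhat g ω ζ).toReal) ∧
        ContinuousOn (pointFreeEnergy R xhat g ω) (riHull R) := by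
      filter_upwards [hreg, hbound, hfeq] with ω h1 ⟨C, hC0, hC⟩ h3
      have hs := segmentLower_toReal h1 (hF h1) hC0 hC
      exact ⟨lowerSemicontinuousOn_of_toReal hC hs, ⟨C, hC⟩,
        hf.congr fun ζ hζ => by simp only [h3 ζ hζ, EReal.toReal_coe],
        continuousOn_of_toReal hC hs⟩
    refine ⟨hb, ?_⟩
    obtain ⟨ω₀, ⟨-, ⟨C, hC⟩, -, hcont⟩, heq⟩ := (hb.and hfeq).exists
    have hfC : ∀ ζ ∈ riHull R, |f ζ| ≤ C := fun ζ hζ => by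
      have h1 := hC ζ (riHull_subset_hull hζ)
      rw [heq ζ hζ, EReal.coe_le_coe_iff, EReal.coe_le_coe_iff] at h1
      exact abs_le.2 h1
    have hfcont : ContinuousOn f (riHull R) := by
      have h1 : ContinuousOn (fun ζ => (f ζ : EReal)) (riHull R) :=
        hcont.congr fun ζ hζ => (heq ζ hζ).symm
      exact (EReal.isEmbedding_coe.continuousOn_iff).2 h1
    obtain ⟨h, hh, hhf⟩ := exists_continuous_extension hf hfcont hfC
    refine ⟨h, ?_⟩
    filter_upwards [hb, hfeq] with ω ⟨h1, _⟩ h2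
    have hext : IsContExtension R (pointFreeEnergy R xhat g ω) h :=
      ⟨hh, fun ζ hζ => by rw [h2 ζ hζ, hhf hζ]⟩
    exact ⟨hext, fun h' hh' => eqOn_of_isContExtension hext hh', fun ζ hζ =>
      uscReg_eq_of_isContExtension hext (fun ζ' hζ' => le_of_isContExtension h1 hext hζ')
        (fun ζ' hζ' => if_neg hζ') hζ⟩
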